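/- Let $n\ge 1$, $0<\beta_{0,1}<\dots<\beta_{0,n}$, $\alpha_1,\dots,\alpha_n>0$, and let $u_0(x,t)=-2\,\frac{d^2}{dx^2}\log \mathrm{Wr}(a_1,\dots,a_n)(x,t)$ be the KdV $n$-soliton, where $\mathrm{Wr}$ is the Wronskian in $x$ and $a_j(x,t)=(-1)^{j+1}e^{-\beta_{0,j}(x-4\beta_{0,j}^2t)}+\alpha_je^{\beta_{0,j}(x-4\beta_{0,j}^2t)}$. For real $u$ with $|u|_{L^1_2}:=\int_{\mathbb R}(1+x^2)|u(x)|\,dx<\infty$ and $\operatorname{Im}k\ge 0$, let $f_\pm(x,k)$ be the Jost solutions, i.e. $-f_\pm''+uf_\pm=k^2f_\pm$ and $f_\pm(x,k)e^{\mp ikx}\to1$ as $x\to\pm\infty$, and let the transmission coefficient $T(k)$ be given by $\frac1{T(k)}=-\frac1{2ik}\left(f_+f_-'-f_+'f_-\right)$. The bound states of $u$ are the numbers $\beta>0$ such that $i\beta$ is a simple pole of $T$, and the norming constant at a bound state $\beta$ is $\gamma=\left(\int_{\mathbb R}f_+(x,i\beta)^2dx\right)^{-1}$. Let $\gamma_{0,j}$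 be the norming constant of $u_0(\cdot,0)$ at $\beta_{0,j}$, and let $\mathfrak d$ be the greatest integer (strictly) less than $1+\int_{\mathbb R}|s\,u_0(s,0)|\,ds$. Lemma. For every $\sigma>2$ there is a constant $C>0$ (depending only on $u_0$ and $\sigma$) such that, whenever $0<\epsilon<\frac{\beta_{0,1}}2$, $\epsilon<\frac{|\beta_{0,j}-\beta_{0,j'}|}2$ for all $j\ne j'$, and $v$ is real-valued with $|v|_{L^1_2}\le \epsilon^\sigma/C$, the potential $u_0(x,0)+v(x)$ has finitely many bound states $\beta_{v,1}<\dots<\beta_{v,\mu}$, with norming constants $\gamma_{v,1},\dots,\gamma_{v,\mu}$, and $$n\le\mu\le\mathfrak d,$$ $$|\beta_{v,\mu-n+j}-\beta_{0,j}|<\epsilon,\qquad |\gamma_{v,\mu-n+j}-\gamma_{0,j}|<C\epsilon\qquad(1\le j\le n),$$ $$|\beta_{v,j'}|<\epsilon\qquad(1\le j'\le\mu-n).$$ -/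

import Mathlib

open MeasureTheory Filter Topology

noncomputable section

namespace KdV

/-! ### The multi-soliton -/

/-- The exponential `a_j(x,t) = (-1)^(j+1) e^(-β_j (x - 4 β_j² t)) + α_j e^(β_j (x - 4 β_j² t))`.
The index `j : Fin n` starts at `0`, so the sign is `(-1)^j`. -/
def expSum {n : ℕ} (β α : Fin n → ℝ) (j : Fin n) (x t : ℝ) : ℝ :=
  (-1) ^ (j : ℕ) * Real.exp (-(β j * (x - 4 * β j ^ 2 * t)))
    + α j * Real.exp (β j * (x - 4 * β j ^ 2 * t))

/-- The Wronskian determinant `Wr(a_1, …, a_n)(x,t)`, with derivatives in `x`. -/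
def solitonWronskian {n : ℕ} (β α : Fin n → ℝ) (x t : ℝ) : ℝ :=
  (Matrix.of fun i j : Fin n =>
    iteratedDeriv (i : ℕ) (fun y : ℝ => expSum β α j y t) x).det

/-- The `n`-soliton `u₀(x,t) = -2 (d²/dx²) log Wr(a_1, …, a_n)`. -/
def nSoliton {n : ℕ} (β α : Fin n → ℝ) (x t : ℝ) : ℝ :=
  -2 * iteratedDeriv 2 (fun y : ℝ => Real.log (solitonWronskian β α y t)) x

/-! ### The weighted space `L¹₂` -/

/-- `φ ∈ L¹₂`, that is `(1 + |x|²) φ ∈ L¹(ℝ)`. -/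
def MemL12 (φ : ℝ → ℝ) : Prop :=
  Integrable (fun x : ℝ => (1 + |x| ^ 2) * φ x)

/-- The norm `|φ|_{L¹₂} = |(1 + |x|²) φ|_{L¹}`. -/
def normL12 (φ : ℝ → ℝ) : ℝ :=
  ∫ x : ℝ, |(1 + |x| ^ 2) * φ x|

/-! ### Direct scattering for the Schrödinger equation `-f'' + u f = k² f` -/

/-- `f` solves `-f'' + u f = k² f`. As `u` is only an integrable function, this is meant in the
Carathéodory sense: `f` is differentiable and `f'` is a primitive of `(u - k²) f`. -/
def IsSchrodingerSolution (u : ℝ → ℝ) (k : ℂ) (f : ℝ → ℂ) : Prop :=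
  Differentiable ℝ f ∧
    ∀ x y : ℝ, deriv f y - deriv f x = ∫ s in x..y, ((u s : ℂ) - k ^ 2) * f s

/-- `f` is a right Jost solution: `m₊(x) = f(x) e^(-ikx) → 1` as `x → +∞`. -/
def IsJostPlus (u : ℝ → ℝ) (k : ℂ) (f : ℝ → ℂ) : Prop :=
  IsSchrodingerSolution u k f ∧
    Tendsto (fun x : ℝ => f x * Complex.exp (-(Complex.I * k * x))) atTop (𝓝 1)

/-- `f` is a left Jost solution: `m₋(x) = f(x) e^(ikx) → 1` as `x → -∞`. -/
def IsJostMinus (u : ℝ → ℝ) (k : ℂ) (f : ℝ → ℂ) : Prop :=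
  IsSchrodingerSolution u k f ∧
    Tendsto (fun x : ℝ => f x * Complex.exp (Complex.I * k * x)) atBot (𝓝 1)

/-- The Jost function `f₊(·,k)`; for `u ∈ L¹₂` and `Im k ≥ 0` it exists and is unique. -/
def jostPlus (u : ℝ → ℝ) (k : ℂ) : ℝ → ℂ :=
  Classical.epsilon (IsJostPlus u k)

/-- The Jost function `f₋(·,k)`; for `u ∈ L¹₂` and `Im k ≥ 0` it exists and is unique. -/
def jostMinus (u : ℝ → ℝ) (k : ℂ) : ℝ → ℂ :=
  Classical.epsilon (IsJostMinus u k)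

/-- The Wronskian `Wr(f,g) = f g' - f' g`. -/
def wronskian (f g : ℝ → ℂ) (x : ℝ) : ℂ :=
  f x * deriv g x - deriv f x * g x

/-- The transmission coefficient: `1 / T(k) = -(1 / (2ik)) Wr(f₊(·,k), f₋(·,k))`, the Wronskian
being independent of the point `x` at which it is taken. -/
def transmission (u : ℝ → ℝ) (k : ℂ) : ℂ :=
  (-(1 / (2 * Complex.I * k)) * wronskian (jostPlus u k) (jostMinus u k) 0)⁻¹

/-- The bound states of `u`: the `β > 0` such that `iβ` is a simple pole of `T`. -/
def boundStates (u : ℝ → ℝ) : Set ℝ :=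
  {β : ℝ | 0 < β ∧
    meromorphicOrderAt (transmission u) (Complex.I * β) = ((-1 : ℤ) : WithTop ℤ)}

/-- `b 0 < b 1 < ⋯ < b (μ - 1)` is the complete list of the bound states of `u`. -/
def IsBoundStateList (u : ℝ → ℝ) (μ : ℕ) (b : Fin μ → ℝ) : Prop :=
  StrictMono b ∧ Set.range b = boundStates u

/-- The norming constant `γ₊ = (∫ f₊(x,iβ)² dx)⁻¹` at a bound state `β`. -/
def normingConstant (u : ℝ → ℝ) (β : ℝ) : ℂ :=
  (∫ x : ℝ, jostPlus u (Complex.I * β) x ^ 2)⁻¹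

/-- The greatest integer (strictly) less than `1 + ∫ |s u(s)| ds`. -/
def boundStateBound (u : ℝ → ℝ) : ℤ :=
  ⌈1 + ∫ s : ℝ, |s * u s|⌉ - 1

theorem boundStateBound_isGreatest (u : ℝ → ℝ) :
    IsGreatest {m : ℤ | (m : ℝ) < 1 + ∫ s : ℝ, |s * u s|} (boundStateBound u) := by
  constructor
  · have h : boundStateBound u < ⌈1 + ∫ s : ℝ, |s * u s|⌉ := sub_one_lt _
    exact Int.lt_ceil.mp h
  · intro m hm
    exact Int.le_sub_one_of_lt (Int.lt_ceil.mpr hm)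

/-- The index `μ - n + j` of the `j`-th among the `n` largest of `μ` bound states. -/
def topIndex {n μ : ℕ} (h : n ≤ μ) (j : Fin n) : Fin μ :=
  ⟨μ - n + (j : ℕ), by have := j.isLt; omega⟩

end KdV

end

/-! Up to a nonvanishing analytic factor, `1/T` is the Wronskian `jostW u` of the two Jost
solutions, so bound states are the simple zeros of `jostW u` on the positive imaginary axis
(`mem_boundStates_iff`). There, at `k = iκ`, it is real-valued, and for the soliton it is `2κ ∏ (κ -
β_j)/(κ + β_j)` (`jostW_nSoliton`): a function whose only zeros on `[0, ∞)` are `0` and the `β_j`,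
all simple.

The key point is that adding `v` changes this function by a small amount in the Lipschitz sense.
Both the change itself and its Lipschitz constant in `k` are `O(‖v‖)`, uniformly over the upper
half-plane, with no loss as `k → 0` (`norm_jostW_add_sub_le`, `norm_jostW_second_diff_le`). The
second moment of the potentials pays for this uniformity. By `exists_zeros_of_close` the perturbed
function is then still expansive near each old zero: it has exactly one zero near each `β_j` by the
intermediate value theorem, at most one near `0`, none elsewhere, and all of them are simple. Hence
`μ` is `n` or `n + 1`.

The upper bound on `μ` therefore reduces to `n < ∫ |s u₀(s)| ds` (`lt_integral_abs_mul_nSoliton`).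
Expanding the Wronskian of the `a_j` gives a sum of exponentials with positive coefficients, and
integrating `s (log W)''` by parts on both half-lines leaves `2 log W(0)` minus the logarithms of
the two extreme coefficients. The arithmetic-geometric inequality bounds this below by `n log 4`.

The formula for `jostW_nSoliton` comes from an explicit Jost solution `e^(-κx) N/W`, verified by
`bilinear_identity`: the expression to be shown zero is a polynomial of degree less than `n` in the
spectral parameter, subject to `n` linear conditions whose determinant is `W ≠ 0`.

At a bound state the two Jost solutions are proportional, so the norming constant is a smooth
function of half-line data (`normingConstant_eq`), each entry of which is Lipschitz in `v` and `κ`.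
This gives `exists_normingConstant_lipschitz`.

All analysis of Jost solutions goes through the Volterra equation `m = 1 + V m` for `m = f₊
e^(-ikx)`, solved by a Neumann series and estimated by a Gronwall inequality; left Jost solutions
are obtained by reflecting the potential. -/

noncomputable section

namespace KdV

/-! ### Primitives of locally integrable functions -/

/-- `Q` is a primitive of the locally integrable function `q`. -/
def IsPrim (Q q : ℝ → ℂ) : Prop :=
  LocallyIntegrable q ∧ ∀ a b : ℝ, Q b - Q a = ∫ s in a..b, q s

theorem LocallyIntegrable.intervalIntegrable' {q : ℝ → ℂ} (hq : LocallyIntegrable q) (a b : ℝ) :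
    IntervalIntegrable q volume a b :=
  (hq.integrableOn_isCompact isCompact_uIcc).intervalIntegrable

/-- Write `f = (Re f)·1 + (Im f)·i`. This carries absolute continuity of indefinite integrals from
real to complex integrands. -/
theorem absolutelyContinuousOnInterval_of_re_im {f : ℝ → ℂ} {a b : ℝ}
    (hr : AbsolutelyContinuousOnInterval (fun x => (f x).re) a b)
    (hi : AbsolutelyContinuousOnInterval (fun x => (f x).im) a b) :
    AbsolutelyContinuousOnInterval f a b := by
  have h : ∀ z : ℂ, AbsolutelyContinuousOnInterval (fun _ : ℝ => z) a b := fun z =>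
    ((LipschitzWith.const z).lipschitzOnWith (s := Set.uIcc a b)).absolutelyContinuousOnInterval
  have key := (hr.fun_smul (h 1)).fun_add (hi.fun_smul (h Complex.I))
  have e : (fun x => (f x).re • (1 : ℂ) + (f x).im • Complex.I) = f := by
    funext x; simp [Complex.re_add_im]
  rwa [e] at key

theorem IsPrim.absolutelyContinuous {Q q : ℝ → ℂ} (h : IsPrim Q q) (a b : ℝ) :
    AbsolutelyContinuousOnInterval Q a b := by
  have hq := LocallyIntegrable.intervalIntegrable' h.1 a b
  have hc : ∀ z : ℝ, AbsolutelyContinuousOnInterval (fun _ : ℝ => z) a b := fun z =>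
    ((LipschitzWith.const z).lipschitzOnWith (s := Set.uIcc a b)).absolutelyContinuousOnInterval
  have hQ : ∀ x, Q x = Q a + ∫ s in a..x, q s := fun x => by rw [← h.2 a x]; ring
  have hi : ∀ x, IntervalIntegrable q volume a x := LocallyIntegrable.intervalIntegrable' h.1 a
  apply absolutelyContinuousOnInterval_of_re_im
  · have h1 : IntervalIntegrable (fun s => (q s).re) volume a b := ⟨hq.1.re, hq.2.re⟩
    have := (hc (Q a).re).fun_add
      (h1.absolutelyContinuousOnInterval_intervalIntegral (c := a) (by simp))
    have e : (fun x => (Q x).re) = fun x => (Q a).re + ∫ s in a..x, (q s).re := by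
      funext x
      rw [hQ x, Complex.add_re]
      congr 1
      have := Complex.reCLM.intervalIntegral_comp_comm (hi x)
      simpa using this.symm
    rwa [e]
  · have h1 : IntervalIntegrable (fun s => (q s).im) volume a b := ⟨hq.1.im, hq.2.im⟩
    have := (hc (Q a).im).fun_add
      (h1.absolutelyContinuousOnInterval_intervalIntegral (c := a) (by simp))
    have e : (fun x => (Q x).im) = fun x => (Q a).im + ∫ s in a..x, (q s).im := by
      funext x
      rw [hQ x, Complex.add_im]
      congr 1
      have := Complex.imCLM.intervalIntegral_comp_comm (hi x)
      simpa using this.symm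
    rwa [e]

theorem IsPrim.continuous {Q q : ℝ → ℂ} (h : IsPrim Q q) : Continuous Q := by
  rw [continuous_iff_continuousAt]
  intro x
  have := (h.absolutelyContinuous (x - 1) (x + 1)).continuousOn
  rw [Set.uIcc_of_le (by linarith)] at this
  exact this.continuousAt (Icc_mem_nhds (by linarith) (by linarith))

theorem IsPrim.ae_hasDerivAt {Q q : ℝ → ℂ} (h : IsPrim Q q) :
    ∀ᵐ x, HasDerivAt Q (q x) x := by
  filter_upwards [LocallyIntegrable.ae_hasDerivAt_integral h.1] with x hx
  have hQ : Q = fun x => Q 0 + ∫ s in (0 : ℝ)..x, q s := by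
    funext x; rw [← h.2 0 x]; ring
  rw [hQ]
  exact (hx 0).const_add _

theorem isPrim_of_hasDerivAt {Q q : ℝ → ℂ} (h : ∀ x, HasDerivAt Q (q x) x) (hq : Continuous q) :
    IsPrim Q q :=
  ⟨hq.locallyIntegrable, fun a b =>
    (intervalIntegral.integral_eq_sub_of_hasDerivAt (fun x _ => h x)
      (hq.intervalIntegrable a b)).symm⟩

theorem IsPrim.hasDerivAt {Q q : ℝ → ℂ} (h : IsPrim Q q) (hq : Continuous q) (x : ℝ) :
    HasDerivAt Q (q x) x := by
  have hQ : Q = fun x => Q 0 + ∫ s in (0 : ℝ)..x, q s := by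
    funext x; rw [← h.2 0 x]; ring
  rw [hQ]
  exact (intervalIntegral.integral_hasDerivAt_right (hq.intervalIntegrable _ _)
    hq.stronglyMeasurable.stronglyMeasurableAtFilter hq.continuousAt).const_add _

theorem IsPrim.add {Q q R r : ℝ → ℂ} (h : IsPrim Q q) (h' : IsPrim R r) :
    IsPrim (fun x => Q x + R x) (fun x => q x + r x) := by
  refine ⟨h.1.add h'.1, fun a b => ?_⟩
  rw [intervalIntegral.integral_add (LocallyIntegrable.intervalIntegrable' h.1 a b)
    (LocallyIntegrable.intervalIntegrable' h'.1 a b), ← h.2, ← h'.2]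
  ring

theorem IsPrim.const_mul {Q q : ℝ → ℂ} (h : IsPrim Q q) (c : ℂ) :
    IsPrim (fun x => c * Q x) (fun x => c * q x) := by
  refine ⟨h.1.smul c, fun a b => ?_⟩
  rw [intervalIntegral.integral_const_mul, ← h.2]
  ring

theorem IsPrim.congr {Q q r : ℝ → ℂ} (h : IsPrim Q q) (h' : ∀ x, q x = r x) : IsPrim Q r := by
  rwa [show r = q from funext fun x => (h' x).symm]

theorem locallyIntegrable_continuous_mul {f q : ℝ → ℂ} (hf : Continuous f)
    (hq : LocallyIntegrable q) : LocallyIntegrable (fun x => f x * q x) := by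
  simpa [mul_comm] using hq.smul_continuous hf

theorem locallyIntegrable_mul_continuous {f q : ℝ → ℂ} (hf : Continuous f)
    (hq : LocallyIntegrable q) : LocallyIntegrable (fun x => q x * f x) := by
  simpa using hq.smul_continuous hf

/-- Product rule for primitives of locally integrable functions. -/
theorem IsPrim.mul {Q q R r : ℝ → ℂ} (h : IsPrim Q q) (h' : IsPrim R r) :
    IsPrim (fun x => Q x * R x) (fun x => q x * R x + Q x * r x) := by
  have hl : LocallyIntegrable (fun x => q x * R x + Q x * r x) := by
    exact (locallyIntegrable_mul_continuous h'.continuous h.1).add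
      (locallyIntegrable_continuous_mul h.continuous h'.1)
  refine ⟨hl, fun a b => ?_⟩
  have hP : IsPrim (fun x => ∫ s in a..x, (q s * R s + Q s * r s))
      (fun x => q x * R x + Q x * r x) := by
    refine ⟨hl, fun c d => ?_⟩
    rw [intervalIntegral.integral_interval_sub_left
      (LocallyIntegrable.intervalIntegrable' hl _ _) (LocallyIntegrable.intervalIntegrable' hl _ _)]
  -- The product minus the candidate primitive is absolutely continuous with zero derivative almost
  -- everywhere, hence constant on the interval.
  have hac := ((h.absolutelyContinuous a b).fun_smul (h'.absolutelyContinuous a b)).fun_sub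
    (hP.absolutelyContinuous a b)
  obtain ⟨C, hC⟩ := hac.const_of_ae_hasDerivAt_zero (by
    filter_upwards [h.ae_hasDerivAt, h'.ae_hasDerivAt, hP.ae_hasDerivAt] with x h1 h2 h3 _
    have := (h1.fun_mul h2).fun_sub h3
    rwa [sub_self] at this)
  have e1 := hC a (by simp)
  have e2 := hC b (by simp)
  simp only [smul_eq_mul, intervalIntegral.integral_same, sub_zero] at e1 e2
  have e3 : Q b * R b = C + ∫ s in a..b, (q s * R s + Q s * r s) := by rw [← e2]; ring
  simp only [e1, e3]
  ring

/-! ### A Gronwall inequality on the line -/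

/-- The weight `exp (-2 ∫_{-∞}^x a)`. -/
def expWeight (a : ℝ → ℝ) (x : ℝ) : ℝ := Real.exp (-(2 * ∫ t in Set.Iic x, a t))

theorem expWeight_pos (a : ℝ → ℝ) (x : ℝ) : 0 < expWeight a x := Real.exp_pos _

theorem expWeight_le_one {a : ℝ → ℝ} (ha : ∀ t, 0 ≤ a t) (x : ℝ) : expWeight a x ≤ 1 := by
  have : 0 ≤ ∫ t in Set.Iic x, a t := integral_nonneg ha
  exact Real.exp_le_one_iff.mpr (by linarith)

theorem le_expWeight {a : ℝ → ℝ} (ha : ∀ t, 0 ≤ a t) (hi : Integrable a) (x : ℝ) :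
    Real.exp (-(2 * ∫ t, a t)) ≤ expWeight a x := by
  have : ∫ t in Set.Iic x, a t ≤ ∫ t, a t :=
    setIntegral_le_integral hi (Eventually.of_forall ha)
  exact Real.exp_le_exp.mpr (by linarith)

theorem setIntegral_Iic_sub {a : ℝ → ℝ} (hi : Integrable a) (x y : ℝ) :
    (∫ t in Set.Iic y, a t) - ∫ t in Set.Iic x, a t = ∫ t in x..y, a t :=
  intervalIntegral.integral_Iic_sub_Iic hi.integrableOn hi.integrableOn

theorem continuous_expWeight {a : ℝ → ℝ} (hi : Integrable a) : Continuous (expWeight a) := by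
  have : (fun x => ∫ t in Set.Iic x, a t) =
      fun x => (∫ t in Set.Iic (0 : ℝ), a t) + ∫ t in (0 : ℝ)..x, a t := by
    funext x
    rw [← setIntegral_Iic_sub hi 0 x]; ring
  unfold expWeight
  have h2 : Continuous fun x => ∫ t in Set.Iic x, a t := by
    rw [this]
    exact continuous_const.add (intervalIntegral.continuous_primitive
      (fun _ _ => hi.intervalIntegrable) 0)
  fun_prop

theorem integrable_mul_expWeight {a : ℝ → ℝ} (ha : ∀ t, 0 ≤ a t) (hi : Integrable a) :
    Integrable fun t => a t * expWeight a t := by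
  refine hi.mul_bdd (c := 1) (continuous_expWeight hi).aestronglyMeasurable ?_
  refine Eventually.of_forall fun t => ?_
  rw [Real.norm_of_nonneg (expWeight_pos a t).le]
  exact expWeight_le_one ha t

/-- The derivative of `expWeight a` is `-2 a · expWeight a` almost everywhere. As `a` is merely
integrable, the fundamental theorem of calculus is applied in its absolutely continuous form. -/
theorem intervalIntegral_mul_expWeight {a : ℝ → ℝ} (ha : ∀ t, 0 ≤ a t) (hi : Integrable a)
    (x y : ℝ) : ∫ t in x..y, a t * expWeight a t = (expWeight a x - expWeight a y) / 2 := by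
  have h1 : AbsolutelyContinuousOnInterval (fun x => ∫ t in Set.Iic x, a t) x y := by
    have : (fun x => ∫ t in Set.Iic x, a t) =
        fun z => (∫ t in Set.Iic x, a t) + ∫ t in x..z, a t := by
      funext z
      rw [← setIntegral_Iic_sub hi x z]; ring
    rw [this]
    have hc : ∀ z : ℝ, AbsolutelyContinuousOnInterval (fun _ : ℝ => z) x y := fun z =>
      ((LipschitzWith.const z).lipschitzOnWith (s := Set.uIcc x y)).absolutelyContinuousOnInterval
    exact (hc _).fun_add (hi.intervalIntegrable.absolutelyContinuousOnInterval_intervalIntegral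
      (by simp))
  have h2 : AbsolutelyContinuousOnInterval (expWeight a) x y := by
    -- Absolute continuity passes from the tail integral to `expWeight` because `p ↦ exp (-2p)` is
    -- 2-Lipschitz on `[0, ∞)`, where these integrals take their values.
    unfold AbsolutelyContinuousOnInterval at h1 ⊢
    refine squeeze_zero (fun t => Finset.sum_nonneg fun i _ => dist_nonneg) (fun t => ?_)
      (by simpa using h1.const_mul 2)
    rw [Finset.mul_sum]
    refine Finset.sum_le_sum fun i _ => ?_
    have hexp : ∀ p q : ℝ, 0 ≤ p → 0 ≤ q →
        |Real.exp (-(2 * p)) - Real.exp (-(2 * q))| ≤ 2 * |p - q| := by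
      have key : ∀ p q : ℝ, 0 ≤ p → p ≤ q →
          |Real.exp (-(2 * p)) - Real.exp (-(2 * q))| ≤ 2 * |p - q| := by
        intro p q hp hpq
        have e1 : Real.exp (-(2 * q)) ≤ Real.exp (-(2 * p)) := Real.exp_le_exp.mpr (by linarith)
        rw [abs_of_nonneg (by linarith), abs_of_nonpos (by linarith)]
        have e2 : Real.exp (-(2 * q)) = Real.exp (-(2 * p)) * Real.exp (-(2 * (q - p))) := by
          rw [← Real.exp_add]; ring_nf
        have e3 := Real.add_one_le_exp (-(2 * (q - p)))
        have e4 : Real.exp (-(2 * p)) ≤ 1 := Real.exp_le_one_iff.mpr (by linarith)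
        have e5 := Real.exp_pos (-(2 * p))
        rw [e2]
        nlinarith
      intro p q hp hq
      rcases le_total p q with h | h
      · exact key p q hp h
      · rw [abs_sub_comm, abs_sub_comm p]; exact key q p hq h
    exact hexp _ _ (integral_nonneg ha) (integral_nonneg ha)
  have h3 := h2.integral_deriv_eq_sub
  have h4 : ∫ t in x..y, deriv (expWeight a) t = ∫ t in x..y, -2 * (a t * expWeight a t) := by
    apply intervalIntegral.integral_congr_ae
    filter_upwards [LocallyIntegrable.ae_hasDerivAt_integral hi.locallyIntegrable] with z hz _
    have : HasDerivAt (fun x => ∫ t in Set.Iic x, a t) (a z) z := by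
      have : (fun x => ∫ t in Set.Iic x, a t) =
          fun z => (∫ t in Set.Iic x, a t) + ∫ t in x..z, a t := by
        funext z
        rw [← setIntegral_Iic_sub hi x z]; ring
      rw [this]
      exact (hz x).const_add _
    have h5 : HasDerivAt (expWeight a) _ z := (this.const_mul 2).fun_neg.exp
    rw [h5.deriv, expWeight]; ring
  rw [h4, intervalIntegral.integral_const_mul] at h3
  linarith

/-- The factor `1/2` is the purpose of the weight: in the supremum norm weighted by `expWeight a`,
integrating against `a` over `(x, ∞)` is a contraction, whatever the size of `a`. -/
theorem setIntegral_Ioi_mul_expWeight_le {a : ℝ → ℝ} (ha : ∀ t, 0 ≤ a t) (hi : Integrable a)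
    (x : ℝ) : ∫ t in Set.Ioi x, a t * expWeight a t ≤ expWeight a x / 2 := by
  have h := intervalIntegral_tendsto_integral_Ioi x
    (integrable_mul_expWeight ha hi).integrableOn tendsto_id
  refine le_of_tendsto h (Eventually.of_forall fun y => ?_)
  rw [id, intervalIntegral_mul_expWeight ha hi]
  linarith [expWeight_pos a y]

/-- A Gronwall inequality for bounded functions: `h ≤ c + ∫_x^∞ a h` implies
`h ≤ 2 c exp (2 ∫ a)`. -/
theorem gronwall_Ioi {a h : ℝ → ℝ} {c M : ℝ} (ha : ∀ t, 0 ≤ a t) (hi : Integrable a)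
    (hm : AEStronglyMeasurable h) (h0 : ∀ t, 0 ≤ h t) (hM : ∀ t, h t ≤ M) (hc : 0 ≤ c)
    (H : ∀ x, h x ≤ c + ∫ t in Set.Ioi x, a t * h t) (x : ℝ) :
    h x ≤ 2 * c * Real.exp (2 * ∫ t, a t) := by
  set E := Real.exp (-(2 * ∫ t, a t)) with hE
  have hE0 : 0 < E := Real.exp_pos _
  have hEe : Real.exp (2 * ∫ t, a t) = E⁻¹ := by rw [hE, Real.exp_neg, inv_inv]
  have hcE : 0 ≤ c / E := by positivity
  -- The weighted supremum is finite because `h` is bounded and the weight is at least `E`. The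
  -- hypothesis yields `S ≤ c / E + S / 2`, and the last term is absorbed; `M` leaves no trace in
  -- the bound.
  set S := ⨆ t, h t / expWeight a t with hS
  have hbd : BddAbove (Set.range fun t => h t / expWeight a t) := by
    refine ⟨M / E, ?_⟩
    rintro _ ⟨t, rfl⟩
    exact div_le_div₀ ((h0 t).trans (hM t)) (hM t) hE0 (le_expWeight ha hi t)
  have hle : ∀ t, h t ≤ S * expWeight a t := fun t => by
    rw [← div_le_iff₀ (expWeight_pos a t)]
    exact le_ciSup hbd t
  have hS0 : 0 ≤ S := le_trans (div_nonneg (h0 0) (expWeight_pos a 0).le) (le_ciSup hbd 0)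
  have hint : Integrable fun t => a t * h t := by
    refine hi.mul_bdd (c := M) hm (Eventually.of_forall fun t => ?_)
    rw [Real.norm_of_nonneg (h0 t)]; exact hM t
  have key : ∀ t, h t / expWeight a t ≤ c / E + S / 2 := by
    intro t
    rw [div_le_iff₀ (expWeight_pos a t)]
    have h1 : ∫ s in Set.Ioi t, a s * h s ≤ S * (expWeight a t / 2) := by
      calc _ ≤ ∫ s in Set.Ioi t, S * (a s * expWeight a s) := by
            refine setIntegral_mono hint.integrableOn
              ((integrable_mul_expWeight ha hi).const_mul S).integrableOn fun s => ?_
            have := mul_le_mul_of_nonneg_left (hle s) (ha s)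
            simp only
            linarith
        _ ≤ _ := by
            rw [integral_const_mul]
            exact mul_le_mul_of_nonneg_left (setIntegral_Ioi_mul_expWeight_le ha hi t) hS0
    have h2 : c ≤ c / E * expWeight a t := by
      rw [div_mul_eq_mul_div, le_div_iff₀ hE0]
      exact mul_le_mul_of_nonneg_left (le_expWeight ha hi t) hc
    nlinarith [H t]
  have hS2 : S ≤ c / E + S / 2 := ciSup_le key
  rw [hEe]
  have h3 : S * expWeight a x ≤ S * 1 := mul_le_mul_of_nonneg_left (expWeight_le_one ha x) hS0
  have : 2 * c * E⁻¹ = 2 * (c / E) := by ring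
  rw [this]
  linarith [hle x]

end KdV

end

noncomputable section

namespace KdV

/-! ### Holomorphic dependence of integrals on a parameter -/

/-- Domination of the integrand alone suffices: Cauchy's estimate on discs of radius `r` dominates
its `k`-derivative by `b / r`. -/
theorem differentiableOn_integral_of_norm_le {U : Set ℂ} (hU : IsOpen U) {F : ℂ → ℝ → ℂ}
    {b : ℝ → ℝ} (hb : Integrable b) (hm : ∀ k ∈ U, AEStronglyMeasurable (F k))
    (hd : ∀ t, DifferentiableOn ℂ (fun k => F k t) U) (hB : ∀ k ∈ U, ∀ t, ‖F k t‖ ≤ b t) :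
    DifferentiableOn ℂ (fun k => ∫ t, F k t) U := by
  intro k₀ hk₀
  obtain ⟨R, hR, hRU⟩ := Metric.isOpen_iff.mp hU k₀ hk₀
  set r := R / 4 with hr
  have hr0 : 0 < r := by positivity
  have hball : ∀ k ∈ Metric.ball k₀ r, Metric.closedBall k r ⊆ U := by
    intro k hk z hz
    apply hRU
    rw [Metric.mem_ball] at hk ⊢
    rw [Metric.mem_closedBall] at hz
    have := dist_triangle z k k₀
    linarith
  have hmem : ∀ k ∈ Metric.ball k₀ r, k ∈ U := fun k hk =>
    hball k hk (Metric.mem_closedBall_self hr0.le)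
  have hda : ∀ k ∈ U, ∀ t, DifferentiableAt ℂ (fun k => F k t) k := fun k hk t =>
    (hd t).differentiableAt (hU.mem_nhds hk)
  refine DifferentiableAt.differentiableWithinAt (HasDerivAt.differentiableAt
    (hasDerivAt_integral_of_dominated_loc_of_deriv_le (F := F)
      (F' := fun k t => deriv (fun z => F z t) k) (bound := fun t => b t / r)
      (Metric.ball_mem_nhds k₀ hr0) ?_ ?_ ?_ ?_ (hb.div_const r) ?_).2)
  · filter_upwards [hU.mem_nhds hk₀] with k hk using hm k hk
  · exact hb.mono' (hm k₀ hk₀) (Eventually.of_forall (hB k₀ hk₀))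
  -- Measurability of the derivative at `k₀`: it is a pointwise limit of difference quotients along
  -- this sequence. The shift by `2` keeps every point strictly inside the ball of radius `r`.
  · have hseq : Tendsto (fun n : ℕ => k₀ + (r / (n + 2 : ℝ) : ℝ)) atTop (𝓝[≠] k₀) := by
      rw [tendsto_nhdsWithin_iff]
      constructor
      · have : Tendsto (fun n : ℕ => (r / (n + 2 : ℝ))) atTop (𝓝 0) :=
          tendsto_const_nhds.div_atTop
            (tendsto_atTop_add_const_right _ _ tendsto_natCast_atTop_atTop)
        have := (Complex.continuous_ofReal.tendsto 0).comp this
        simpa using this.const_add k₀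
      · refine Eventually.of_forall fun n => ?_
        have : (0 : ℝ) < r / (n + 2 : ℝ) := by positivity
        simp only [Set.mem_compl_iff, Set.mem_singleton_iff, add_eq_left]
        exact_mod_cast this.ne'
    refine aestronglyMeasurable_of_tendsto_ae (u := atTop)
      (f := fun (n : ℕ) t => slope (fun z => F z t) k₀ (k₀ + (r / (n + 2 : ℝ) : ℝ))) ?_ ?_
    · intro n
      have hmn : k₀ + ((r / (n + 2 : ℝ) : ℝ) : ℂ) ∈ U := by
        apply hmem
        have h1 : r / (n + 2 : ℝ) < r := by
          rw [div_lt_iff₀ (by positivity)]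
          nlinarith [Nat.cast_nonneg (α := ℝ) n]
        have h2 : (0 : ℝ) ≤ r / (n + 2 : ℝ) := by positivity
        rw [Metric.mem_ball, dist_eq_norm, add_sub_cancel_left, Complex.norm_real,
          Real.norm_of_nonneg h2]
        exact h1
      simp only [slope_def_module, smul_eq_mul]
      exact ((hm _ hmn).sub (hm _ hk₀)).const_mul _
    · refine Eventually.of_forall fun t => ?_
      exact (hasDerivAt_iff_tendsto_slope.mp (hda k₀ hk₀ t).hasDerivAt).comp hseq
  · refine Eventually.of_forall fun t k hk => ?_
    refine Complex.norm_deriv_le_of_forall_mem_sphere_norm_le hr0 ?_ ?_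
    · refine DifferentiableOn.diffContOnCl ((hd t).mono ?_)
      rw [closure_ball _ hr0.ne']
      exact hball k hk
    · intro z hz
      exact hB z (hball k hk (Metric.sphere_subset_closedBall hz)) t
  · exact Eventually.of_forall fun t k hk => (hda k (hmem k hk) t).hasDerivAt

/-! ### The Volterra kernel -/

/-- The kernel `(e^(2iky) - 1) / (2ik)` for `y > 0`, extended by zero. -/
def kern (k : ℂ) (y : ℝ) : ℂ :=
  (Complex.exp (2 * Complex.I * k * (max y 0 : ℝ)) - 1) / (2 * Complex.I * k)

theorem kern_of_nonpos (k : ℂ) {y : ℝ} (hy : y ≤ 0) : kern k y = 0 := by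
  simp [kern, max_eq_right hy]

theorem continuous_kern (k : ℂ) : Continuous (kern k) := by
  unfold kern
  fun_prop

theorem ne_zero_of_im_pos {k : ℂ} (hk : 0 < k.im) : k ≠ 0 := by
  rintro rfl; simp at hk

/-- The integrand has modulus at most `1`, so this form gives bounds that survive the singular
denominator as `k → 0`. -/
theorem kern_eq_integral {k : ℂ} (hk : 0 < k.im) (y : ℝ) :
    kern k y = ∫ s in (0 : ℝ)..max y 0, Complex.exp (2 * Complex.I * k * s) := by
  have hc : 2 * Complex.I * k ≠ 0 := by simp [ne_zero_of_im_pos hk]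
  rw [integral_exp_mul_complex hc, kern]
  simp

theorem re_two_I_mul (k : ℂ) (s : ℝ) : (2 * Complex.I * k * s).re = -(2 * k.im * s) := by
  simp [Complex.mul_re, Complex.mul_im]

theorem norm_exp_two_I_mul_le {k : ℂ} (hk : 0 < k.im) {s : ℝ} (hs : 0 ≤ s) :
    ‖Complex.exp (2 * Complex.I * k * s)‖ ≤ 1 := by
  rw [Complex.norm_exp, re_two_I_mul]
  exact Real.exp_le_one_iff.mpr (by have := mul_nonneg hk.le hs; linarith)

/-- The left half-plane is convex and `|exp'| ≤ 1` there. -/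
theorem norm_exp_sub_exp_le {z w : ℂ} (hz : z.re ≤ 0) (hw : w.re ≤ 0) :
    ‖Complex.exp z - Complex.exp w‖ ≤ ‖z - w‖ := by
  have hconv : Convex ℝ {z : ℂ | z.re ≤ 0} := convex_halfSpace_re_le 0
  have := hconv.norm_image_sub_le_of_norm_deriv_le (f := Complex.exp) (C := 1) (x := w) (y := z)
    (fun x _ => Complex.differentiable_exp x) (fun x hx => by
      rw [Complex.deriv_exp, Complex.norm_exp]
      exact Real.exp_le_one_iff.mpr hx) hw hz
  simpa using this

theorem norm_kern_le {k : ℂ} (hk : 0 < k.im) (y : ℝ) : ‖kern k y‖ ≤ max y 0 := by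
  rw [kern_eq_integral hk]
  have := intervalIntegral.norm_integral_le_of_norm_le_const (a := 0) (b := max y 0) (C := 1)
    (f := fun s : ℝ => Complex.exp (2 * Complex.I * k * s)) (fun s hs => by
      rw [Set.uIoc_of_le (le_max_right _ _)] at hs
      exact norm_exp_two_I_mul_le hk hs.1.le)
  simpa [abs_of_nonneg (le_max_right y 0)] using this

/-- Complements `norm_kern_le`. Being bounded in `y`, it needs no moments of the potential and
serves for existence and analyticity; `norm_kern_le` is uniform in `k` and serves for perturbation
estimates. -/
theorem norm_kern_le_inv {k : ℂ} (hk : 0 < k.im) (y : ℝ) : ‖kern k y‖ ≤ ‖k‖⁻¹ := by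
  have hk0 : 0 < ‖k‖ := norm_pos_iff.mpr (ne_zero_of_im_pos hk)
  have h1 : ‖Complex.exp (2 * Complex.I * k * (max y 0 : ℝ)) - 1‖ ≤ 2 := by
    refine (norm_sub_le _ _).trans ?_
    have := norm_exp_two_I_mul_le hk (le_max_right y 0)
    rw [norm_one]; linarith
  rw [kern, norm_div, norm_mul, norm_mul, Complex.norm_I, Complex.norm_two, div_le_iff₀ (by positivity)]
  field_simp
  linarith

/-- Lipschitz dependence on `k` costs a square of `y`; this is the source of the second moment. -/
theorem norm_kern_sub_le {k l : ℂ} (hk : 0 < k.im) (hl : 0 < l.im) (y : ℝ) :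
    ‖kern k y - kern l y‖ ≤ 2 * ‖k - l‖ * max y 0 ^ 2 := by
  have hc : ∀ k : ℂ, Continuous fun s : ℝ => Complex.exp (2 * Complex.I * k * s) := fun k => by
    fun_prop
  rw [kern_eq_integral hk, kern_eq_integral hl, ← intervalIntegral.integral_sub
    ((hc k).intervalIntegrable _ _) ((hc l).intervalIntegrable _ _)]
  have := intervalIntegral.norm_integral_le_of_norm_le_const (a := 0) (b := max y 0)
    (C := 2 * ‖k - l‖ * max y 0)
    (f := fun s : ℝ => Complex.exp (2 * Complex.I * k * s) - Complex.exp (2 * Complex.I * l * s))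
    (fun s hs => by
      rw [Set.uIoc_of_le (le_max_right _ _)] at hs
      refine (norm_exp_sub_exp_le ?_ ?_).trans ?_
      · rw [re_two_I_mul]; have := mul_nonneg hk.le hs.1.le; linarith
      · rw [re_two_I_mul]; have := mul_nonneg hl.le hs.1.le; linarith
      · rw [← sub_mul, ← mul_sub, norm_mul, norm_mul, norm_mul, Complex.norm_I, Complex.norm_two,
          Complex.norm_real, Real.norm_of_nonneg hs.1.le, mul_one]
        exact mul_le_mul_of_nonneg_left hs.2 (by positivity))
  rw [sub_zero, abs_of_nonneg (le_max_right y 0)] at this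
  linarith [this, show 2 * ‖k - l‖ * max y 0 * max y 0 = 2 * ‖k - l‖ * max y 0 ^ 2 by ring]

theorem differentiableOn_kern {U : Set ℂ} (hU : ∀ k ∈ U, 0 < k.im) (y : ℝ) :
    DifferentiableOn ℂ (fun k => kern k y) U := by
  unfold kern
  refine DifferentiableOn.div (by fun_prop) (by fun_prop) fun k hk => ?_
  simp [ne_zero_of_im_pos (hU k hk)]

/-! ### The Volterra operator -/

/-- The Volterra operator `φ ↦ ∫_x^∞ (e^(2ik(t-x)) - 1)/(2ik) u(t) φ(t) dt`. -/
def volterra (k : ℂ) (u : ℝ → ℝ) (φ : ℝ → ℂ) (x : ℝ) : ℂ :=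
  ∫ t, kern k (t - x) * ((u t : ℂ) * φ t)

theorem integrable_mul_of_norm_le {u : ℝ → ℝ} (hu : Integrable u) {φ : ℝ → ℂ} {C : ℝ}
    (hφ : Continuous φ) (hC : ∀ x, ‖φ x‖ ≤ C) : Integrable fun t => (u t : ℂ) * φ t :=
  hu.ofReal.mul_bdd hφ.aestronglyMeasurable (Eventually.of_forall hC)

theorem integrable_kern_mul {k : ℂ} (hk : 0 < k.im) {g : ℝ → ℂ} (hg : Integrable g) (x : ℝ) :
    Integrable fun t => kern k (t - x) * g t := by
  refine hg.bdd_mul (c := ‖k‖⁻¹) ?_ (Eventually.of_forall fun t => norm_kern_le_inv hk _)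
  exact ((continuous_kern k).comp (continuous_id.sub continuous_const)).aestronglyMeasurable

theorem continuous_volterra {k : ℂ} (hk : 0 < k.im) {u : ℝ → ℝ} {φ : ℝ → ℂ}
    (h : Integrable fun t => (u t : ℂ) * φ t) : Continuous (volterra k u φ) := by
  refine continuous_of_dominated (bound := fun t => ‖k‖⁻¹ * ‖(u t : ℂ) * φ t‖)
    (fun x => (integrable_kern_mul hk h x).aestronglyMeasurable) (fun x => ?_)
    (h.norm.const_mul _) ?_
  · refine Eventually.of_forall fun t => ?_
    rw [norm_mul]
    exact mul_le_mul_of_nonneg_right (norm_kern_le_inv hk _) (norm_nonneg _)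
  · refine Eventually.of_forall fun t => ?_
    exact ((continuous_kern k).comp (continuous_const.sub continuous_id)).mul continuous_const

theorem norm_integral_kern_mul_le {K g : ℝ → ℂ} {b : ℝ → ℝ} (x : ℝ)
    (hK : ∀ t, t ≤ x → K t = 0) (hb : IntegrableOn b (Set.Ioi x))
    (h : ∀ t, x < t → ‖K t * g t‖ ≤ b t) :
    ‖∫ t, K t * g t‖ ≤ ∫ t in Set.Ioi x, b t := by
  have : ∫ t, K t * g t = ∫ t in Set.Ioi x, K t * g t := by
    rw [setIntegral_eq_integral_of_forall_compl_eq_zero]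
    intro t ht
    rw [hK t (by simpa using ht), zero_mul]
  rw [this]
  exact norm_integral_le_of_norm_le hb
    ((ae_restrict_iff' measurableSet_Ioi).mpr (Eventually.of_forall h))

/-! ### The Neumann series -/

/-- The terms of the Neumann series of the Volterra equation. -/
def born (u : ℝ → ℝ) : ℕ → ℂ → ℝ → ℂ
  | 0 => fun _ _ => 1
  | n + 1 => fun k => volterra k u (born u n k)

/-- The open set of spectral parameters on which the Neumann series is controlled. -/
def specDomain (r : ℝ) : Set ℂ := {k | 0 < k.im ∧ r < ‖k‖}

theorem isOpen_specDomain (r : ℝ) : IsOpen (specDomain r) :=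
  (isOpen_lt continuous_const Complex.continuous_im).inter
    (isOpen_lt continuous_const continuous_norm)

/-- The lower bound of the exponential weight attached to `|u| / r`. -/
def bornScale (u : ℝ → ℝ) (r : ℝ) : ℝ := Real.exp (-(2 * ∫ t, |u t| / r))

/-- On `specDomain r` the kernel is at most `1/r`, so each Volterra step gains a factor `1/2` in the
weight attached to `|u|/r`. The series thus converges geometrically without any smallness of `u`;
dividing by `bornScale` makes the weighted bound at least `1` at the start. -/
theorem born_bound {u : ℝ → ℝ} (hu : Integrable u) {r : ℝ} (hr : 0 < r) (n : ℕ) :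
    (∀ k ∈ specDomain r, Continuous (born u n k)) ∧
    (∀ k ∈ specDomain r, ∀ x, ‖born u n k x‖ ≤
      (1 / 2) ^ n * (expWeight (fun t => |u t| / r) x / bornScale u r)) ∧
    ∀ x, DifferentiableOn ℂ (fun k => born u n k x) (specDomain r) := by
  have ha : ∀ t, 0 ≤ |u t| / r := fun t => by positivity
  have hi : Integrable fun t => |u t| / r := hu.abs.div_const r
  have hs : 0 < bornScale u r := Real.exp_pos _
  induction n with
  | zero =>
    refine ⟨fun k _ => continuous_const, fun k _ x => ?_, fun x => differentiableOn_const 1⟩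
    simp only [born, pow_zero, one_mul, norm_one]
    rw [le_div_iff₀ hs, one_mul]
    exact le_expWeight ha hi x
  | succ n ih =>
    obtain ⟨h1, h2, h3⟩ := ih
    have h2' : ∀ k ∈ specDomain r, ∀ x, ‖born u n k x‖ ≤ (1 / 2) ^ n * (1 / bornScale u r) :=
      fun k hk x => (h2 k hk x).trans (by
        have := expWeight_le_one ha x
        gcongr)
    have hint : ∀ k ∈ specDomain r, Integrable fun t => (u t : ℂ) * born u n k t :=
      fun k hk => integrable_mul_of_norm_le hu (h1 k hk) (h2' k hk)
    have hkr : ∀ k ∈ specDomain r, ∀ y, ‖kern k y‖ ≤ r⁻¹ := fun k hk y =>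
      (norm_kern_le_inv hk.1 y).trans (inv_anti₀ hr hk.2.le)
    refine ⟨fun k hk => continuous_volterra hk.1 (hint k hk), fun k hk x => ?_, fun x => ?_⟩
    · have := norm_integral_kern_mul_le (K := fun t => kern k (t - x))
        (g := fun t => (u t : ℂ) * born u n k t)
        (b := fun t => (1 / 2) ^ n / bornScale u r * (|u t| / r * expWeight (fun t => |u t| / r) t))
        x (fun t ht => kern_of_nonpos k (by linarith))
        ((integrable_mul_expWeight ha hi).const_mul _).integrableOn (fun t _ => by
          rw [norm_mul, norm_mul, Complex.norm_real, Real.norm_eq_abs]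
          calc _ ≤ r⁻¹ * (|u t| * ((1 / 2) ^ n * (expWeight (fun t => |u t| / r) t / bornScale u r))) := by
                gcongr
                · exact hkr k hk _
                · exact h2 k hk t
            _ = _ := by ring)
      refine this.trans ?_
      rw [integral_const_mul]
      calc _ ≤ (1 / 2) ^ n / bornScale u r * (expWeight (fun t => |u t| / r) x / 2) := by
            gcongr
            exact setIntegral_Ioi_mul_expWeight_le ha hi x
        _ = _ := by ring
    · refine differentiableOn_integral_of_norm_le (isOpen_specDomain r)
        (b := fun t => r⁻¹ * (|u t| * ((1 / 2) ^ n * (1 / bornScale u r))))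
        ((hu.abs.mul_const _).const_mul _)
        (fun k hk => (integrable_kern_mul hk.1 (hint k hk) x).aestronglyMeasurable)
        (fun t => (differentiableOn_kern (fun k hk => hk.1) _).mul
          ((h3 t).const_mul _)) (fun k hk t => ?_)
      rw [norm_mul, norm_mul, Complex.norm_real, Real.norm_eq_abs]
      gcongr
      · exact hkr k hk _
      · exact h2' k hk t

/-- `φ` is a bounded continuous solution of the Volterra equation `φ = 1 + V φ`. -/
structure IsVolterraSolution (k : ℂ) (u : ℝ → ℝ) (φ : ℝ → ℂ) : Prop where
  continuous : Continuous φ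
  bounded : ∃ C, ∀ x, ‖φ x‖ ≤ C
  eq : ∀ x, φ x = 1 + volterra k u φ x

/-- The Neumann series converges uniformly in both `x` and `k`, so its sum inherits continuity,
boundedness and holomorphy from its terms. -/
theorem exists_volterraSolution {u : ℝ → ℝ} (hu : Integrable u) {r : ℝ} (hr : 0 < r) :
    ∃ m : ℂ → ℝ → ℂ, (∀ k ∈ specDomain r, IsVolterraSolution k u (m k)) ∧
      (∃ C, ∀ k ∈ specDomain r, ∀ x, ‖m k x‖ ≤ C) ∧
      ∀ x, DifferentiableOn ℂ (fun k => m k x) (specDomain r) := by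
  have ha : ∀ t, 0 ≤ |u t| / r := fun t => by positivity
  have hs : 0 < bornScale u r := Real.exp_pos _
  have hsum : Summable fun n : ℕ => (1 / 2 : ℝ) ^ n * (1 / bornScale u r) :=
    summable_geometric_two.mul_right _
  have hb : ∀ n, ∀ k ∈ specDomain r, ∀ x, ‖born u n k x‖ ≤ (1 / 2) ^ n * (1 / bornScale u r) :=
    fun n k hk x => ((born_bound hu hr n).2.1 k hk x).trans (by
      have := expWeight_le_one ha x
      gcongr)
  have hcont : ∀ k ∈ specDomain r, Continuous fun x => ∑' n, born u n k x := fun k hk =>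
    continuous_tsum (fun n => (born_bound hu hr n).1 k hk) hsum fun n x => hb n k hk x
  have hbd : ∀ k ∈ specDomain r, ∀ x,
      ‖∑' n, born u n k x‖ ≤ ∑' n : ℕ, (1 / 2 : ℝ) ^ n * (1 / bornScale u r) := fun k hk x =>
    tsum_of_norm_bounded hsum.hasSum fun n => hb n k hk x
  refine ⟨fun k x => ∑' n, born u n k x, fun k hk => ⟨hcont k hk, ⟨_, hbd k hk⟩, fun x => ?_⟩,
    ⟨_, hbd⟩, fun x => ?_⟩
  · have hsk : ∀ x, Summable fun n => born u n k x := fun x =>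
      Summable.of_norm_bounded hsum fun n => hb n k hk x
    beta_reduce
    rw [(hsk x).tsum_eq_zero_add]
    congr 1
    have := hasSum_integral_of_dominated_convergence (μ := volume)
      (F := fun n t => kern k (t - x) * ((u t : ℂ) * born u n k t))
      (f := fun t => kern k (t - x) * ((u t : ℂ) * ∑' n, born u n k t))
      (fun n t => ‖k‖⁻¹ * (|u t| * ((1 / 2 : ℝ) ^ n * (1 / bornScale u r))))
      (fun n => (integrable_kern_mul hk.1 (integrable_mul_of_norm_le hu
        ((born_bound hu hr n).1 k hk) (hb n k hk)) x).aestronglyMeasurable)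
      (fun n => Eventually.of_forall fun t => by
        rw [norm_mul, norm_mul, Complex.norm_real, Real.norm_eq_abs]
        gcongr
        · exact norm_kern_le_inv hk.1 _
        · exact hb n k hk t)
      (Eventually.of_forall fun t => (hsum.mul_left _).mul_left _)
      (by
        simp only [tsum_mul_left]
        exact (hu.abs.mul_const _).const_mul _)
      (Eventually.of_forall fun t => ((hsk t).hasSum.mul_left _).mul_left _)
    exact this.tsum_eq
  · exact Complex.differentiableOn_tsum_of_summable_norm hsum
      (fun n => (born_bound hu hr n).2.2 x) (isOpen_specDomain r) fun n k hk => hb n k hk x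

end KdV

end

noncomputable section

namespace KdV

/-! ### Jost solutions and the Volterra equation -/

/-- The increment `f (x + 1) - f x` tends to `0`, since `f` converges, and to `c`, by the mean value
inequality applied to `f t - t c`. -/
theorem eq_zero_of_tendsto_of_tendsto_deriv {f f' : ℝ → ℂ} {l c : ℂ}
    (h : ∀ x, HasDerivAt f (f' x) x) (hf : Tendsto f atTop (𝓝 l))
    (hf' : Tendsto f' atTop (𝓝 c)) : c = 0 := by
  have h1 : Tendsto (fun x => f (x + 1) - f x) atTop (𝓝 (l - l)) :=
    (hf.comp (tendsto_atTop_add_const_right _ _ tendsto_id)).sub hf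
  have h2 : Tendsto (fun x => f (x + 1) - f x) atTop (𝓝 c) := by
    rw [Metric.tendsto_atTop] at hf' ⊢
    intro ε hε
    obtain ⟨N, hN⟩ := hf' (ε / 2) (by positivity)
    refine ⟨N, fun x hx => ?_⟩
    have hg : ∀ t ∈ Set.Icc x (x + 1),
        HasDerivWithinAt (fun t => f t - t * c) (f' t - c) (Set.Icc x (x + 1)) t := fun t _ => by
      have := ((h t).fun_sub ((Complex.ofRealCLM.hasDerivAt (x := t)).mul_const c)).hasDerivWithinAt
        (s := Set.Icc x (x + 1))
      simpa using this
    have := Convex.norm_image_sub_le_of_norm_hasDerivWithin_le (C := ε / 2) hg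
      (fun t ht => by
        rw [← dist_eq_norm]; exact (hN t (hx.trans ht.1)).le) (convex_Icc x (x + 1))
      (Set.left_mem_Icc.mpr (by linarith)) (Set.right_mem_Icc.mpr (by linarith))
    rw [dist_eq_norm]
    have e : f (x + 1) - f x - c = f (x + 1) - (x + 1 : ℝ) * c - (f x - x * c) := by
      push_cast; ring
    rw [e]
    refine this.trans_lt ?_
    simp only [add_sub_cancel_left, norm_one, mul_one]
    linarith
  rw [sub_self] at h1
  exact tendsto_nhds_unique h2 h1

theorem isPrim_setIntegral_Ioi {p : ℝ → ℂ} (hl : LocallyIntegrable p)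
    (h : ∀ x, IntegrableOn p (Set.Ioi x)) :
    IsPrim (fun x => ∫ t in Set.Ioi x, p t) (fun x => -p x) := by
  refine ⟨hl.neg, fun a b => ?_⟩
  rw [intervalIntegral.integral_neg, ← intervalIntegral.integral_Ioi_sub_Ioi' (h a) (h b)]
  ring

theorem isPrim_cexp (c : ℂ) : IsPrim (fun x : ℝ => Complex.exp (c * x))
    (fun x => c * Complex.exp (c * x)) := by
  refine isPrim_of_hasDerivAt (fun x => ?_) (by fun_prop)
  have := ((Complex.ofRealCLM.hasDerivAt (x := x)).const_mul c).cexp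
  simpa [mul_comm] using this

theorem tendsto_setIntegral_Ioi_zero {p : ℝ → ℂ} {a : ℝ} (h : IntegrableOn p (Set.Ioi a)) :
    Tendsto (fun x => ∫ t in Set.Ioi x, p t) atTop (𝓝 0) := by
  have h1 := intervalIntegral_tendsto_integral_Ioi a h tendsto_id
  have h2 : Tendsto (fun x => (∫ t in Set.Ioi a, p t) - ∫ t in a..x, p t) atTop (𝓝 0) := by
    simpa using h1.const_sub (∫ t in Set.Ioi a, p t)
  refine h2.congr' ?_
  filter_upwards [eventually_ge_atTop a] with x hx
  have := intervalIntegral.integral_Ioi_sub_Ioi' h (h.mono_set (Set.Ioi_subset_Ioi hx))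
  rw [← this]; ring

theorem IsPrim.hasLimit {Q q : ℝ → ℂ} (h : IsPrim Q q) {a : ℝ} (hq : IntegrableOn q (Set.Ioi a)) :
    Tendsto Q atTop (𝓝 (Q a + ∫ t in Set.Ioi a, q t)) := by
  refine ((intervalIntegral_tendsto_integral_Ioi a hq tendsto_id).const_add (Q a)).congr
    fun x => ?_
  rw [id, ← h.2 a x]; ring

variable {k : ℂ} {u : ℝ → ℝ}

theorem IsSchrodingerSolution.isPrim_deriv {f : ℝ → ℂ} (hu : Integrable u)
    (h : IsSchrodingerSolution u k f) :
    IsPrim (deriv f) (fun s => ((u s : ℂ) - k ^ 2) * f s) := by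
  refine ⟨?_, h.2⟩
  have h1 : LocallyIntegrable fun s => (u s : ℂ) - k ^ 2 :=
    hu.ofReal.locallyIntegrable.sub continuous_const.locallyIntegrable
  exact locallyIntegrable_mul_continuous h.1.continuous h1

theorem IsSchrodingerSolution.isPrim {f : ℝ → ℂ} (hu : Integrable u)
    (h : IsSchrodingerSolution u k f) : IsPrim f (deriv f) :=
  isPrim_of_hasDerivAt (fun x => (h.1 x).hasDerivAt) (h.isPrim_deriv hu).continuous

theorem isSchrodingerSolution_of_isPrim {f g : ℝ → ℂ} (h : IsPrim f g)
    (h' : IsPrim g (fun s => ((u s : ℂ) - k ^ 2) * f s)) :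
    IsSchrodingerSolution u k f ∧ ∀ x, deriv f x = g x := by
  have hd := h.hasDerivAt h'.continuous
  have e : deriv f = g := funext fun x => (hd x).deriv
  exact ⟨⟨fun x => (hd x).differentiableAt, fun x y => by rw [e]; exact h'.2 x y⟩, fun x => by rw [e]⟩

/-- Factoring `e^(2ik(t-x))` removes `x` from the integrands and leaves two tail integrals, which
are primitives and can be handled by the product rule. -/
theorem volterra_eq (hk : 0 < k.im) {φ : ℝ → ℂ} {x : ℝ}
    (h : IntegrableOn (fun t => (u t : ℂ) * φ t) (Set.Ioi x)) :
    volterra k u φ x = (Complex.exp (-(2 * Complex.I * k) * x) *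
      (∫ t in Set.Ioi x, Complex.exp (2 * Complex.I * k * t) * ((u t : ℂ) * φ t)) -
      ∫ t in Set.Ioi x, (u t : ℂ) * φ t) / (2 * Complex.I * k) := by
  have h0 : volterra k u φ x = ∫ t in Set.Ioi x, kern k (t - x) * ((u t : ℂ) * φ t) := by
    rw [volterra, setIntegral_eq_integral_of_forall_compl_eq_zero]
    intro t ht
    rw [kern_of_nonpos k (by simpa using ht), zero_mul]
  have hE : IntegrableOn (fun t : ℝ => Complex.exp (-(2 * Complex.I * k) * x) *
      (Complex.exp (2 * Complex.I * k * t) * ((u t : ℂ) * φ t))) (Set.Ioi x) := by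
    have : IntegrableOn (fun t : ℝ => Complex.exp (2 * Complex.I * k * (t - x : ℝ)) *
        ((u t : ℂ) * φ t)) (Set.Ioi x) := by
      refine Integrable.bdd_mul (c := 1) h (by fun_prop) ?_
      refine (ae_restrict_iff' measurableSet_Ioi).mpr (Eventually.of_forall fun t ht => ?_)
      exact norm_exp_two_I_mul_le hk (by rw [Set.mem_Ioi] at ht; linarith)
    refine this.congr_fun (fun t _ => ?_) measurableSet_Ioi
    beta_reduce
    rw [← mul_assoc (Complex.exp _) (Complex.exp _), ← Complex.exp_add]
    congr 2
    push_cast; ring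
  rw [h0, ← integral_const_mul, ← integral_sub hE h, ← integral_div]
  refine setIntegral_congr_fun measurableSet_Ioi fun t ht => ?_
  have e : max (t - x) 0 = t - x := max_eq_left (by rw [Set.mem_Ioi] at ht; linarith)
  simp only [kern, e]
  rw [← mul_assoc (Complex.exp _) (Complex.exp _), ← Complex.exp_add]
  have : 2 * Complex.I * k * ((t - x : ℝ) : ℂ) = -(2 * Complex.I * k) * x + 2 * Complex.I * k * t := by
    push_cast; ring
  rw [this]; ring

theorem integrableOn_exp_mul (hk : 0 < k.im) {g : ℝ → ℂ} {x : ℝ} (h : IntegrableOn g (Set.Ioi x)) :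
    IntegrableOn (fun t : ℝ => Complex.exp (2 * Complex.I * k * t) * g t) (Set.Ioi x) := by
  refine Integrable.bdd_mul (c := Real.exp (-(2 * k.im * x))) h (by fun_prop) ?_
  refine (ae_restrict_iff' measurableSet_Ioi).mpr (Eventually.of_forall fun t ht => ?_)
  rw [Complex.norm_exp, re_two_I_mul, Real.exp_le_exp]
  rw [Set.mem_Ioi] at ht
  nlinarith

/-- A function solving the Volterra equation with integrable `u φ` is a Jost solution, up to
the factor `e^(ikx)`. -/
theorem isSchrodingerSolution_of_volterra (hk : 0 < k.im) {φ : ℝ → ℂ}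
    (h : Integrable fun t => (u t : ℂ) * φ t) (hφ : ∀ x, φ x = 1 + volterra k u φ x) :
    IsSchrodingerSolution u k (fun x => Complex.exp (Complex.I * k * x) * φ x) ∧
    ∀ x : ℝ, deriv (fun x : ℝ => Complex.exp (Complex.I * k * x) * φ x) x =
      Complex.exp (Complex.I * k * x) * (2 * Complex.I * k - Complex.I * k * φ x -
        ∫ t in Set.Ioi x, (u t : ℂ) * φ t) := by
  have hk0 := ne_zero_of_im_pos hk
  have hc : 2 * Complex.I * k ≠ 0 := by simp [hk0]
  have hQ := isPrim_setIntegral_Ioi h.locallyIntegrable fun x => h.integrableOn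
  have hP := isPrim_setIntegral_Ioi (p := fun t : ℝ => Complex.exp (2 * Complex.I * k * t) *
      ((u t : ℂ) * φ t)) (locallyIntegrable_continuous_mul (by fun_prop) h.locallyIntegrable)
      fun x => integrableOn_exp_mul hk h.integrableOn
  set P : ℝ → ℂ := fun x => ∫ t in Set.Ioi x, Complex.exp (2 * Complex.I * k * t) *
      ((u t : ℂ) * φ t) with hPdef
  set Q : ℝ → ℂ := fun x => ∫ t in Set.Ioi x, (u t : ℂ) * φ t with hQdef
  have hV : ∀ x : ℝ, φ x = 1 + (Complex.exp (-(2 * Complex.I * k) * x) * P x - Q x) /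
      (2 * Complex.I * k) := fun x => by rw [hφ x, volterra_eq hk h.integrableOn]
  have hEp := isPrim_cexp (Complex.I * k)
  have hEm := isPrim_cexp (-(Complex.I * k))
  have hexp : ∀ x : ℝ, Complex.exp (Complex.I * k * x) * Complex.exp (-(2 * Complex.I * k) * x) =
      Complex.exp (-(Complex.I * k) * x) := fun x => by
    rw [← Complex.exp_add]; congr 1; ring
  have hexp2 : ∀ x : ℝ, Complex.exp (-(Complex.I * k) * x) * Complex.exp (2 * Complex.I * k * x) =
      Complex.exp (Complex.I * k * x) := fun x => by
    rw [← Complex.exp_add]; congr 1; ring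
  -- Both the function and its expected derivative are written as combinations of exponentials times
  -- the tail integrals `P` and `Q`, so that `IsPrim.mul` verifies the equation twice.
  have hf : ∀ x : ℝ, Complex.exp (Complex.I * k * x) * φ x = Complex.exp (Complex.I * k * x) +
      (2 * Complex.I * k)⁻¹ * (Complex.exp (-(Complex.I * k) * x) * P x +
        (-1) * (Complex.exp (Complex.I * k * x) * Q x)) := fun x => by
    rw [hV x, ← hexp x]; field_simp; ring
  have hg : ∀ x : ℝ, Complex.exp (Complex.I * k * x) * (2 * Complex.I * k - Complex.I * k * φ x -
        Q x) = Complex.I * k * Complex.exp (Complex.I * k * x) +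
      (-(1 / 2)) * (Complex.exp (-(Complex.I * k) * x) * P x +
        Complex.exp (Complex.I * k * x) * Q x) := fun x => by
    rw [hV x, ← hexp x]; field_simp; ring
  have key := isSchrodingerSolution_of_isPrim (u := u) (k := k)
    (f := fun x : ℝ => Complex.exp (Complex.I * k * x) * φ x)
    (g := fun x : ℝ => Complex.exp (Complex.I * k * x) * (2 * Complex.I * k - Complex.I * k * φ x -
        Q x)) ?_ ?_
  · exact key
  · simp only [hf, hg]
    refine (hEp.add (((hEm.mul hP).add ((hEp.mul hQ).const_mul (-1))).const_mul _)).congr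
      fun x => ?_
    rw [show Complex.exp (-(Complex.I * k) * x) * -(Complex.exp (2 * Complex.I * k * x) *
      ((u x : ℂ) * φ x)) = -((Complex.exp (-(Complex.I * k) * x) *
        Complex.exp (2 * Complex.I * k * x)) * ((u x : ℂ) * φ x)) by ring, hexp2]
    field_simp
    ring
  · simp only [hg]
    refine ((hEp.const_mul (Complex.I * k)).add (((hEm.mul hP).add (hEp.mul hQ)).const_mul
      (-(1 / 2)))).congr fun x => ?_
    rw [show Complex.exp (-(Complex.I * k) * x) * -(Complex.exp (2 * Complex.I * k * x) *
      ((u x : ℂ) * φ x)) = -((Complex.exp (-(Complex.I * k) * x) *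
        Complex.exp (2 * Complex.I * k * x)) * ((u x : ℂ) * φ x)) by ring, hexp2, sub_mul,
      mul_comm (k ^ 2), show (u x : ℂ) * (Complex.exp (Complex.I * k * x) * φ x) =
        Complex.exp (Complex.I * k * x) * (u x * φ x) by ring, hf x]
    have hI : Complex.I ^ 2 = -1 := Complex.I_sq
    field_simp
    ring_nf
    have hI3 : Complex.I ^ 3 = -Complex.I := by rw [pow_succ, hI]; ring
    simp only [hI3]
    ring_nf
    simp only [hI]
    ring

theorem tendsto_volterra_zero (hk : 0 < k.im) {φ : ℝ → ℂ}
    (h : Integrable fun t => (u t : ℂ) * φ t) : Tendsto (volterra k u φ) atTop (𝓝 0) := by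
  have := tendsto_integral_filter_of_dominated_convergence (l := atTop) (μ := volume)
    (F := fun x t => kern k (t - x) * ((u t : ℂ) * φ t)) (f := fun _ => 0)
    (fun t => ‖k‖⁻¹ * ‖(u t : ℂ) * φ t‖)
    (Eventually.of_forall fun x => (integrable_kern_mul hk h x).aestronglyMeasurable)
    (Eventually.of_forall fun x => Eventually.of_forall fun t => by
      rw [norm_mul]
      exact mul_le_mul_of_nonneg_right (norm_kern_le_inv hk _) (norm_nonneg _))
    (h.norm.const_mul _)
    (Eventually.of_forall fun t => by
      refine tendsto_const_nhds.congr' ?_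
      filter_upwards [eventually_ge_atTop t] with x hx
      rw [kern_of_nonpos k (by linarith), zero_mul])
  rw [integral_zero] at this
  exact this

theorem IsVolterraSolution.integrable_mul {φ : ℝ → ℂ} (hu : Integrable u)
    (h : IsVolterraSolution k u φ) : Integrable fun t => (u t : ℂ) * φ t := by
  obtain ⟨C, hC⟩ := h.bounded
  exact integrable_mul_of_norm_le hu h.continuous hC

theorem IsVolterraSolution.isJostPlus (hk : 0 < k.im) (hu : Integrable u) {φ : ℝ → ℂ}
    (h : IsVolterraSolution k u φ) :
    IsJostPlus u k (fun x => Complex.exp (Complex.I * k * x) * φ x) := by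
  have hi := h.integrable_mul hu
  refine ⟨(isSchrodingerSolution_of_volterra hk hi h.eq).1, ?_⟩
  have h1 : Tendsto φ atTop (𝓝 1) := by
    have := (tendsto_volterra_zero hk hi).const_add 1
    rw [add_zero] at this
    exact this.congr fun x => (h.eq x).symm
  refine h1.congr fun x => ?_
  rw [mul_assoc, mul_comm (φ x), ← mul_assoc, ← Complex.exp_add]
  simp

/-- The Volterra equation for the normalised Jost solution. -/
theorem IsJostPlus.eq_volterra (hk : 0 < k.im) (hu : Integrable u) {f : ℝ → ℂ}
    (h : IsJostPlus u k f) (x : ℝ) :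
    f x * Complex.exp (-(Complex.I * k) * x) =
      1 + volterra k u (fun t => f t * Complex.exp (-(Complex.I * k) * t)) x := by
  have hk0 := ne_zero_of_im_pos hk
  have hc : 2 * Complex.I * k ≠ 0 := by simp [hk0]
  have hf := h.1.isPrim hu
  have hf' := h.1.isPrim_deriv hu
  have hEm := isPrim_cexp (-(Complex.I * k))
  have hE2 := isPrim_cexp (2 * Complex.I * k)
  set φ : ℝ → ℂ := fun t => f t * Complex.exp (-(Complex.I * k) * t) with hφ
  have hφ1 : Tendsto φ atTop (𝓝 1) := by
    refine h.2.congr fun x => ?_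
    simp only [hφ, neg_mul]
  have hφc : Continuous φ := (hf.mul hEm).continuous
  -- Nothing is known about `φ` at `-∞` yet; on right half-lines it is bounded, being continuous
  -- with a limit.
  have hint : ∀ x, IntegrableOn (fun t => (u t : ℂ) * φ t) (Set.Ioi x) := by
    intro x
    obtain ⟨N, hN⟩ := (hφ1.norm.eventually_le_const (by norm_num : ‖(1 : ℂ)‖ < 2)).exists_forall_of_atTop
    obtain ⟨C, hC⟩ := (isCompact_Icc (a := x) (b := max x N)).exists_bound_of_continuousOn
      hφc.continuousOn
    refine Integrable.mul_bdd (c := max C 2) hu.ofReal.integrableOn hφc.aestronglyMeasurable ?_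
    refine (ae_restrict_iff' measurableSet_Ioi).mpr (Eventually.of_forall fun t ht => ?_)
    rw [Set.mem_Ioi] at ht
    rcases le_total t N with h1 | h1
    · exact (hC t ⟨ht.le, h1.trans (le_max_right _ _)⟩).trans (le_max_left _ _)
    · exact (hN t h1).trans (le_max_right _ _)
  have hlu : LocallyIntegrable fun t => (u t : ℂ) * φ t :=
    locallyIntegrable_mul_continuous hφc hu.ofReal.locallyIntegrable
  set φ' : ℝ → ℂ := fun t => (deriv f t + -(Complex.I * k) * f t) *
    Complex.exp (-(Complex.I * k) * t) with hφ'
  have hφP : IsPrim φ φ' := (hf.mul hEm).congr fun t => by rw [hφ']; ring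
  have hφ'P : IsPrim φ' (fun t => u t * φ t + -(2 * Complex.I * k) * φ' t) := by
    refine ((hf'.add (hf.const_mul (-(Complex.I * k)))).mul hEm).congr fun t => ?_
    simp only [hφ', hφ]
    ring_nf
    rw [show Complex.I ^ 2 = -1 from Complex.I_sq]
    ring
  have hφd := hφP.hasDerivAt hφ'P.continuous
  have hQ := isPrim_setIntegral_Ioi hlu hint
  -- Since `φ'' + 2ik φ' = u φ` is integrable to the right, `φ' + 2ik φ` has a limit; hence so has
  -- `φ'`, and its limit must be `0` because `φ` converges. This fixes `φ'` in terms of `φ` and a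
  -- tail integral.
  have hSum : IsPrim (fun t => φ' t + 2 * Complex.I * k * φ t) (fun t => (u t : ℂ) * φ t) :=
    (hφ'P.add (hφP.const_mul (2 * Complex.I * k))).congr fun t => by ring
  have hlim : ∀ y, Tendsto φ' atTop (𝓝 (φ' y + 2 * Complex.I * k * φ y +
      (∫ t in Set.Ioi y, (u t : ℂ) * φ t) - 2 * Complex.I * k * 1)) := fun y =>
    ((hSum.hasLimit (hint y)).sub (hφ1.const_mul (2 * Complex.I * k))).congr fun t => by ring
  have hφ'eq : ∀ y, φ' y + 2 * Complex.I * k * φ y +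
      (∫ t in Set.Ioi y, (u t : ℂ) * φ t) - 2 * Complex.I * k * 1 = 0 := fun y =>
    eq_zero_of_tendsto_of_tendsto_deriv hφd hφ1 (hlim y)
  have hexp0 : Tendsto (fun t : ℝ => Complex.exp (2 * Complex.I * k * t)) atTop (𝓝 0) := by
    rw [tendsto_zero_iff_norm_tendsto_zero]
    simp only [Complex.norm_exp, re_two_I_mul]
    refine Real.tendsto_exp_atBot.comp (tendsto_neg_atTop_atBot.comp ?_)
    exact tendsto_id.const_mul_atTop (by positivity)
  -- The first-order equation just found is integrated from `x` to `∞` with the integrating factor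
  -- `e^(2ikt)`, whose decay kills the boundary term.
  have hG : IsPrim (fun t => Complex.exp (2 * Complex.I * k * t) * (φ t +
      (2 * Complex.I * k)⁻¹ * ((∫ s in Set.Ioi t, (u s : ℂ) * φ s) + -(2 * Complex.I * k))))
      (fun t => (-(2 * Complex.I * k)⁻¹) *
        (Complex.exp (2 * Complex.I * k * t) * ((u t : ℂ) * φ t))) := by
    have h1 : IsPrim (fun _ : ℝ => -(2 * Complex.I * k)) (fun _ => 0) :=
      isPrim_of_hasDerivAt (fun x => hasDerivAt_const x _) continuous_const
    refine (hE2.mul (hφP.add ((hQ.add h1).const_mul (2 * Complex.I * k)⁻¹))).congr fun t => ?_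
    have e : φ' t = 2 * Complex.I * k - 2 * Complex.I * k * φ t -
      (∫ s in Set.Ioi t, (u s : ℂ) * φ s) := by linear_combination hφ'eq t
    rw [e]
    field_simp
    ring
  have hG0 : Tendsto (fun t : ℝ => Complex.exp (2 * Complex.I * k * t) * (φ t +
      (2 * Complex.I * k)⁻¹ * ((∫ s in Set.Ioi t, (u s : ℂ) * φ s) + -(2 * Complex.I * k))))
      atTop (𝓝 0) := by
    have := hexp0.mul (hφ1.add (((tendsto_setIntegral_Ioi_zero (hint 0)).add_const
      (-(2 * Complex.I * k))).const_mul (2 * Complex.I * k)⁻¹))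
    simpa using this
  have hfin := tendsto_nhds_unique hG0 (hG.hasLimit (a := x)
    ((integrableOn_exp_mul hk (hint x)).const_mul _))
  rw [volterra_eq hk (hint x)]
  rw [integral_const_mul] at hfin
  have hne := Complex.exp_ne_zero (2 * Complex.I * k * x)
  have he : Complex.exp (-(2 * Complex.I * k) * x) = (Complex.exp (2 * Complex.I * k * x))⁻¹ := by
    rw [← Complex.exp_neg]; congr 1; ring
  rw [he]
  change φ x = _
  field_simp at hfin ⊢
  linear_combination (-1 : ℂ) * hfin

/-- Solutions of the homogeneous Volterra equation which are bounded to the right vanish. -/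
theorem eq_zero_of_volterra_eq (hk : 0 < k.im) (hu : Integrable u) {d : ℝ → ℂ}
    (hd : Continuous d) (hb : ∀ x, ∃ C, ∀ t, x ≤ t → ‖d t‖ ≤ C)
    (h : ∀ x, d x = volterra k u d x) (x : ℝ) : d x = 0 := by
  have hk0 : 0 < ‖k‖ := norm_pos_iff.mpr (ne_zero_of_im_pos hk)
  obtain ⟨C, hC⟩ := hb x
  have hC0 : 0 ≤ C := (norm_nonneg _).trans (hC x le_rfl)
  have ha : ∀ t, 0 ≤ |u t| / ‖k‖ := fun t => by positivity
  -- Truncating to `[x, ∞)` makes `d` bounded; the equation at a point involves only values to its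
  -- right, so the truncation preserves the inequality. With `c = 0` the conclusion is vanishing.
  have := gronwall_Ioi (a := fun t => |u t| / ‖k‖) (h := (Set.Ici x).indicator fun t => ‖d t‖)
    (c := 0) (M := C) ha (hu.abs.div_const _)
    ((hd.norm.measurable.indicator measurableSet_Ici).aestronglyMeasurable)
    (fun t => Set.indicator_nonneg (fun _ _ => norm_nonneg _) t)
    (fun t => Set.indicator_le' (fun t ht => hC t ht) (fun _ _ => hC0) t) le_rfl
    (fun y => by
      by_cases hy : x ≤ y
      · rw [Set.indicator_of_mem (Set.mem_Ici.mpr hy), zero_add, h y]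
        have hint : IntegrableOn (fun t => |u t| / ‖k‖ * (Set.Ici x).indicator (fun t => ‖d t‖) t)
            (Set.Ioi y) := by
          refine Integrable.mul_bdd (c := C) (hu.abs.div_const _).integrableOn
            ((hd.norm.measurable.indicator measurableSet_Ici).aestronglyMeasurable)
            (Eventually.of_forall fun t => ?_)
          rw [Real.norm_of_nonneg (Set.indicator_nonneg (fun _ _ => norm_nonneg _) t)]
          exact Set.indicator_le' (fun t ht => hC t ht) (fun _ _ => hC0) t
        refine norm_integral_kern_mul_le (K := fun t => kern k (t - y)) y
          (fun t ht => kern_of_nonpos k (by linarith)) hint fun t ht => ?_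
        rw [Set.indicator_of_mem (Set.mem_Ici.mpr (hy.trans ht.le)), norm_mul, norm_mul,
          Complex.norm_real, Real.norm_eq_abs, div_mul_eq_mul_div, div_eq_inv_mul]
        exact mul_le_mul_of_nonneg_right (norm_kern_le_inv hk _) (by positivity)
      · rw [Set.indicator_of_notMem (by simpa using hy), zero_add]
        refine integral_nonneg fun t => mul_nonneg (ha t) ?_
        exact Set.indicator_nonneg (fun _ _ => norm_nonneg _) t) x
  rw [Set.indicator_of_mem Set.self_mem_Ici] at this
  simpa using this

/-- The normalised Jost solution `m(x) = f₊(x,k) e^(-ikx)`. -/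
def jostM (u : ℝ → ℝ) (k : ℂ) (x : ℝ) : ℂ :=
  jostPlus u k x * Complex.exp (-(Complex.I * k) * x)

theorem jostPlus_eq (u : ℝ → ℝ) (k : ℂ) (x : ℝ) :
    jostPlus u k x = Complex.exp (Complex.I * k * x) * jostM u k x := by
  rw [jostM, mul_comm, mul_assoc, ← Complex.exp_add]
  simp

theorem exists_isVolterraSolution (hk : 0 < k.im) (hu : Integrable u) :
    ∃ φ, IsVolterraSolution k u φ := by
  have hk0 : 0 < ‖k‖ := norm_pos_iff.mpr (ne_zero_of_im_pos hk)
  obtain ⟨m, hm, -⟩ := exists_volterraSolution hu (half_pos hk0)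
  exact ⟨m k, hm k ⟨hk, by linarith⟩⟩

/-- The difference solves the homogeneous Volterra equation. This is the uniqueness of Jost
solutions, which gives meaning to their definition by choice and lets an explicit formula be
recognised as the Jost solution. -/
theorem IsJostPlus.eq_of_isVolterraSolution (hk : 0 < k.im) (hu : Integrable u) {f φ : ℝ → ℂ}
    (h : IsJostPlus u k f) (hφ : IsVolterraSolution k u φ) (x : ℝ) :
    f x * Complex.exp (-(Complex.I * k) * x) = φ x := by
  have hV := h.eq_volterra hk hu
  set ψ : ℝ → ℂ := fun t => f t * Complex.exp (-(Complex.I * k) * t) with hψ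
  have hψc : Continuous ψ := ((h.1.isPrim hu).mul (isPrim_cexp _)).continuous
  have hψ1 : Tendsto ψ atTop (𝓝 1) := by
    refine h.2.congr fun x => ?_
    simp only [hψ, neg_mul]
  have hb : ∀ x, ∃ C, ∀ t, x ≤ t → ‖ψ t‖ ≤ C := by
    intro x
    obtain ⟨N, hN⟩ := (hψ1.norm.eventually_le_const (by norm_num : ‖(1 : ℂ)‖ < 2)).exists_forall_of_atTop
    obtain ⟨C, hC⟩ := (isCompact_Icc (a := x) (b := max x N)).exists_bound_of_continuousOn
      hψc.continuousOn
    refine ⟨max C 2, fun t ht => ?_⟩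
    rcases le_total t N with h1 | h1
    · exact (hC t ⟨ht, h1.trans (le_max_right _ _)⟩).trans (le_max_left _ _)
    · exact (hN t h1).trans (le_max_right _ _)
  obtain ⟨B, hB⟩ := hφ.bounded
  refine sub_eq_zero.mp (eq_zero_of_volterra_eq hk hu (d := fun t => ψ t - φ t)
    (hψc.sub hφ.continuous) (fun x => ?_) (fun x => ?_) x)
  · obtain ⟨C, hC⟩ := hb x
    exact ⟨C + B, fun t ht => (norm_sub_le _ _).trans (add_le_add (hC t ht) (hB t))⟩
  · have hi2 := integrable_kern_mul hk (hφ.integrable_mul hu) x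
    obtain ⟨C, hC⟩ := hb x
    have hi1 : Integrable fun t => kern k (t - x) * ((u t : ℂ) * ψ t) := by
      have : IntegrableOn (fun t => kern k (t - x) * ((u t : ℂ) * ψ t)) (Set.Ioi x) := by
        refine Integrable.bdd_mul (c := ‖k‖⁻¹) ?_
          ((continuous_kern k).comp (continuous_id.sub continuous_const)).aestronglyMeasurable
          (Eventually.of_forall fun t => norm_kern_le_inv hk _)
        refine Integrable.mul_bdd (c := C) hu.ofReal.integrableOn hψc.aestronglyMeasurable ?_
        exact (ae_restrict_iff' measurableSet_Ioi).mpr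
          (Eventually.of_forall fun t ht => hC t (Set.mem_Ioi.mp ht).le)
      rw [← integrable_indicator_iff measurableSet_Ioi] at this
      refine this.congr (Eventually.of_forall fun t => ?_)
      by_cases ht : t ∈ Set.Ioi x
      · rw [Set.indicator_of_mem ht]
      · rw [Set.indicator_of_notMem ht]
        simp only
        rw [kern_of_nonpos k (by simpa using ht), zero_mul]
    have e : volterra k u (fun t => ψ t - φ t) x = volterra k u ψ x - volterra k u φ x := by
      simp only [volterra]
      rw [← integral_sub hi1 hi2]
      refine integral_congr_ae (Eventually.of_forall fun t => ?_)
      simp only; ring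
    have hVx : ψ x = 1 + volterra k u ψ x := hV x
    rw [e, hVx, hφ.eq x]
    ring

theorem isJostPlus_jostPlus (hk : 0 < k.im) (hu : Integrable u) :
    IsJostPlus u k (jostPlus u k) := by
  obtain ⟨φ, hφ⟩ := exists_isVolterraSolution hk hu
  exact Classical.epsilon_spec ⟨_, hφ.isJostPlus hk hu⟩

theorem jostM_eq_of_isVolterraSolution (hk : 0 < k.im) (hu : Integrable u) {φ : ℝ → ℂ}
    (hφ : IsVolterraSolution k u φ) : jostM u k = φ :=
  funext fun x => (isJostPlus_jostPlus hk hu).eq_of_isVolterraSolution hk hu hφ x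

theorem isVolterraSolution_jostM (hk : 0 < k.im) (hu : Integrable u) :
    IsVolterraSolution k u (jostM u k) := by
  obtain ⟨φ, hφ⟩ := exists_isVolterraSolution hk hu
  rwa [jostM_eq_of_isVolterraSolution hk hu hφ]

theorem IsJostPlus.eq_jostPlus (hk : 0 < k.im) (hu : Integrable u) {f : ℝ → ℂ}
    (h : IsJostPlus u k f) : f = jostPlus u k := by
  funext x
  have := h.eq_of_isVolterraSolution hk hu (isVolterraSolution_jostM hk hu) x
  rw [jostPlus_eq, ← this, mul_comm, mul_assoc, ← Complex.exp_add]
  simp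

end KdV

end

noncomputable section

namespace KdV

/-! ### Reflection -/

variable {k : ℂ} {u : ℝ → ℝ}

theorem IsSchrodingerSolution.comp_neg {f : ℝ → ℂ} (h : IsSchrodingerSolution u k f) :
    IsSchrodingerSolution (fun x => u (-x)) k (fun x => f (-x)) := by
  refine ⟨h.1.comp differentiable_neg, fun x y => ?_⟩
  rw [deriv_comp_neg, deriv_comp_neg,
    intervalIntegral.integral_comp_neg (fun s => ((u s : ℂ) - k ^ 2) * f s), ← h.2]
  ring

theorem IsJostMinus.comp_neg {f : ℝ → ℂ} (h : IsJostMinus u k f) :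
    IsJostPlus (fun x => u (-x)) k (fun x => f (-x)) := by
  refine ⟨h.1.comp_neg, (h.2.comp tendsto_neg_atTop_atBot).congr fun x => ?_⟩
  simp

theorem IsJostPlus.comp_neg {f : ℝ → ℂ} (h : IsJostPlus (fun x => u (-x)) k f) :
    IsJostMinus u k (fun x => f (-x)) := by
  have h1 := h.1.comp_neg
  simp only [neg_neg] at h1
  refine ⟨h1, (h.2.comp tendsto_neg_atBot_atTop).congr fun x => ?_⟩
  simp

theorem isJostMinus_jostMinus (hk : 0 < k.im) (hu : Integrable u) :
    IsJostMinus u k (jostMinus u k) :=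
  Classical.epsilon_spec ⟨_, (isJostPlus_jostPlus hk hu.comp_neg).comp_neg⟩

/-- Reduces every statement about left Jost solutions to right ones of the reflected potential. -/
theorem jostMinus_eq (hk : 0 < k.im) (hu : Integrable u) (x : ℝ) :
    jostMinus u k x = jostPlus (fun x => u (-x)) k (-x) := by
  have := (isJostMinus_jostMinus hk hu).comp_neg.eq_jostPlus hk hu.comp_neg
  rw [← this]; beta_reduce; rw [neg_neg]

/-! ### The Wronskian of the Jost solutions -/

theorem wronskian_eq_zero_point {f g : ℝ → ℂ} (hu : Integrable u)
    (hf : IsSchrodingerSolution u k f) (hg : IsSchrodingerSolution u k g) (x : ℝ) :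
    wronskian f g x = wronskian f g 0 := by
  have hP := ((hf.isPrim hu).mul (hg.isPrim_deriv hu)).add
    (((hf.isPrim_deriv hu).mul (hg.isPrim hu)).const_mul (-1))
  have := hP.2 0 x
  have e : ∀ s, deriv f s * deriv g s + f s * (((u s : ℂ) - k ^ 2) * g s) +
      -1 * (((u s : ℂ) - k ^ 2) * f s * g s + deriv f s * deriv g s) = 0 := fun s => by ring
  simp only [e, intervalIntegral.integral_zero] at this
  simp only [wronskian]
  linear_combination this

/-- The Wronskian of the two Jost solutions. -/
def jostW (u : ℝ → ℝ) (k : ℂ) : ℂ := wronskian (jostPlus u k) (jostMinus u k) 0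

theorem tendsto_jostM (hk : 0 < k.im) (hu : Integrable u) :
    Tendsto (jostM u k) atTop (𝓝 1) := by
  refine (isJostPlus_jostPlus hk hu).2.congr fun x => ?_
  simp only [jostM, neg_mul]

theorem deriv_jostPlus (hk : 0 < k.im) (hu : Integrable u) (x : ℝ) :
    deriv (jostPlus u k) x = Complex.exp (Complex.I * k * x) * (2 * Complex.I * k -
      Complex.I * k * jostM u k x - ∫ t in Set.Ioi x, (u t : ℂ) * jostM u k t) := by
  have h := isVolterraSolution_jostM hk hu
  rw [← (isSchrodingerSolution_of_volterra hk (h.integrable_mul hu) h.eq).2 x]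
  congr 1
  funext y
  exact jostPlus_eq u k y

theorem tendsto_setIntegral_Ioi_neg {g : ℝ → ℂ} (hI : Integrable g) :
    Tendsto (fun y => ∫ t in Set.Ioi (-y), g t) atTop (𝓝 (∫ t, g t)) := by
  have h5 : Tendsto (fun x => ∫ t in x..0, g t) atBot (𝓝 (∫ t in Set.Iic 0, g t)) :=
    intervalIntegral_tendsto_integral_Iic 0 hI.integrableOn tendsto_id
  have h6 := (h5.comp tendsto_neg_atTop_atBot).add_const (∫ t in Set.Ioi 0, g t)
  rw [intervalIntegral.integral_Iic_add_Ioi hI.integrableOn hI.integrableOn] at h6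
  refine h6.congr fun y => ?_
  have := intervalIntegral.integral_Ioi_sub_Ioi' (hI.integrableOn (s := Set.Ioi (-y)))
    (hI.integrableOn (s := Set.Ioi 0))
  simp only [Function.comp]
  rw [← this]; ring

/-- Evaluate the constant Wronskian at `-y` and let `y → ∞`, where the left Jost solution is
asymptotically free. Only the right Jost solution remains in the answer, so estimates for `jostM`
become estimates for the Wronskian. -/
theorem jostW_eq (hk : 0 < k.im) (hu : Integrable u) :
    jostW u k = -(2 * Complex.I * k) + ∫ t, (u t : ℂ) * jostM u k t := by
  have hu' : Integrable fun x => u (-x) := hu.comp_neg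
  have hV := isVolterraSolution_jostM hk hu
  have hV' := isVolterraSolution_jostM hk hu'
  have hI := hV.integrable_mul hu
  have hI' := hV'.integrable_mul hu'
  set v : ℝ → ℝ := fun x => u (-x) with hv
  have hconst : ∀ y, wronskian (jostPlus u k) (jostMinus u k) (-y) = jostW u k := fun y =>
    wronskian_eq_zero_point hu (isJostPlus_jostPlus hk hu).1 (isJostMinus_jostMinus hk hu).1 _
  have hminus : jostMinus u k = fun x => jostPlus v k (-x) := funext (jostMinus_eq hk hu)
  have hE : ∀ y : ℝ, Complex.exp (Complex.I * k * (-y : ℝ)) * Complex.exp (Complex.I * k * y) = 1 :=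
    fun y => by rw [← Complex.exp_add]; simp
  have hform : ∀ y, wronskian (jostPlus u k) (jostMinus u k) (-y) =
      jostM u k (-y) * (-(2 * Complex.I * k) + 2 * (Complex.I * k) * jostM v k y +
        ∫ t in Set.Ioi y, (v t : ℂ) * jostM v k t) -
      (2 * Complex.I * k - ∫ t in Set.Ioi (-y), (u t : ℂ) * jostM u k t) * jostM v k y := by
    intro y
    rw [wronskian, hminus, deriv_comp_neg, neg_neg, deriv_jostPlus hk hu, deriv_jostPlus hk hu',
      jostPlus_eq u]
    beta_reduce
    rw [neg_neg, jostPlus_eq v]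
    linear_combination (jostM u k (-y) * (-(2 * Complex.I * k) + Complex.I * k * jostM v k y +
        ∫ t in Set.Ioi y, (v t : ℂ) * jostM v k t) -
      (2 * Complex.I * k - Complex.I * k * jostM u k (-y) -
        ∫ t in Set.Ioi (-y), (u t : ℂ) * jostM u k t) * jostM v k y) * hE y
  have h1 := tendsto_jostM hk hu'
  -- The bracket tends to `-2ik + 2ik = 0`, while `jostM u k` stays bounded on the whole line.
  have h2 : Tendsto (fun y => jostM u k (-y) * (-(2 * Complex.I * k) +
      2 * (Complex.I * k) * jostM v k y + ∫ t in Set.Ioi y, (v t : ℂ) * jostM v k t))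
      atTop (𝓝 0) := by
    obtain ⟨C, hC⟩ := hV.bounded
    have h3 : Tendsto (fun y => -(2 * Complex.I * k) + 2 * (Complex.I * k) * jostM v k y +
        ∫ t in Set.Ioi y, (v t : ℂ) * jostM v k t) atTop (𝓝 0) := by
      have := ((h1.const_mul (2 * (Complex.I * k))).const_add (-(2 * Complex.I * k))).add
        (tendsto_setIntegral_Ioi_zero (hI'.integrableOn (s := Set.Ioi 0)))
      convert this using 2
      ring
    rw [tendsto_zero_iff_norm_tendsto_zero] at h3 ⊢
    refine squeeze_zero (fun _ => norm_nonneg _) (fun y => ?_) (by simpa using h3.const_mul C)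
    rw [norm_mul]
    exact mul_le_mul_of_nonneg_right (hC _) (norm_nonneg _)
  have h4 := tendsto_setIntegral_Ioi_neg hI
  have h7 := h2.sub ((h4.const_sub (2 * Complex.I * k)).mul h1)
  have h8 : Tendsto (fun _ : ℝ => jostW u k) atTop _ := h7.congr fun y => by
    rw [← hconst y, hform y]
  rw [tendsto_nhds_unique tendsto_const_nhds h8]
  ring

/-! ### Holomorphy of the Wronskian, and bound states as its simple zeros -/

theorem exists_bound_jostM (hu : Integrable u) {r : ℝ} (hr : 0 < r) :
    ∃ C, ∀ k ∈ specDomain r, ∀ x, ‖jostM u k x‖ ≤ C := by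
  obtain ⟨m, hm, ⟨C, hC⟩, -⟩ := exists_volterraSolution hu hr
  exact ⟨C, fun k hk x => by
    rw [jostM_eq_of_isVolterraSolution hk.1 hu (hm k hk)]; exact hC k hk x⟩

theorem differentiableOn_jostM (hu : Integrable u) {r : ℝ} (hr : 0 < r) (x : ℝ) :
    DifferentiableOn ℂ (fun k => jostM u k x) (specDomain r) := by
  obtain ⟨m, hm, -, hd⟩ := exists_volterraSolution hu hr
  exact (hd x).congr fun k hk => by rw [jostM_eq_of_isVolterraSolution hk.1 hu (hm k hk)]

theorem analyticAt_jostW (hu : Integrable u) (hk : 0 < k.im) : AnalyticAt ℂ (jostW u) k := by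
  have hk0 : 0 < ‖k‖ := norm_pos_iff.mpr (ne_zero_of_im_pos hk)
  obtain ⟨C, hC⟩ := exists_bound_jostM hu (half_pos hk0)
  have h1 : DifferentiableOn ℂ (fun k => ∫ t, (u t : ℂ) * jostM u k t) (specDomain (‖k‖ / 2)) :=
    differentiableOn_integral_of_norm_le (isOpen_specDomain _) (b := fun t => |u t| * C)
      (hu.abs.mul_const C)
      (fun k hk => ((isVolterraSolution_jostM hk.1 hu).integrable_mul hu).aestronglyMeasurable)
      (fun t => (differentiableOn_jostM hu (half_pos hk0) t).const_mul _)
      (fun k hk t => by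
        rw [norm_mul, Complex.norm_real, Real.norm_eq_abs]
        exact mul_le_mul_of_nonneg_left (hC k hk t) (abs_nonneg _))
  have h2 : DifferentiableOn ℂ (jostW u) (specDomain (‖k‖ / 2)) := by
    refine DifferentiableOn.congr (f := fun k => -(2 * Complex.I * k) +
      ∫ t, (u t : ℂ) * jostM u k t) (DifferentiableOn.add (by fun_prop) h1) fun k hk => ?_
    exact jostW_eq hk.1 hu
  exact h2.analyticAt ((isOpen_specDomain _).mem_nhds ⟨hk, by linarith⟩)

/-- The factor `-1/(2ik)` is analytic and nonzero at `iβ`, hence does not affect orders, and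
inversion turns a pole of order one into a zero of order one. -/
theorem mem_boundStates_iff (hu : Integrable u) {β : ℝ} (hβ : 0 < β) :
    β ∈ boundStates u ↔ analyticOrderAt (jostW u) (Complex.I * β) = 1 := by
  have him : 0 < (Complex.I * (β : ℂ)).im := by simpa using hβ
  have hw := analyticAt_jostW hu him
  set k₀ : ℂ := Complex.I * β
  have hne : 2 * Complex.I * k₀ ≠ 0 := by simp [ne_zero_of_im_pos him]
  have hg : AnalyticAt ℂ (fun k : ℂ => -(1 / (2 * Complex.I * k))) k₀ := by
    have : AnalyticAt ℂ (fun k : ℂ => 2 * Complex.I * k) k₀ := by fun_prop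
    exact (analyticAt_const.div this hne).neg
  have hg0 : meromorphicOrderAt (fun k : ℂ => -(1 / (2 * Complex.I * k))) k₀ = 0 := by
    rw [hg.meromorphicOrderAt_eq, (hg.analyticOrderAt_eq_zero).mpr (by simpa using hne)]
    rfl
  have hT : transmission u = (fun k => (-(1 / (2 * Complex.I * k))) * jostW u k)⁻¹ := rfl
  have hmul : meromorphicOrderAt (fun k => (-(1 / (2 * Complex.I * k))) * jostW u k) k₀ =
      meromorphicOrderAt (jostW u) k₀ := by
    have := fun_meromorphicOrderAt_mul hg.meromorphicAt hw.meromorphicAt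
    rw [this, hg0, zero_add]
  simp only [boundStates, Set.mem_ofPred_eq, hβ, true_and]
  rw [hT, meromorphicOrderAt_inv, hmul, hw.meromorphicOrderAt_eq]
  cases h : analyticOrderAt (jostW u) k₀ with
  | top =>
    refine iff_of_false (fun h1 => ?_) (fun h1 => ENat.top_ne_one h1)
    have h2 : (⊤ : WithTop ℤ) = ((-1 : ℤ) : WithTop ℤ) := h1
    exact WithTop.top_ne_coe h2
  | coe n =>
    simp only [ENat.map_natCast]
    constructor
    · intro h1
      have h2 : ((-(n : ℤ) : ℤ) : WithTop ℤ) = ((-1 : ℤ) : WithTop ℤ) := h1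
      have : n = 1 := by have := WithTop.coe_injective h2; omega
      rw [this]; rfl
    · intro h1
      have : n = 1 := by exact_mod_cast h1
      rw [this]; rfl

/-! ### Reality on the imaginary axis -/

theorem conj_kern (κ y : ℝ) : (starRingEnd ℂ) (kern (Complex.I * κ) y) = kern (Complex.I * κ) y := by
  have h : 2 * Complex.I * (Complex.I * κ) = ((-(2 * κ) : ℝ) : ℂ) := by
    push_cast
    linear_combination 2 * (κ : ℂ) * Complex.I_sq
  rw [kern, h, ← Complex.ofReal_mul, ← Complex.ofReal_exp, ← Complex.ofReal_one,
    ← Complex.ofReal_sub, ← Complex.ofReal_div, Complex.conj_ofReal]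

/-- On the imaginary axis the kernel and the potential are real, so the conjugate solves the same
Volterra equation; uniqueness applies. -/
theorem conj_jostM (hu : Integrable u) {κ : ℝ} (hκ : 0 < κ) (x : ℝ) :
    (starRingEnd ℂ) (jostM u (Complex.I * κ) x) = jostM u (Complex.I * κ) x := by
  have him : 0 < (Complex.I * (κ : ℂ)).im := by simpa using hκ
  have h := isVolterraSolution_jostM him hu
  have h' : IsVolterraSolution (Complex.I * κ) u
      (fun x => (starRingEnd ℂ) (jostM u (Complex.I * κ) x)) := by
    refine ⟨Complex.continuous_conj.comp h.continuous, ?_, fun x => ?_⟩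
    · obtain ⟨C, hC⟩ := h.bounded
      exact ⟨C, fun x => by rw [Complex.norm_conj]; exact hC x⟩
    · rw [h.eq x, map_add, map_one, volterra, volterra, ← integral_conj]
      simp only [map_mul, conj_kern, Complex.conj_ofReal]
  exact (congrFun (jostM_eq_of_isVolterraSolution him hu h') x).symm

/-- The normalised Jost solution on the imaginary axis. -/
def jostR (u : ℝ → ℝ) (κ x : ℝ) : ℝ := (jostM u (Complex.I * κ) x).re

theorem jostM_eq_ofReal (hu : Integrable u) {κ : ℝ} (hκ : 0 < κ) (x : ℝ) :
    jostM u (Complex.I * κ) x = (jostR u κ x : ℂ) :=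
  (Complex.conj_eq_iff_re.mp (conj_jostM hu hκ x)).symm

theorem I_mul_I_mul (κ x : ℝ) : Complex.I * (Complex.I * κ) * x = ((-(κ * x) : ℝ) : ℂ) := by
  push_cast
  linear_combination (κ : ℂ) * x * Complex.I_sq

theorem jostPlus_eq_ofReal (hu : Integrable u) {κ : ℝ} (hκ : 0 < κ) (x : ℝ) :
    jostPlus u (Complex.I * κ) x = ((Real.exp (-(κ * x)) * jostR u κ x : ℝ) : ℂ) := by
  rw [jostPlus_eq, jostM_eq_ofReal hu hκ, I_mul_I_mul]
  push_cast; rfl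

theorem jostW_eq_ofReal (hu : Integrable u) {κ : ℝ} (hκ : 0 < κ) :
    jostW u (Complex.I * κ) = ((2 * κ + ∫ t, u t * jostR u κ t : ℝ) : ℂ) := by
  have him : 0 < (Complex.I * (κ : ℂ)).im := by simpa using hκ
  rw [jostW_eq him hu, Complex.ofReal_add, ← integral_complex_ofReal]
  congr 1
  · push_cast
    linear_combination -2 * (κ : ℂ) * Complex.I_sq
  · refine integral_congr_ae (Eventually.of_forall fun t => ?_)
    simp only [jostM_eq_ofReal hu hκ, Complex.ofReal_mul]

end KdV

end

noncomputable section

namespace KdV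

/-! ### Weighted estimates for the Volterra equation -/

/-- The weight `1 + max (-x) 0`, which controls the growth of Jost solutions at `-∞`. -/
def leftWeight (x : ℝ) : ℝ := 1 + max (-x) 0

theorem one_le_leftWeight (x : ℝ) : 1 ≤ leftWeight x := by
  have := le_max_right (-x) 0
  rw [leftWeight]; linarith

theorem leftWeight_pos (x : ℝ) : 0 < leftWeight x := zero_lt_one.trans_le (one_le_leftWeight x)

theorem continuous_leftWeight : Continuous leftWeight := by unfold leftWeight; fun_prop

theorem leftWeight_le (x : ℝ) : leftWeight x ≤ 1 + |x| := by
  have := max_le (neg_le_abs x) (abs_nonneg x)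
  rw [leftWeight]; linarith

theorem leftWeight_of_nonneg {x : ℝ} (hx : 0 ≤ x) : leftWeight x = 1 := by
  rw [leftWeight, max_eq_right (by linarith), add_zero]

/-- With `t₊`, `t₋` the positive and negative parts, `(t - x)₊ ≤ (1 + t₊)(1 + x₋)` and `(1 + t₊)(1 +
t₋) = 1 + |t|`. Kernel growth is thus shared between a moment of the potential in `t` and linear
growth at `-∞` in `x`. -/
theorem max_mul_leftWeight_le (x t : ℝ) :
    max (t - x) 0 * leftWeight t ≤ (1 + |t|) * leftWeight x := by
  have h1 : max (t - x) 0 ≤ (1 + max t 0) * leftWeight x := by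
    have a1 := le_max_left t 0
    have a2 := le_max_right t 0
    have a3 := le_max_left (-x) 0
    have a4 := le_max_right (-x) 0
    refine max_le ?_ (by have := leftWeight_pos x; positivity)
    rw [leftWeight]
    nlinarith
  have h2 : (1 + max t 0) * leftWeight t = 1 + |t| := by
    rcases le_total 0 t with h | h
    · rw [leftWeight_of_nonneg h, max_eq_left h, abs_of_nonneg h]; ring
    · rw [leftWeight, max_eq_right h, max_eq_left (by linarith), abs_of_nonpos h]; ring
  calc _ ≤ (1 + max t 0) * leftWeight x * leftWeight t :=
        mul_le_mul_of_nonneg_right h1 (leftWeight_pos t).le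
    _ = ((1 + max t 0) * leftWeight t) * leftWeight x := by ring
    _ = _ := by rw [h2]

theorem leftWeight_anti {x t : ℝ} (h : x ≤ t) : leftWeight t ≤ leftWeight x := by
  unfold leftWeight
  have := max_le_max (neg_le_neg h) (le_refl (0 : ℝ))
  linarith

theorem max_mul_leftWeight_pow_le (p : ℕ) (x t : ℝ) :
    max (t - x) 0 * leftWeight t ^ (p + 1) ≤ (1 + |t|) ^ 2 * leftWeight x ^ (p + 1) := by
  have ht := leftWeight_pos t
  have hx := leftWeight_pos x
  rcases le_total t x with h | h
  · rw [max_eq_right (by linarith), zero_mul]; positivity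
  · calc _ = max (t - x) 0 * leftWeight t * leftWeight t ^ p := by ring
      _ ≤ (1 + |t|) * leftWeight x * leftWeight x ^ p := by
          have := leftWeight_anti h
          have := max_mul_leftWeight_le x t
          gcongr
      _ ≤ _ := by
          have h1 : 1 + |t| ≤ (1 + |t|) ^ 2 := by nlinarith [abs_nonneg t]
          calc _ = (1 + |t|) * leftWeight x ^ (p + 1) := by ring
            _ ≤ _ := by gcongr

theorem max_sq_mul_leftWeight_le (x t : ℝ) :
    max (t - x) 0 ^ 2 * leftWeight t ≤ (1 + |t|) ^ 2 * leftWeight x ^ 2 := by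
  have h := max_mul_leftWeight_le x t
  have h1 := one_le_leftWeight t
  have h0 := le_max_right (t - x) 0
  calc _ ≤ max (t - x) 0 ^ 2 * leftWeight t ^ 2 := by
        gcongr
        nlinarith
    _ = (max (t - x) 0 * leftWeight t) ^ 2 := by ring
    _ ≤ ((1 + |t|) * leftWeight x) ^ 2 := by gcongr
    _ = _ := by ring

/-- Integrable functions with integrable second moment. -/
structure IsWeighted (u : ℝ → ℝ) : Prop where
  integrable : Integrable u
  integrable_sq : Integrable fun t => (1 + |t|) ^ 2 * |u t|

/-- The weighted norm `∫ (1 + |t|)² |u(t)| dt`. -/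
def weightedNorm (u : ℝ → ℝ) : ℝ := ∫ t, (1 + |t|) ^ 2 * |u t|

theorem weightedNorm_nonneg (u : ℝ → ℝ) : 0 ≤ weightedNorm u :=
  integral_nonneg fun t => by positivity

theorem IsWeighted.add {u v : ℝ → ℝ} (hu : IsWeighted u) (hv : IsWeighted v) :
    IsWeighted (fun x => u x + v x) := by
  refine ⟨hu.1.add hv.1, (hu.2.add hv.2).mono' ?_ (Eventually.of_forall fun t => ?_)⟩
  · exact (by fun_prop : Continuous fun t : ℝ => (1 + |t|) ^ 2).aestronglyMeasurable.mul
      (hu.1.add hv.1).abs.aestronglyMeasurable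
  · have := abs_add_le (u t) (v t)
    rw [Real.norm_of_nonneg (by positivity), Pi.add_apply, ← mul_add]
    gcongr

theorem weightedNorm_add_le {u v : ℝ → ℝ} (hu : IsWeighted u) (hv : IsWeighted v) :
    weightedNorm (fun x => u x + v x) ≤ weightedNorm u + weightedNorm v := by
  unfold weightedNorm
  rw [← integral_add hu.2 hv.2]
  refine integral_mono (hu.add hv).2 (hu.2.add hv.2) fun t => ?_
  beta_reduce
  rw [← mul_add]
  exact mul_le_mul_of_nonneg_left (abs_add_le _ _) (by positivity)

theorem IsWeighted.comp_neg {u : ℝ → ℝ} (hu : IsWeighted u) : IsWeighted (fun x => u (-x)) := by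
  refine ⟨hu.1.comp_neg, ?_⟩
  have := hu.2.comp_neg
  simpa only [abs_neg] using this

theorem weightedNorm_comp_neg (u : ℝ → ℝ) : weightedNorm (fun x => u (-x)) = weightedNorm u := by
  unfold weightedNorm
  rw [← integral_neg_eq_self (fun t => (1 + |t|) ^ 2 * |u t|)]
  simp only [abs_neg]

/-- Bounded continuous functions. -/
structure IsBC (φ : ℝ → ℂ) : Prop where
  continuous : Continuous φ
  bounded : ∃ C, ∀ x, ‖φ x‖ ≤ C

theorem IsBC.sub {φ ψ : ℝ → ℂ} (h : IsBC φ) (h' : IsBC ψ) : IsBC (fun x => φ x - ψ x) := by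
  obtain ⟨C, hC⟩ := h.2
  obtain ⟨D, hD⟩ := h'.2
  exact ⟨h.1.sub h'.1, C + D, fun x => (norm_sub_le _ _).trans (add_le_add (hC x) (hD x))⟩

variable {k l : ℂ} {u v : ℝ → ℝ} {φ ψ : ℝ → ℂ}

theorem IsVolterraSolution.isBC (h : IsVolterraSolution k u φ) : IsBC φ := ⟨h.1, h.2⟩

theorem IsBC.integrable_mul (h : IsBC φ) (hu : Integrable u) :
    Integrable fun t => (u t : ℂ) * φ t := by
  obtain ⟨C, hC⟩ := h.2
  exact integrable_mul_of_norm_le hu h.1 hC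

theorem volterra_sub (hk : 0 < k.im) (hu : Integrable u) (h : IsBC φ) (h' : IsBC ψ) (x : ℝ) :
    volterra k u (fun t => φ t - ψ t) x = volterra k u φ x - volterra k u ψ x := by
  simp only [volterra]
  rw [← integral_sub (integrable_kern_mul hk (h.integrable_mul hu) x)
    (integrable_kern_mul hk (h'.integrable_mul hu) x)]
  refine integral_congr_ae (Eventually.of_forall fun t => ?_)
  simp only; ring

theorem volterra_add_potential (hk : 0 < k.im) (hu : Integrable u) (hv : Integrable v)
    (h : IsBC φ) (x : ℝ) :
    volterra k (fun t => u t + v t) φ x = volterra k u φ x + volterra k v φ x := by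
  simp only [volterra]
  rw [← integral_add (integrable_kern_mul hk (h.integrable_mul hu) x)
    (integrable_kern_mul hk (h.integrable_mul hv) x)]
  refine integral_congr_ae (Eventually.of_forall fun t => ?_)
  simp only; push_cast; ring

theorem norm_volterra_le (hk : 0 < k.im) (hu : IsWeighted u) {C : ℝ} (p : ℕ)
    (hφ : ∀ t, ‖φ t‖ ≤ C * leftWeight t ^ (p + 1)) (x : ℝ) :
    ‖volterra k u φ x‖ ≤ C * weightedNorm u * leftWeight x ^ (p + 1) := by
  have hC : 0 ≤ C := by
    have h1 := (norm_nonneg _).trans (hφ 0)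
    rw [leftWeight_of_nonneg le_rfl] at h1
    simpa using h1
  have := norm_integral_le_of_norm_le (hu.2.const_mul (C * leftWeight x ^ (p + 1)))
    (f := fun t => kern k (t - x) * ((u t : ℂ) * φ t)) (Eventually.of_forall fun t => by
      rw [norm_mul, norm_mul, Complex.norm_real, Real.norm_eq_abs]
      calc _ ≤ max (t - x) 0 * (|u t| * (C * leftWeight t ^ (p + 1))) := by
            gcongr
            · exact norm_kern_le hk _
            · exact hφ t
        _ = C * |u t| * (max (t - x) 0 * leftWeight t ^ (p + 1)) := by ring
        _ ≤ C * |u t| * ((1 + |t|) ^ 2 * leftWeight x ^ (p + 1)) := by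
            have := max_mul_leftWeight_pow_le p x t
            gcongr
        _ = _ := by ring)
  rw [integral_const_mul] at this
  refine this.trans_eq ?_
  rw [weightedNorm]; ring

/-- Differencing in the spectral parameter costs one power of the left weight: growth of order one
becomes growth of order two. -/
theorem norm_volterra_sub_le (hk : 0 < k.im) (hl : 0 < l.im) (hu : IsWeighted u) (h : IsBC φ)
    {C : ℝ} (hφ : ∀ t, ‖φ t‖ ≤ C * leftWeight t) (x : ℝ) :
    ‖volterra k u φ x - volterra l u φ x‖ ≤
      2 * C * weightedNorm u * ‖k - l‖ * leftWeight x ^ 2 := by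
  have hC : 0 ≤ C := by
    have h1 := (norm_nonneg _).trans (hφ 0)
    rw [leftWeight_of_nonneg le_rfl] at h1
    simpa using h1
  rw [volterra, volterra, ← integral_sub (integrable_kern_mul hk (h.integrable_mul hu.1) x)
    (integrable_kern_mul hl (h.integrable_mul hu.1) x)]
  have := norm_integral_le_of_norm_le (hu.2.const_mul (2 * C * ‖k - l‖ * leftWeight x ^ 2))
    (f := fun t => kern k (t - x) * ((u t : ℂ) * φ t) - kern l (t - x) * ((u t : ℂ) * φ t))
    (Eventually.of_forall fun t => by
      rw [← sub_mul, norm_mul, norm_mul, Complex.norm_real, Real.norm_eq_abs]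
      calc _ ≤ 2 * ‖k - l‖ * max (t - x) 0 ^ 2 * (|u t| * (C * leftWeight t)) := by
            gcongr
            · exact norm_kern_sub_le hk hl _
            · exact hφ t
        _ = 2 * ‖k - l‖ * C * |u t| * (max (t - x) 0 ^ 2 * leftWeight t) := by ring
        _ ≤ 2 * ‖k - l‖ * C * |u t| * ((1 + |t|) ^ 2 * leftWeight x ^ 2) := by
            have := max_sq_mul_leftWeight_le x t
            gcongr
        _ = _ := by ring)
  rw [integral_const_mul] at this
  refine this.trans_eq ?_
  rw [weightedNorm]; ring

/-- The Gronwall constant attached to a bound `M` of the weighted norm. -/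
def gronwallConst (M : ℝ) : ℝ := 2 * Real.exp (2 * M)

theorem gronwallConst_pos (M : ℝ) : 0 < gronwallConst M := by unfold gronwallConst; positivity

/-- Gronwall for `‖φ‖` divided by the weight, with density `(1 + |t|)² |u|`. The constant depends on
`M` alone, not on `k`, since the kernel is bounded by `norm_kern_le`; boundedness of `φ` only makes
the Gronwall supremum finite. -/
theorem norm_le_of_volterra_eq (hk : 0 < k.im) (hu : IsWeighted u) {M : ℝ}
    (hM : weightedNorm u ≤ M) (h : IsBC φ) {g : ℝ → ℂ} {c : ℝ} (p : ℕ)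
    (hg : ∀ x, ‖g x‖ ≤ c * leftWeight x ^ (p + 1)) (hφ : ∀ x, φ x = g x + volterra k u φ x)
    (x : ℝ) : ‖φ x‖ ≤ gronwallConst M * c * leftWeight x ^ (p + 1) := by
  have hc : 0 ≤ c := by
    have h1 := (norm_nonneg _).trans (hg 0)
    rw [leftWeight_of_nonneg le_rfl] at h1
    simpa using h1
  obtain ⟨C, hC⟩ := h.2
  have hC0 : 0 ≤ C := (norm_nonneg _).trans (hC 0)
  have hpw : ∀ x, 0 < leftWeight x ^ (p + 1) := fun x => pow_pos (leftWeight_pos x) _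
  have hcont : Continuous fun t => ‖φ t‖ / leftWeight t ^ (p + 1) :=
    h.1.norm.div (continuous_leftWeight.pow _) fun t => (hpw t).ne'
  have hbd : ∀ t, ‖φ t‖ / leftWeight t ^ (p + 1) ≤ C := fun t => by
    rw [div_le_iff₀ (hpw t)]
    have : 1 ≤ leftWeight t ^ (p + 1) := one_le_pow₀ (one_le_leftWeight t)
    nlinarith [hC t]
  have hnn : ∀ t, 0 ≤ ‖φ t‖ / leftWeight t ^ (p + 1) := fun t =>
    div_nonneg (norm_nonneg _) (hpw t).le
  have hint : Integrable fun t => (1 + |t|) ^ 2 * |u t| * (‖φ t‖ / leftWeight t ^ (p + 1)) :=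
    hu.2.mul_bdd (c := C) hcont.aestronglyMeasurable (Eventually.of_forall fun t => by
      rw [Real.norm_of_nonneg (hnn t)]; exact hbd t)
  have key := gronwall_Ioi (a := fun t => (1 + |t|) ^ 2 * |u t|)
    (h := fun t => ‖φ t‖ / leftWeight t ^ (p + 1)) (c := c) (M := C) (fun t => by positivity)
    hu.2 hcont.aestronglyMeasurable hnn hbd hc (fun x => by
      rw [div_le_iff₀ (hpw x), hφ x, add_mul]
      refine (norm_add_le _ _).trans (add_le_add (hg x) ?_)
      rw [← integral_mul_const]
      refine norm_integral_kern_mul_le (K := fun t => kern k (t - x)) x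
        (fun t ht => kern_of_nonpos k (by linarith)) (hint.mul_const _).integrableOn fun t ht => ?_
      rw [norm_mul, norm_mul, Complex.norm_real, Real.norm_eq_abs]
      have e : ‖φ t‖ = ‖φ t‖ / leftWeight t ^ (p + 1) * leftWeight t ^ (p + 1) :=
        (div_mul_cancel₀ _ (hpw t).ne').symm
      set q := ‖φ t‖ / leftWeight t ^ (p + 1)
      have hq : 0 ≤ q := hnn t
      rw [e]
      calc _ ≤ max (t - x) 0 * (|u t| * (q * leftWeight t ^ (p + 1))) := by
            have := leftWeight_pos t
            gcongr
            exact norm_kern_le hk _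
        _ = |u t| * q * (max (t - x) 0 * leftWeight t ^ (p + 1)) := by ring
        _ ≤ |u t| * q * ((1 + |t|) ^ 2 * leftWeight x ^ (p + 1)) := by
            have := max_mul_leftWeight_pow_le p x t
            gcongr
        _ = _ := by ring) x
  rw [div_le_iff₀ (hpw x)] at key
  refine key.trans ?_
  have h1 : Real.exp (2 * ∫ t, (1 + |t|) ^ 2 * |u t|) ≤ Real.exp (2 * M) := by
    rw [Real.exp_le_exp]
    exact mul_le_mul_of_nonneg_left hM (by norm_num)
  have := hpw x
  calc _ ≤ 2 * c * Real.exp (2 * M) * leftWeight x ^ (p + 1) := by gcongr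
    _ = _ := by rw [gronwallConst]; ring

/-! ### Perturbation of the Jost solutions -/

theorem isBC_jostM (hk : 0 < k.im) (hu : IsWeighted u) : IsBC (jostM u k) :=
  (isVolterraSolution_jostM hk hu.1).isBC

theorem norm_jostM_le (hk : 0 < k.im) (hu : IsWeighted u) {M : ℝ} (hM : weightedNorm u ≤ M)
    (x : ℝ) : ‖jostM u k x‖ ≤ gronwallConst M * leftWeight x := by
  have h := isVolterraSolution_jostM hk hu.1
  have := norm_le_of_volterra_eq hk hu hM h.isBC (g := fun _ => 1) (c := 1) 0
    (fun x => by simpa using one_le_leftWeight x) h.eq x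
  simpa using this

/-- The difference solves the Volterra equation at `l` with source `(V_k - V_l) m_k`. -/
theorem norm_jostM_sub_le (hk : 0 < k.im) (hl : 0 < l.im) (hu : IsWeighted u) {M : ℝ}
    (hM : weightedNorm u ≤ M) (x : ℝ) :
    ‖jostM u k x - jostM u l x‖ ≤ 2 * gronwallConst M ^ 2 * M * ‖k - l‖ * leftWeight x ^ 2 := by
  have hK := gronwallConst_pos M
  have h := isVolterraSolution_jostM hk hu.1
  have h' := isVolterraSolution_jostM hl hu.1
  have := norm_le_of_volterra_eq hl hu hM (h.isBC.sub h'.isBC)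
    (g := fun x => volterra k u (jostM u k) x - volterra l u (jostM u k) x)
    (c := 2 * gronwallConst M * M * ‖k - l‖) 1
    (fun x => (norm_volterra_sub_le hk hl hu h.isBC (norm_jostM_le hk hu hM) x).trans (by
      have := leftWeight_pos x
      norm_num only
      gcongr))
    (fun x => by
      rw [volterra_sub hl hu.1 h.isBC h'.isBC]
      have e1 := h.eq x
      have e2 := h'.eq x
      linear_combination e1 - e2) x
  refine this.trans_eq ?_
  ring

/-- The difference solves the Volterra equation of `u` with source the Volterra operator of `v`
applied to the perturbed solution. -/
theorem norm_jostM_add_sub_le (hk : 0 < k.im) (hu : IsWeighted u) (hv : IsWeighted v) {M : ℝ}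
    (hM : weightedNorm u ≤ M) (hM' : weightedNorm (fun x => u x + v x) ≤ M) (x : ℝ) :
    ‖jostM (fun x => u x + v x) k x - jostM u k x‖ ≤
      gronwallConst M ^ 2 * weightedNorm v * leftWeight x := by
  have hK := gronwallConst_pos M
  have h := isVolterraSolution_jostM hk (hu.add hv).1
  have h' := isVolterraSolution_jostM hk hu.1
  have := norm_le_of_volterra_eq hk hu hM (h.isBC.sub h'.isBC)
    (g := fun x => volterra k v (jostM (fun x => u x + v x) k) x)
    (c := gronwallConst M * weightedNorm v) 0
    (fun x => norm_volterra_le hk hv 0 (fun t => by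
      simpa using norm_jostM_le hk (hu.add hv) hM' t) x)
    (fun x => by
      rw [volterra_sub hk hu.1 h.isBC h'.isBC]
      have e1 := h.eq x
      have e2 := h'.eq x
      rw [volterra_add_potential hk hu.1 hv.1 h.isBC] at e1
      linear_combination e1 - e2) x
  refine this.trans_eq ?_
  ring

/-- The mixed difference solves the Volterra equation of `u` at `l` with three sources: the kernel
difference in the potential `v`, the potential `v` acting on `m_k - m_l`, and the kernel difference
in `u` acting on the change of `m_k` due to `v`. Each carries both small factors `weightedNorm v`
and `‖k - l‖`. -/
theorem norm_jostM_second_diff_le (hk : 0 < k.im) (hl : 0 < l.im) (hu : IsWeighted u)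
    (hv : IsWeighted v) {M : ℝ} (hM : weightedNorm u ≤ M)
    (hM' : weightedNorm (fun x => u x + v x) ≤ M) (x : ℝ) :
    ‖(jostM (fun x => u x + v x) k x - jostM u k x) -
      (jostM (fun x => u x + v x) l x - jostM u l x)‖ ≤
      (2 * gronwallConst M ^ 2 + 4 * gronwallConst M ^ 3 * M) * weightedNorm v * ‖k - l‖ *
        leftWeight x ^ 2 := by
  set K := gronwallConst M with hKdef
  have hK : 0 < K := gronwallConst_pos M
  have hδ := weightedNorm_nonneg v
  have hMnn : 0 ≤ M := (weightedNorm_nonneg u).trans hM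
  have huv := hu.add hv
  have hk1 := isVolterraSolution_jostM hk huv.1
  have hl1 := isVolterraSolution_jostM hl huv.1
  have hk0 := isVolterraSolution_jostM hk hu.1
  have hl0 := isVolterraSolution_jostM hl hu.1
  set mk := jostM (fun x => u x + v x) k
  set ml := jostM (fun x => u x + v x) l
  set nk := jostM u k
  set nl := jostM u l
  have := norm_le_of_volterra_eq hl hu hM ((hk1.isBC.sub hk0.isBC).sub (hl1.isBC.sub hl0.isBC))
    (g := fun x => (volterra k v mk x - volterra l v mk x) +
      volterra l v (fun t => mk t - ml t) x + (volterra k u (fun t => mk t - nk t) x -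
        volterra l u (fun t => mk t - nk t) x))
    (c := (2 * K + 4 * K ^ 2 * M) * weightedNorm v * ‖k - l‖) 1
    (fun x => by
      have hx := leftWeight_pos x
      have a1 := norm_volterra_sub_le hk hl hv hk1.isBC (norm_jostM_le hk huv hM') x
      have a2 := norm_volterra_le hl hv 1 (norm_jostM_sub_le hk hl huv hM') x
      have a3 := norm_volterra_sub_le hk hl hu (hk1.isBC.sub hk0.isBC)
        (norm_jostM_add_sub_le hk hu hv hM hM') x
      have a4 : 2 * (K ^ 2 * weightedNorm v) * weightedNorm u * ‖k - l‖ * leftWeight x ^ 2 ≤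
          2 * (K ^ 2 * weightedNorm v) * M * ‖k - l‖ * leftWeight x ^ 2 := by gcongr
      refine (norm_add₃_le).trans ?_
      refine (add_le_add (add_le_add a1 a2) (a3.trans a4)).trans_eq ?_
      ring)
    (fun x => by
      rw [volterra_sub hl hu.1 (hk1.isBC.sub hk0.isBC) (hl1.isBC.sub hl0.isBC),
        volterra_sub hl hv.1 hk1.isBC hl1.isBC, volterra_sub hk hu.1 hk1.isBC hk0.isBC,
        volterra_sub hl hu.1 hl1.isBC hl0.isBC]
      have e1 := hk1.eq x
      have e2 := hl1.eq x
      have e3 := hk0.eq x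
      have e4 := hl0.eq x
      rw [volterra_add_potential hk hu.1 hv.1 hk1.isBC] at e1
      rw [volterra_add_potential hl hu.1 hv.1 hl1.isBC] at e2
      linear_combination e1 - e2 - e3 + e4) x
  refine this.trans_eq ?_
  ring

theorem norm_integral_mul_le (hu : IsWeighted u) {C : ℝ} (hφ : ∀ t, ‖φ t‖ ≤ C * leftWeight t ^ 2) :
    ‖∫ t, (u t : ℂ) * φ t‖ ≤ C * weightedNorm u := by
  have hC : 0 ≤ C := by
    have h1 := (norm_nonneg _).trans (hφ 0)
    rw [leftWeight_of_nonneg le_rfl] at h1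
    simpa using h1
  have := norm_integral_le_of_norm_le (hu.2.const_mul C)
    (f := fun t => (u t : ℂ) * φ t) (Eventually.of_forall fun t => by
      rw [norm_mul, Complex.norm_real, Real.norm_eq_abs]
      calc _ ≤ |u t| * (C * leftWeight t ^ 2) := by gcongr; exact hφ t
        _ ≤ |u t| * (C * (1 + |t|) ^ 2) := by
            have := leftWeight_pos t
            have := leftWeight_le t
            gcongr
        _ = _ := by ring)
  rw [integral_const_mul] at this
  exact this

theorem jostW_add_sub (hk : 0 < k.im) (hu : IsWeighted u) (hv : IsWeighted v) :
    jostW (fun x => u x + v x) k - jostW u k =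
      (∫ t, (v t : ℂ) * jostM (fun x => u x + v x) k t) +
      ∫ t, (u t : ℂ) * (jostM (fun x => u x + v x) k t - jostM u k t) := by
  have h := isBC_jostM hk (hu.add hv)
  have h' := isBC_jostM hk hu
  have e : ∫ t, ((u t + v t : ℝ) : ℂ) * jostM (fun x => u x + v x) k t =
      (∫ t, (v t : ℂ) * jostM (fun x => u x + v x) k t) +
      ∫ t, (u t : ℂ) * jostM (fun x => u x + v x) k t := by
    rw [← integral_add (h.integrable_mul hv.1) (h.integrable_mul hu.1)]
    refine integral_congr_ae (Eventually.of_forall fun t => ?_)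
    simp only; push_cast; ring
  have e' : ∫ t, (u t : ℂ) * (jostM (fun x => u x + v x) k t - jostM u k t) =
      (∫ t, (u t : ℂ) * jostM (fun x => u x + v x) k t) - ∫ t, (u t : ℂ) * jostM u k t := by
    rw [← integral_sub (h.integrable_mul hu.1) (h'.integrable_mul hu.1)]
    simp only [mul_sub]
  rw [jostW_eq hk (hu.add hv).1, jostW_eq hk hu.1, e, e']
  ring

/-- Constant in the perturbation estimates for the Wronskian. -/
def wronskianConst (M : ℝ) : ℝ :=
  gronwallConst M + gronwallConst M ^ 2 * M + 2 * gronwallConst M ^ 2 * M +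
    (2 * gronwallConst M ^ 2 + 4 * gronwallConst M ^ 3 * M) * M

theorem norm_jostW_add_sub_le (hk : 0 < k.im) (hu : IsWeighted u) (hv : IsWeighted v) {M : ℝ}
    (hM : weightedNorm u ≤ M) (hM' : weightedNorm (fun x => u x + v x) ≤ M) :
    ‖jostW (fun x => u x + v x) k - jostW u k‖ ≤ wronskianConst M * weightedNorm v := by
  have hK := gronwallConst_pos M
  have hδ := weightedNorm_nonneg v
  have hMnn : 0 ≤ M := (weightedNorm_nonneg u).trans hM
  have hw : ∀ t, leftWeight t ≤ leftWeight t ^ 2 := fun t => by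
    have := one_le_leftWeight t; nlinarith
  rw [jostW_add_sub hk hu hv]
  have a1 := norm_integral_mul_le hv (C := gronwallConst M)
    fun t => (norm_jostM_le hk (hu.add hv) hM' t).trans
      (mul_le_mul_of_nonneg_left (hw t) hK.le)
  have a2 := norm_integral_mul_le hu (C := gronwallConst M ^ 2 * weightedNorm v)
    fun t => (norm_jostM_add_sub_le hk hu hv hM hM' t).trans
      (mul_le_mul_of_nonneg_left (hw t) (by positivity))
  have a3 : gronwallConst M ^ 2 * weightedNorm v * weightedNorm u ≤
      gronwallConst M ^ 2 * weightedNorm v * M := by gcongr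
  have a4 : 0 ≤ (2 * gronwallConst M ^ 2 * M +
    (2 * gronwallConst M ^ 2 + 4 * gronwallConst M ^ 3 * M) * M) * weightedNorm v := by positivity
  refine (norm_add_le _ _).trans ((add_le_add a1 (a2.trans a3)).trans ?_)
  rw [wronskianConst]
  linarith

/-- The perturbation of the Wronskian has a small Lipschitz constant in the spectral parameter,
uniformly up to the real axis and `k = 0`. This keeps zeros simple and allows at most one to emerge
from the origin. -/
theorem norm_jostW_second_diff_le (hk : 0 < k.im) (hl : 0 < l.im) (hu : IsWeighted u)
    (hv : IsWeighted v) {M : ℝ} (hM : weightedNorm u ≤ M)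
    (hM' : weightedNorm (fun x => u x + v x) ≤ M) :
    ‖(jostW (fun x => u x + v x) k - jostW u k) - (jostW (fun x => u x + v x) l - jostW u l)‖ ≤
      wronskianConst M * weightedNorm v * ‖k - l‖ := by
  have hK := gronwallConst_pos M
  have hδ := weightedNorm_nonneg v
  have hMnn : 0 ≤ M := (weightedNorm_nonneg u).trans hM
  have huv := hu.add hv
  have bk1 := isBC_jostM hk huv
  have bl1 := isBC_jostM hl huv
  have bk0 := isBC_jostM hk hu
  have bl0 := isBC_jostM hl hu
  have e : (jostW (fun x => u x + v x) k - jostW u k) -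
      (jostW (fun x => u x + v x) l - jostW u l) =
      (∫ t, (v t : ℂ) * (jostM (fun x => u x + v x) k t - jostM (fun x => u x + v x) l t)) +
      ∫ t, (u t : ℂ) * ((jostM (fun x => u x + v x) k t - jostM u k t) -
        (jostM (fun x => u x + v x) l t - jostM u l t)) := by
    rw [jostW_add_sub hk hu hv, jostW_add_sub hl hu hv]
    simp only [mul_sub (_ : ℂ) (jostM (fun x => u x + v x) k _) (jostM (fun x => u x + v x) l _)]
    rw [integral_sub (bk1.integrable_mul hv.1) (bl1.integrable_mul hv.1)]
    simp only [mul_sub (_ : ℂ) (jostM (fun x => u x + v x) k _ - jostM u k _)]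
    rw [integral_sub ((bk1.sub bk0).integrable_mul hu.1) ((bl1.sub bl0).integrable_mul hu.1)]
    ring
  rw [e]
  have a1 := norm_integral_mul_le hv (norm_jostM_sub_le hk hl huv hM')
  have a2 := norm_integral_mul_le hu (norm_jostM_second_diff_le hk hl hu hv hM hM')
  have a3 : (2 * gronwallConst M ^ 2 + 4 * gronwallConst M ^ 3 * M) * weightedNorm v * ‖k - l‖ *
      weightedNorm u ≤ (2 * gronwallConst M ^ 2 + 4 * gronwallConst M ^ 3 * M) *
      weightedNorm v * ‖k - l‖ * M := by gcongr
  have a4 : 0 ≤ (gronwallConst M + gronwallConst M ^ 2 * M) * weightedNorm v * ‖k - l‖ := by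
    positivity
  refine (norm_add_le _ _).trans ((add_le_add a1 (a2.trans a3)).trans ?_)
  rw [wronskianConst]
  linarith

end KdV

end

noncomputable section

namespace KdV

/-! ### Uniqueness for the initial value problem -/

variable {k : ℂ} {u v : ℝ → ℝ}

/-- Gronwall for `‖f‖ + ‖f'‖` with density `1 + |u| + ‖k‖²`, cut off to `[y, x₀]` to make everything
integrable. The inequality integrates to the right, so zero data propagate to the left; the other
direction follows by reflection. -/
theorem IsSchrodingerSolution.eq_zero_of_le {f : ℝ → ℂ} (hu : Integrable u)
    (h : IsSchrodingerSolution u k f) {x₀ : ℝ} (h0 : f x₀ = 0) (h0' : deriv f x₀ = 0) {y : ℝ}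
    (hy : y ≤ x₀) : f y = 0 := by
  have hf := h.isPrim hu
  have hf' := h.isPrim_deriv hu
  set I := Set.Icc y x₀ with hI
  set H : ℝ → ℝ := fun x => ‖f x‖ + ‖deriv f x‖ with hH
  have hHc : Continuous H := hf.continuous.norm.add hf'.continuous.norm
  have hH0 : ∀ x, 0 ≤ H x := fun x => by positivity
  obtain ⟨M, hM⟩ := (isCompact_Icc (a := y) (b := x₀)).exists_bound_of_continuousOn
    hHc.continuousOn
  have hM' : ∀ x ∈ I, H x ≤ M := fun x hx => (le_abs_self _).trans (hM x hx)
  have hM0 : 0 ≤ M := (hH0 y).trans (hM' y (Set.left_mem_Icc.mpr hy))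
  set b : ℝ → ℝ := fun x => 1 + |u x| + ‖k‖ ^ 2 with hb
  have hb0 : ∀ x, 0 ≤ b x := fun x => by positivity
  have hbl : LocallyIntegrable b :=
    ((continuous_const (y := (1 : ℝ))).locallyIntegrable.add hu.abs.locallyIntegrable).add
      continuous_const.locallyIntegrable
  have hbi : Integrable (I.indicator b) :=
    (integrable_indicator_iff measurableSet_Icc).mpr (hbl.integrableOn_isCompact isCompact_Icc)
  have hle : ∀ x ∈ I, H x ≤ ∫ t in Set.Ioi x, I.indicator b t * I.indicator H t := by
    intro x hx
    have e1 : f x = -∫ s in x..x₀, deriv f s := by rw [← hf.2 x x₀, h0]; ring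
    have e2 : deriv f x = -∫ s in x..x₀, ((u s : ℂ) - k ^ 2) * f s := by
      rw [← hf'.2 x x₀, h0']; ring
    have i1 := (LocallyIntegrable.intervalIntegrable' hf.1 x x₀).norm
    have i2 := (LocallyIntegrable.intervalIntegrable' hf'.1 x x₀).norm
    have n1 := intervalIntegral.norm_integral_le_integral_norm (μ := volume) (f := deriv f) hx.2
    have n2 := intervalIntegral.norm_integral_le_integral_norm (μ := volume)
      (f := fun s => ((u s : ℂ) - k ^ 2) * f s) hx.2
    have e3 : H x ≤ ∫ s in x..x₀, (‖deriv f s‖ + ‖((u s : ℂ) - k ^ 2) * f s‖) := by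
      rw [intervalIntegral.integral_add i1 i2]
      have m1 : ‖f x‖ = ‖∫ s in x..x₀, deriv f s‖ := by rw [e1, norm_neg]
      have m2 : ‖deriv f x‖ = ‖∫ s in x..x₀, ((u s : ℂ) - k ^ 2) * f s‖ := by
        rw [e2, norm_neg]
      simp only [hH]
      rw [m1, m2]
      exact add_le_add n1 n2
    rw [intervalIntegral.integral_of_le hx.2] at e3
    refine e3.trans ?_
    have hint : Integrable fun t => I.indicator b t * I.indicator H t := by
      refine hbi.mul_bdd (c := M)
        (hHc.measurable.indicator measurableSet_Icc).aestronglyMeasurable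
        (Eventually.of_forall fun t => ?_)
      rw [Real.norm_of_nonneg (Set.indicator_nonneg (fun _ _ => hH0 _) t)]
      exact Set.indicator_le' (fun t ht => hM' t ht) (fun _ _ => hM0) t
    refine le_trans (setIntegral_mono_on (g := fun t => I.indicator b t * I.indicator H t)
      ((intervalIntegrable_iff_integrableOn_Ioc_of_le hx.2).mp (i1.add i2)) hint.integrableOn
      measurableSet_Ioc fun t ht => ?_) (setIntegral_mono_set hint.integrableOn
        (Eventually.of_forall fun t => mul_nonneg
          (Set.indicator_nonneg (fun _ _ => hb0 _) t) (Set.indicator_nonneg (fun _ _ => hH0 _) t))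
        (Eventually.of_forall fun t (ht : t ∈ Set.Ioc x x₀) => ht.1))
    have htI : t ∈ I := ⟨hx.1.trans ht.1.le, ht.2⟩
    rw [Set.indicator_of_mem htI, Set.indicator_of_mem htI, norm_mul]
    have n3 : ‖(u t : ℂ) - k ^ 2‖ ≤ |u t| + ‖k‖ ^ 2 := by
      refine (norm_sub_le _ _).trans ?_
      rw [Complex.norm_real, Real.norm_eq_abs, norm_pow]
    have n4 := mul_le_mul_of_nonneg_right n3 (norm_nonneg (f t))
    have n5 : 0 ≤ (|u t| + ‖k‖ ^ 2) * ‖deriv f t‖ := by positivity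
    simp only [hb, hH]
    nlinarith [norm_nonneg (f t)]
  have key := gronwall_Ioi (a := I.indicator b) (h := I.indicator H) (c := 0) (M := M)
    (fun t => Set.indicator_nonneg (fun _ _ => hb0 _) t) hbi
    (hHc.measurable.indicator measurableSet_Icc).aestronglyMeasurable
    (fun t => Set.indicator_nonneg (fun _ _ => hH0 _) t)
    (fun t => Set.indicator_le' (fun t ht => hM' t ht) (fun _ _ => hM0) t) le_rfl
    (fun x => by
      rw [zero_add]
      by_cases hx : x ∈ I
      · rw [Set.indicator_of_mem hx]; exact hle x hx
      · rw [Set.indicator_of_notMem hx]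
        exact integral_nonneg fun t => mul_nonneg
          (Set.indicator_nonneg (fun _ _ => hb0 _) t) (Set.indicator_nonneg (fun _ _ => hH0 _) t)) y
  rw [Set.indicator_of_mem (Set.left_mem_Icc.mpr hy)] at key
  have h1 : ‖f y‖ ≤ 0 := by
    have := norm_nonneg (deriv f y)
    simp only [hH] at key
    linarith
  exact norm_le_zero_iff.mp h1

theorem IsSchrodingerSolution.eq_zero {f : ℝ → ℂ} (hu : Integrable u)
    (h : IsSchrodingerSolution u k f) {x₀ : ℝ} (h0 : f x₀ = 0) (h0' : deriv f x₀ = 0) (y : ℝ) :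
    f y = 0 := by
  rcases le_total y x₀ with hy | hy
  · exact h.eq_zero_of_le hu h0 h0' hy
  · have := h.comp_neg.eq_zero_of_le hu.comp_neg (x₀ := -x₀) (y := -y) (by simpa using h0)
      (by rw [deriv_comp_neg]; simpa using h0') (by linarith)
    simpa using this

theorem IsSchrodingerSolution.sub_const_mul {f g : ℝ → ℂ} (hu : Integrable u)
    (hf : IsSchrodingerSolution u k f) (hg : IsSchrodingerSolution u k g) (c : ℂ) :
    IsSchrodingerSolution u k (fun x => g x + c * f x) ∧
      ∀ x, deriv (fun x => g x + c * f x) x = deriv g x + c * deriv f x :=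
  isSchrodingerSolution_of_isPrim ((hg.isPrim hu).add ((hf.isPrim hu).const_mul c))
    (((hg.isPrim_deriv hu).add ((hf.isPrim_deriv hu).const_mul c)).congr fun x => by ring)

/-- At a zero of the Wronskian the Jost solutions are proportional. -/
theorem jostMinus_mul_eq (hk : 0 < k.im) (hu : Integrable u) (hW : jostW u k = 0) {x₀ : ℝ}
    (hx₀ : jostPlus u k x₀ ≠ 0) (x : ℝ) :
    jostMinus u k x = jostMinus u k x₀ / jostPlus u k x₀ * jostPlus u k x := by
  have hp := (isJostPlus_jostPlus hk hu).1
  have hm := (isJostMinus_jostMinus hk hu).1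
  set c := jostMinus u k x₀ / jostPlus u k x₀ with hc
  obtain ⟨hs, hd⟩ := hp.sub_const_mul hu hm (-c)
  have hw : wronskian (jostPlus u k) (jostMinus u k) x₀ = 0 := by
    rw [wronskian_eq_zero_point hu hp hm]; exact hW
  have := hs.eq_zero hu (x₀ := x₀) (by rw [hc]; field_simp; ring) (by
    rw [hd]
    refine mul_left_cancel₀ hx₀ ?_
    rw [wronskian] at hw
    rw [hc]
    field_simp
    linear_combination hw) x
  linear_combination this

/-! ### Norming constants -/

/-- The `L²` norm on the positive half-line of the Jost solution at `iκ`. -/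
def halfNorm (u : ℝ → ℝ) (κ : ℝ) : ℝ := ∫ x in Set.Ioi 0, (Real.exp (-(κ * x)) * jostR u κ x) ^ 2

theorem im_I_mul_pos {κ : ℝ} (hκ : 0 < κ) : 0 < (Complex.I * (κ : ℂ)).im := by simpa using hκ

theorem continuous_jostR (hu : Integrable u) {κ : ℝ} (hκ : 0 < κ) : Continuous (jostR u κ) :=
  Complex.continuous_re.comp (isVolterraSolution_jostM (im_I_mul_pos hκ) hu).continuous

theorem tendsto_jostR (hu : Integrable u) {κ : ℝ} (hκ : 0 < κ) :
    Tendsto (jostR u κ) atTop (𝓝 1) := by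
  have := (Complex.continuous_re.tendsto _).comp (tendsto_jostM (im_I_mul_pos hκ) hu)
  rwa [Complex.one_re] at this

theorem abs_jostR_le (hu : IsWeighted u) {M : ℝ} (hM : weightedNorm u ≤ M) {κ : ℝ} (hκ : 0 < κ)
    {x : ℝ} (hx : 0 ≤ x) : |jostR u κ x| ≤ gronwallConst M := by
  have := norm_jostM_le (im_I_mul_pos hκ) hu hM x
  rw [leftWeight_of_nonneg hx, mul_one] at this
  exact (Complex.abs_re_le_norm _).trans this

/-- Lipschitz constant of the Jost solutions. -/
def jostConst (M : ℝ) : ℝ := gronwallConst M ^ 2 + 2 * gronwallConst M ^ 2 * M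

theorem abs_jostR_sub_le (hu : IsWeighted u) (hv : IsWeighted v) {M : ℝ}
    (hM : weightedNorm u ≤ M) (hM' : weightedNorm (fun x => u x + v x) ≤ M) {κ κ₀ : ℝ}
    (hκ : 0 < κ) (hκ₀ : 0 < κ₀) (x : ℝ) :
    |jostR (fun x => u x + v x) κ x - jostR u κ₀ x| ≤
      jostConst M * (weightedNorm v + |κ - κ₀|) * leftWeight x ^ 2 := by
  have hK := gronwallConst_pos M
  have hδ := weightedNorm_nonneg v
  have hMnn : 0 ≤ M := (weightedNorm_nonneg u).trans hM
  have a1 := norm_jostM_add_sub_le (im_I_mul_pos hκ) hu hv hM hM' x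
  have a2 := norm_jostM_sub_le (im_I_mul_pos hκ) (im_I_mul_pos hκ₀) hu hM x
  have e : ‖Complex.I * (κ : ℂ) - Complex.I * κ₀‖ = |κ - κ₀| := by
    rw [← mul_sub, norm_mul, Complex.norm_I, one_mul, ← Complex.ofReal_sub, Complex.norm_real,
      Real.norm_eq_abs]
  rw [e] at a2
  have a3 : |jostR (fun x => u x + v x) κ x - jostR u κ₀ x| ≤
      ‖jostM (fun x => u x + v x) (Complex.I * κ) x - jostM u (Complex.I * κ) x‖ +
      ‖jostM u (Complex.I * κ) x - jostM u (Complex.I * κ₀) x‖ := by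
    rw [jostR, jostR, ← Complex.sub_re]
    refine (Complex.abs_re_le_norm _).trans ?_
    exact norm_sub_le_norm_sub_add_norm_sub _ _ _
  have hw := one_le_leftWeight x
  have a4 : gronwallConst M ^ 2 * weightedNorm v * leftWeight x ≤
      gronwallConst M ^ 2 * weightedNorm v * leftWeight x ^ 2 := by
    gcongr
    nlinarith
  have a5 : 0 ≤ gronwallConst M ^ 2 * |κ - κ₀| * leftWeight x ^ 2 := by positivity
  have a6 : 0 ≤ 2 * gronwallConst M ^ 2 * M * weightedNorm v * leftWeight x ^ 2 := by positivity
  rw [jostConst]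
  nlinarith

theorem abs_exp_neg_mul_sub_le {η κ κ₀ x : ℝ} (hκ : η ≤ κ) (hκ₀ : η ≤ κ₀) (hx : 0 ≤ x) :
    |Real.exp (-(κ * x)) - Real.exp (-(κ₀ * x))| ≤ |κ - κ₀| * x * Real.exp (-(η * x)) := by
  have key : ∀ a b : ℝ, η ≤ a → a ≤ b →
      |Real.exp (-(a * x)) - Real.exp (-(b * x))| ≤ |a - b| * x * Real.exp (-(η * x)) := by
    intro a b ha hab
    have h1 : Real.exp (-(b * x)) = Real.exp (-(a * x)) * Real.exp (-((b - a) * x)) := by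
      rw [← Real.exp_add]; ring_nf
    have h2 := Real.add_one_le_exp (-((b - a) * x))
    have h3 : Real.exp (-(b * x)) ≤ Real.exp (-(a * x)) := Real.exp_le_exp.mpr (by nlinarith)
    have h4 : Real.exp (-(a * x)) ≤ Real.exp (-(η * x)) := Real.exp_le_exp.mpr (by nlinarith)
    have h5 := Real.exp_pos (-(a * x))
    have h6 : 0 ≤ (b - a) * x := mul_nonneg (by linarith) hx
    rw [abs_of_nonneg (by linarith), abs_of_nonpos (by linarith), h1]
    nlinarith
  rcases le_total κ κ₀ with h | h
  · exact key _ _ hκ h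
  · rw [abs_sub_comm, abs_sub_comm κ]; exact key _ _ hκ₀ h

/-- Half of the exponential absorbs the linear factor. -/
theorem one_add_mul_exp_le {η x : ℝ} (hη : 0 < η) (hx : 0 ≤ x) :
    (1 + x) * Real.exp (-(η * x)) ≤ (1 + 2 / η) * Real.exp (-(η / 2) * x) := by
  have h1 : Real.exp (-(η * x)) = Real.exp (-(η / 2) * x) * Real.exp (-(η / 2 * x)) := by
    rw [← Real.exp_add]; ring_nf
  have h2 : x * Real.exp (-(η / 2 * x)) ≤ 2 / η := by
    rw [Real.exp_neg, ← div_eq_mul_inv, div_le_div_iff₀ (Real.exp_pos _) hη]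
    have := Real.add_one_le_exp (η / 2 * x)
    linarith
  have h3 : Real.exp (-(η / 2 * x)) ≤ 1 := Real.exp_le_one_iff.mpr (by
    have : 0 ≤ η / 2 * x := by positivity
    linarith)
  rw [h1]
  have h4 := Real.exp_pos (-(η / 2) * x)
  nlinarith

theorem integrableOn_halfNorm (hu : IsWeighted u) {κ : ℝ} (hκ : 0 < κ) :
    IntegrableOn (fun x => (Real.exp (-(κ * x)) * jostR u κ x) ^ 2) (Set.Ioi 0) := by
  have hc := continuous_jostR hu.1 hκ
  refine Integrable.mono' ((integrableOn_exp_mul_Ioi (a := -κ) (by linarith) 0).const_mul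
    (gronwallConst (weightedNorm u) ^ 2)) (by fun_prop) ?_
  refine (ae_restrict_iff' measurableSet_Ioi).mpr (Eventually.of_forall fun x hx => ?_)
  have hx0 : (0 : ℝ) ≤ x := le_of_lt hx
  have h1 := abs_jostR_le hu le_rfl hκ hx0
  have h2 : Real.exp (-κ * x) ≤ 1 := Real.exp_le_one_iff.mpr (by nlinarith)
  have h3 := Real.exp_pos (-κ * x)
  rw [Real.norm_of_nonneg (sq_nonneg _), mul_pow, ← neg_mul, ← sq_abs (jostR u κ x)]
  have h4 : |jostR u κ x| ^ 2 ≤ gronwallConst (weightedNorm u) ^ 2 := by gcongr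
  have h5 : Real.exp (-κ * x) ^ 2 ≤ Real.exp (-κ * x) := by nlinarith
  calc _ ≤ Real.exp (-κ * x) * gronwallConst (weightedNorm u) ^ 2 := by gcongr
    _ = _ := by ring

theorem halfNorm_pos (hu : IsWeighted u) {κ : ℝ} (hκ : 0 < κ) : 0 < halfNorm u κ := by
  have hi := integrableOn_halfNorm hu hκ
  rw [halfNorm, setIntegral_pos_iff_support_of_nonneg_ae
    (Eventually.of_forall fun x => sq_nonneg _) hi]
  obtain ⟨N, hN⟩ := ((tendsto_jostR hu.1 hκ).eventually_ne one_ne_zero).exists_forall_of_atTop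
  refine lt_of_lt_of_le (b := volume (Set.Ioo (max N 0) (max N 0 + 1))) (by simp) (measure_mono ?_)
  intro x hx
  refine ⟨?_, (le_max_right N 0).trans_lt hx.1⟩
  have := hN x ((le_max_left N 0).trans hx.1.le)
  simpa [Function.mem_support] using this

/-- The integrand is a difference of squares: the sum is bounded, and the difference is small with
decay `(1 + x) e^(-ηx)`. The bound `η` from below on both `κ` and `κ₀` makes the resulting integral
finite, equal to `2/η` after absorption. -/
theorem abs_halfNorm_sub_le (hu : IsWeighted u) (hv : IsWeighted v) {M : ℝ}
    (hM : weightedNorm u ≤ M) (hM' : weightedNorm (fun x => u x + v x) ≤ M) {η κ κ₀ : ℝ}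
    (hη : 0 < η) (hκ : η ≤ κ) (hκ₀ : η ≤ κ₀) :
    |halfNorm (fun x => u x + v x) κ - halfNorm u κ₀| ≤
      2 * gronwallConst M * (jostConst M + gronwallConst M) * (1 + 2 / η) * (2 / η) *
        (weightedNorm v + |κ - κ₀|) := by
  have hκ' : 0 < κ := hη.trans_le hκ
  have hκ₀' : 0 < κ₀ := hη.trans_le hκ₀
  have hK := gronwallConst_pos M
  have hδ := weightedNorm_nonneg v
  have hMnn : 0 ≤ M := (weightedNorm_nonneg u).trans hM
  have hJ : 0 ≤ jostConst M := by unfold jostConst; positivity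
  set D := weightedNorm v + |κ - κ₀| with hD
  have hD0 : 0 ≤ D := by positivity
  have hD1 : |κ - κ₀| ≤ D := by linarith
  rw [halfNorm, halfNorm, ← integral_sub (integrableOn_halfNorm (hu.add hv) hκ')
    (integrableOn_halfNorm hu hκ₀')]
  have key := norm_integral_le_of_norm_le
    ((integrableOn_exp_mul_Ioi (a := -(η / 2)) (by linarith) 0).const_mul
      (2 * gronwallConst M * (jostConst M + gronwallConst M) * D * (1 + 2 / η)))
    (f := fun x => (Real.exp (-(κ * x)) * jostR (fun x => u x + v x) κ x) ^ 2 -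
      (Real.exp (-(κ₀ * x)) * jostR u κ₀ x) ^ 2)
    ((ae_restrict_iff' measurableSet_Ioi).mpr (Eventually.of_forall fun x hx => by
      have hx0 : (0 : ℝ) ≤ x := le_of_lt hx
      have b1 := abs_jostR_le (hu.add hv) hM' hκ' hx0
      have b2 := abs_jostR_le hu hM hκ₀' hx0
      have b3 := abs_jostR_sub_le hu hv hM hM' hκ' hκ₀' x
      rw [leftWeight_of_nonneg hx0, one_pow, mul_one] at b3
      have b4 := abs_exp_neg_mul_sub_le hκ hκ₀ hx0
      set R := jostR (fun x => u x + v x) κ x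
      set R₀ := jostR u κ₀ x
      set E := Real.exp (-(κ * x)) with hE
      set E₀ := Real.exp (-(κ₀ * x)) with hE₀
      set Eη := Real.exp (-(η * x)) with hEη
      have c0 : 0 < Eη := Real.exp_pos _
      have c1 : E ≤ Eη := Real.exp_le_exp.mpr (by nlinarith)
      have c3 : E ≤ 1 := Real.exp_le_one_iff.mpr (by nlinarith)
      have c4 : E₀ ≤ 1 := Real.exp_le_one_iff.mpr (by nlinarith)
      have c5 : 0 < E := Real.exp_pos _
      have c6 : 0 < E₀ := Real.exp_pos _
      have d1 : |E * R - E₀ * R₀| ≤ (jostConst M + gronwallConst M) * D * ((1 + x) * Eη) := by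
        have : E * R - E₀ * R₀ = E * (R - R₀) + (E - E₀) * R₀ := by ring
        rw [this]
        refine (abs_add_le _ _).trans ?_
        rw [abs_mul, abs_mul, abs_of_pos c5]
        calc _ ≤ Eη * (jostConst M * D) + (D * x * Eη) * gronwallConst M := by
              gcongr
              exact b4.trans (by gcongr)
          _ ≤ Eη * (jostConst M * D) + (D * x * Eη) * gronwallConst M +
              (Eη * x * (jostConst M * D) + (D * Eη) * gronwallConst M) := by
              have : 0 ≤ Eη * x * (jostConst M * D) + (D * Eη) * gronwallConst M := by positivity
              linarith
          _ = _ := by ring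
      have d2 : |E * R + E₀ * R₀| ≤ 2 * gronwallConst M := by
        refine (abs_add_le _ _).trans ?_
        rw [abs_mul, abs_mul, abs_of_pos c5, abs_of_pos c6]
        have := abs_nonneg R
        have := abs_nonneg R₀
        nlinarith
      rw [Real.norm_eq_abs, sq_sub_sq, abs_mul]
      calc _ ≤ 2 * gronwallConst M * ((jostConst M + gronwallConst M) * D * ((1 + x) * Eη)) := by
            gcongr
        _ ≤ 2 * gronwallConst M * ((jostConst M + gronwallConst M) * D *
            ((1 + 2 / η) * Real.exp (-(η / 2) * x))) := by
            exact mul_le_mul_of_nonneg_left (mul_le_mul_of_nonneg_left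
              (one_add_mul_exp_le hη hx0) (by positivity)) (by positivity)
        _ = _ := by ring))
  rw [integral_const_mul, integral_exp_mul_Ioi (by linarith)] at key
  rw [Real.norm_eq_abs] at key
  refine key.trans_eq ?_
  simp only [mul_zero, Real.exp_zero]
  field_simp

/-- The norming constant in terms of half-line data. -/
theorem normingConstant_eq (hu : IsWeighted u) {κ : ℝ} (hκ : 0 < κ)
    (hW : jostW u (Complex.I * κ) = 0) {x₀ : ℝ} (hx₀ : jostR u κ x₀ ≠ 0) :
    jostR (fun x => u (-x)) κ (-x₀) ≠ 0 ∧
    normingConstant u κ = (((halfNorm u κ + (Real.exp (-(2 * κ * x₀)) * jostR u κ x₀ /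
      jostR (fun x => u (-x)) κ (-x₀)) ^ 2 * halfNorm (fun x => u (-x)) κ)⁻¹ : ℝ) : ℂ) := by
  have him := im_I_mul_pos hκ
  set ut : ℝ → ℝ := fun x => u (-x) with hut
  have hu' : IsWeighted ut := hu.comp_neg
  have hp : jostPlus u (Complex.I * κ) x₀ ≠ 0 := by
    rw [jostPlus_eq_ofReal hu.1 hκ]
    exact_mod_cast mul_ne_zero (Real.exp_ne_zero _) hx₀
  -- The factor in `f₋ = c f₊`. On the left half-line `f₊ = c⁻¹ f₋`, and the square of `f₋` there
  -- integrates to the half norm of the reflected potential.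
  set c : ℝ := (Real.exp (κ * x₀) * jostR ut κ (-x₀)) / (Real.exp (-(κ * x₀)) * jostR u κ x₀)
    with hc
  have hprop : ∀ x, Real.exp (κ * x) * jostR ut κ (-x) =
      c * (Real.exp (-(κ * x)) * jostR u κ x) := by
    intro x
    have := jostMinus_mul_eq him hu.1 hW hp x
    rw [jostMinus_eq him hu.1, jostMinus_eq him hu.1, jostPlus_eq_ofReal hu.1 hκ,
      jostPlus_eq_ofReal hu.1 hκ, jostPlus_eq_ofReal hu'.1 hκ, jostPlus_eq_ofReal hu'.1 hκ] at this
    have := by exact_mod_cast this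
    simpa [hc] using this
  have hc0 : c ≠ 0 := by
    intro h0
    obtain ⟨y, hy⟩ := ((tendsto_jostR hu'.1 hκ).eventually_ne one_ne_zero).exists
    have := hprop (-y)
    rw [h0, zero_mul, neg_neg] at this
    exact hy ((mul_eq_zero.mp this).resolve_left (Real.exp_ne_zero _))
  have hB : jostR ut κ (-x₀) ≠ 0 := by
    intro h0
    apply hc0
    rw [hc, h0, mul_zero, zero_div]
  refine ⟨hB, ?_⟩
  have hsq : ∀ x, jostPlus u (Complex.I * κ) x ^ 2 =
      (((Real.exp (-(κ * x)) * jostR u κ x) ^ 2 : ℝ) : ℂ) := fun x => by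
    rw [jostPlus_eq_ofReal hu.1 hκ]; push_cast; rfl
  have hleft : ∀ x, (Real.exp (-(κ * -x)) * jostR u κ (-x)) ^ 2 =
      c⁻¹ ^ 2 * (Real.exp (-(κ * x)) * jostR ut κ x) ^ 2 := by
    intro x
    have := hprop (-x)
    rw [neg_neg, mul_neg] at this
    rw [this, mul_neg]
    field_simp
  have hI1 := integrableOn_halfNorm hu hκ
  have hI2 : IntegrableOn (fun x => (Real.exp (-(κ * x)) * jostR u κ x) ^ 2) (Set.Iic 0) := by
    have h1 : IntegrableOn (fun x => (Real.exp (-(κ * -x)) * jostR u κ (-x)) ^ 2) (Set.Ioi 0) := by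
      simp only [hleft]
      exact (integrableOn_halfNorm hu' hκ).const_mul _
    have h2 : IntegrableOn (fun x => (Real.exp (-(κ * x)) * jostR u κ x) ^ 2) (Set.Iio 0) := by
      have := h1
      rw [← neg_zero] at this
      have := IntegrableOn.comp_neg_Iio this
      simpa only [neg_neg] using this
    exact (integrableOn_congr_set_ae Iio_ae_eq_Iic).mp h2
  have hI3 : ∫ x in Set.Iic 0, (Real.exp (-(κ * x)) * jostR u κ x) ^ 2 =
      c⁻¹ ^ 2 * halfNorm ut κ := by
    have := integral_comp_neg_Ioi 0 (fun x => (Real.exp (-(κ * x)) * jostR u κ x) ^ 2)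
    rw [neg_zero] at this
    rw [← this, halfNorm, ← integral_const_mul]
    exact integral_congr_ae (Eventually.of_forall hleft)
  rw [normingConstant]
  simp only [hsq]
  rw [integral_complex_ofReal, ← intervalIntegral.integral_Iic_add_Ioi hI2 hI1, hI3,
    Complex.ofReal_inv, add_comm, ← halfNorm]
  have hc2 : c⁻¹ = Real.exp (-(2 * κ * x₀)) * jostR u κ x₀ / jostR ut κ (-x₀) := by
    have e : Real.exp (-(2 * κ * x₀)) = Real.exp (-(κ * x₀)) * (Real.exp (κ * x₀))⁻¹ := by
      rw [← Real.exp_neg, ← Real.exp_add]; ring_nf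
    rw [hc, inv_div, e]
    field_simp
  rw [hc2]

/-- Local Lipschitz continuity of the norming constants. -/
theorem exists_normingConstant_lipschitz (hu : IsWeighted u) {β : ℝ} (hβ : 0 < β)
    (hW : jostW u (Complex.I * β) = 0) :
    ∃ C > 0, ∃ ε₁ > 0, ∀ v : ℝ → ℝ, IsWeighted v → ∀ κ : ℝ, 0 < κ → weightedNorm v ≤ ε₁ →
      |κ - β| ≤ ε₁ → jostW (fun x => u x + v x) (Complex.I * κ) = 0 →
      ‖normingConstant (fun x => u x + v x) κ - normingConstant u β‖ ≤
        C * (weightedNorm v + |κ - β|) := by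
  set ut : ℝ → ℝ := fun x => u (-x) with hut
  have hu' : IsWeighted ut := hu.comp_neg
  set M := weightedNorm u + 1 with hMdef
  have hM0 := weightedNorm_nonneg u
  have hMu : weightedNorm u ≤ M := by linarith
  have hMut : weightedNorm ut ≤ M := by rw [hut, weightedNorm_comp_neg]; exact hMu
  obtain ⟨x₀, hx₀⟩ := ((tendsto_jostR hu.1 hβ).eventually_ne one_ne_zero).exists
  obtain ⟨hB, hN⟩ := normingConstant_eq hu hβ hW hx₀
  -- The norming constant as a function of two half norms, the two Jost values at `x₀` and `κ`. It
  -- is continuously differentiable at the unperturbed data, hence Lipschitz nearby, and it remains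
  -- to bound the displacement of the data.
  set Φ : ℝ × ℝ × ℝ × ℝ × ℝ → ℝ := fun p =>
    (p.1 + (Real.exp (-(2 * p.2.2.2.2 * x₀)) * p.2.2.1 / p.2.2.2.1) ^ 2 * p.2.1)⁻¹ with hΦ
  set p₀ : ℝ × ℝ × ℝ × ℝ × ℝ := (halfNorm u β, halfNorm ut β, jostR u β x₀, jostR ut β (-x₀), β)
    with hp₀
  have hS : halfNorm u β + (Real.exp (-(2 * β * x₀)) * jostR u β x₀ / jostR ut β (-x₀)) ^ 2 *
      halfNorm ut β ≠ 0 := by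
    have := halfNorm_pos hu hβ
    have := halfNorm_pos hu' hβ
    positivity
  have hΦs : ContDiffAt ℝ 1 Φ p₀ := by
    refine ContDiffAt.inv ?_ hS
    refine ContDiffAt.add (by fun_prop) (ContDiffAt.mul (ContDiffAt.pow ?_ 2) (by fun_prop))
    exact ContDiffAt.div (by fun_prop) (by fun_prop) hB
  obtain ⟨L, t, ht, hL⟩ := hΦs.exists_lipschitzOnWith
  -- Keeps the perturbed Jost value at the same `x₀` nonzero, as the formula for the norming
  -- constant requires.
  have hopen : {p : ℝ × ℝ × ℝ × ℝ × ℝ | p.2.2.1 ≠ 0} ∈ 𝓝 p₀ :=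
    (isOpen_ne_fun (by fun_prop) (by fun_prop)).mem_nhds hx₀
  obtain ⟨ρ, hρ, hball⟩ := Metric.mem_nhds_iff.mp (Filter.inter_mem ht hopen)
  set η := β / 2 with hη
  have hη0 : 0 < η := by positivity
  have hK := gronwallConst_pos M
  have hMnn : 0 ≤ M := hM0.trans hMu
  have hJ : 0 ≤ jostConst M := by unfold jostConst; positivity
  set C₁ := 2 * gronwallConst M * (jostConst M + gronwallConst M) * (1 + 2 / η) * (2 / η) with hC₁
  have hw1 := leftWeight_pos x₀
  have hw2 := leftWeight_pos (-x₀)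
  set C₂ := C₁ + jostConst M * leftWeight x₀ ^ 2 + jostConst M * leftWeight (-x₀) ^ 2 + 1 with hC₂
  have hC₁0 : 0 ≤ C₁ := by positivity
  have hC₂0 : 0 < C₂ := by positivity
  have hp1 : 0 ≤ jostConst M * leftWeight x₀ ^ 2 := by positivity
  have hp2 : 0 ≤ jostConst M * leftWeight (-x₀) ^ 2 := by positivity
  -- `β / 2` keeps `κ ≥ η`, `1` keeps the weighted norms below `M`, and `ρ / (4 C₂)` places the
  -- perturbed data within `ρ / 2` of `p₀`. The `+ 1` guards against `L = 0`.
  refine ⟨(L + 1) * C₂, by positivity, min (min (β / 2) 1) (ρ / (4 * C₂)), by positivity, ?_⟩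
  intro v hv κ hκ hvε hκε hWv
  have hv1 : weightedNorm v ≤ 1 := hvε.trans ((min_le_left _ _).trans (min_le_right _ _))
  have hκβ : |κ - β| ≤ β / 2 := hκε.trans ((min_le_left _ _).trans (min_le_left _ _))
  have hηκ : η ≤ κ := by have := abs_le.mp hκβ; rw [hη]; linarith
  have hηβ : η ≤ β := by rw [hη]; linarith
  have hMv : weightedNorm (fun x => u x + v x) ≤ M :=
    (weightedNorm_add_le hu hv).trans (by linarith)
  set vt : ℝ → ℝ := fun x => v (-x) with hvt
  have hv' : IsWeighted vt := hv.comp_neg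
  have hvtn : weightedNorm vt = weightedNorm v := weightedNorm_comp_neg v
  have hMvt : weightedNorm (fun x => ut x + vt x) ≤ M :=
    (weightedNorm_add_le hu' hv').trans (by
      rw [hvtn, hut, weightedNorm_comp_neg]; linarith)
  set D := weightedNorm v + |κ - β| with hD
  have hD0 : 0 ≤ D := add_nonneg (weightedNorm_nonneg v) (abs_nonneg _)
  have hDρ : C₂ * D < ρ := by
    have h1 : weightedNorm v ≤ ρ / (4 * C₂) := hvε.trans (min_le_right _ _)
    have h2 : |κ - β| ≤ ρ / (4 * C₂) := hκε.trans (min_le_right _ _)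
    have h3 : D ≤ ρ / (2 * C₂) := by
      have : ρ / (4 * C₂) + ρ / (4 * C₂) = ρ / (2 * C₂) := by field_simp; ring
      linarith
    calc C₂ * D ≤ C₂ * (ρ / (2 * C₂)) := by gcongr
      _ = ρ / 2 := by field_simp
      _ < ρ := by linarith
  have b1 := abs_halfNorm_sub_le hu hv hMu hMv hη0 hηκ hηβ
  have b2 := abs_halfNorm_sub_le hu' hv' hMut hMvt hη0 hηκ hηβ
  have b3 := abs_jostR_sub_le hu hv hMu hMv hκ hβ x₀
  have b4 := abs_jostR_sub_le hu' hv' hMut hMvt hκ hβ (-x₀)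
  rw [hvtn] at b2 b4
  set p : ℝ × ℝ × ℝ × ℝ × ℝ := (halfNorm (fun x => u x + v x) κ,
    halfNorm (fun x => ut x + vt x) κ, jostR (fun x => u x + v x) κ x₀,
    jostR (fun x => ut x + vt x) κ (-x₀), κ) with hp
  have hdist : dist p p₀ ≤ C₂ * D := by
    simp only [hp, hp₀, Prod.dist_eq, Real.dist_eq]
    refine max_le (b1.trans ?_) (max_le (b2.trans ?_) (max_le (b3.trans ?_) (max_le (b4.trans ?_) ?_)))
    · exact mul_le_mul_of_nonneg_right (by linarith) hD0
    · exact mul_le_mul_of_nonneg_right (by linarith) hD0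
    · calc _ = jostConst M * leftWeight x₀ ^ 2 * D := by ring
        _ ≤ _ := mul_le_mul_of_nonneg_right (by linarith) hD0
    · calc _ = jostConst M * leftWeight (-x₀) ^ 2 * D := by ring
        _ ≤ _ := mul_le_mul_of_nonneg_right (by linarith) hD0
    · have h1 : |κ - β| ≤ D := by have := weightedNorm_nonneg v; linarith
      have h2 : 1 * D ≤ C₂ * D := mul_le_mul_of_nonneg_right (by linarith) hD0
      linarith
  have hpm := hball (Metric.mem_ball.mpr (hdist.trans_lt hDρ))
  have hp₀m := hball (Metric.mem_ball_self hρ)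
  obtain ⟨-, hNv⟩ := normingConstant_eq (hu.add hv) hκ hWv hpm.2
  have e1 : normingConstant (fun x => u x + v x) κ = (Φ p : ℂ) := hNv
  have e2 : normingConstant u β = (Φ p₀ : ℂ) := hN
  rw [e1, e2, ← Complex.ofReal_sub, Complex.norm_real, ← dist_eq_norm]
  calc dist (Φ p) (Φ p₀) ≤ L * dist p p₀ := hL.dist_le_mul _ hpm.1 _ hp₀m.1
    _ ≤ L * (C₂ * D) := by gcongr
    _ ≤ (L + 1) * C₂ * D := by
        have : 0 ≤ C₂ * D := by positivity
        linarith

end KdV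

end

noncomputable section

namespace KdV

/-! ### The Wronskian of the soliton as a positive exponential sum -/

section Soliton

variable {n : ℕ} (β α : Fin n → ℝ)

/-- The node `±β_j` selected by a choice of signs. -/
def node (τ : Fin n → Bool) (j : Fin n) : ℝ := if τ j then β j else -β j

/-- The exponent `∑ ±β_j` attached to a choice of signs. -/
def freq (τ : Fin n → Bool) : ℝ := ∑ j, node β τ j

/-- The coefficient `α_j` or `(-1)^j` of `e^(±β_j x)` in `a_j`. -/
def signCoeff (τ : Fin n → Bool) (j : Fin n) : ℝ := if τ j then α j else (-1) ^ (j : ℕ)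

/-- The coefficient of `e^(λ_τ x)` in the Wronskian. -/
def tauCoeff (τ : Fin n → Bool) : ℝ :=
  (∏ j, signCoeff α τ j) * (Matrix.vandermonde (node β τ)).det

/-- The derivatives of the Wronskian as exponential sums. -/
def tauSum (k : ℕ) (x : ℝ) : ℝ :=
  ∑ τ, tauCoeff β α τ * freq β τ ^ k * Real.exp (freq β τ * x)

theorem expSum_zero (j : Fin n) (x : ℝ) :
    expSum β α j x 0 = (-1) ^ (j : ℕ) * Real.exp (-β j * x) + α j * Real.exp (β j * x) := by
  simp [expSum]

theorem iteratedDeriv_expSum (j : Fin n) (i : ℕ) :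
    iteratedDeriv i (fun y => expSum β α j y 0) =
      fun x => (-1) ^ (j : ℕ) * (-β j) ^ i * Real.exp (-β j * x) +
        α j * β j ^ i * Real.exp (β j * x) := by
  induction i with
  | zero => funext x; simp [expSum_zero]
  | succ i ih =>
    rw [iteratedDeriv_succ, ih]
    funext x
    have h : ∀ c : ℝ, HasDerivAt (fun x : ℝ => Real.exp (c * x)) (Real.exp (c * x) * c) x :=
      fun c => by simpa using ((hasDerivAt_id x).const_mul c).exp
    rw [(((h (-β j)).const_mul _).fun_add ((h (β j)).const_mul _)).deriv]
    ring

/-- The Wronskian matrix of the functions `a_j`. -/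
def solitonMatrix (x : ℝ) : Matrix (Fin n) (Fin n) ℝ :=
  Matrix.of fun i j => (-1) ^ (j : ℕ) * (-β j) ^ (i : ℕ) * Real.exp (-β j * x) +
        α j * β j ^ (i : ℕ) * Real.exp (β j * x)

theorem solitonWronskian_eq_det (x : ℝ) :
    solitonWronskian β α x 0 = (solitonMatrix β α x).det := by
  unfold solitonWronskian solitonMatrix
  congr 2
  funext i j
  rw [iteratedDeriv_expSum]

/-- Each `a_j` is a sum of two exponentials, so multilinearity of the determinant gives one term for
each choice of signs, and every term is a Vandermonde determinant. -/
theorem solitonWronskian_eq (x : ℝ) : solitonWronskian β α x 0 = tauSum β α 0 x := by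
  rw [solitonWronskian_eq_det, ← Matrix.det_transpose]
  have hrow : (solitonMatrix β α x).transpose = fun j => ∑ b : Bool,
      fun i : Fin n => (if b then α j * Real.exp (β j * x) else
        (-1) ^ (j : ℕ) * Real.exp (-β j * x)) * (if b then β j else -β j) ^ (i : ℕ) := by
    funext j i
    simp [solitonMatrix, Matrix.transpose_apply, Finset.sum_apply]
    ring
  have := (Matrix.detRowAlternating (R := ℝ) (n := Fin n)).toMultilinearMap.map_sum
    (fun (j : Fin n) (b : Bool) => fun i : Fin n => (if b then α j * Real.exp (β j * x) else
        (-1) ^ (j : ℕ) * Real.exp (-β j * x)) * (if b then β j else -β j) ^ (i : ℕ))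
  have e : ((solitonMatrix β α x).transpose).det = _ := (congrArg Matrix.det hrow).trans this
  rw [e, tauSum]
  refine Finset.sum_congr rfl fun τ _ => ?_
  have h2 := Matrix.det_mul_column (fun j => signCoeff α τ j * Real.exp (node β τ j * x))
    (Matrix.vandermonde (node β τ))
  have h3 : ∏ j, (signCoeff α τ j * Real.exp (node β τ j * x)) =
      (∏ j, signCoeff α τ j) * Real.exp (freq β τ * x) := by
    rw [Finset.prod_mul_distrib, freq, Finset.sum_mul, Real.exp_sum]
  rw [h3] at h2
  rw [tauCoeff, pow_zero, mul_one, mul_right_comm, ← h2]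
  change Matrix.det _ = _
  congr 1
  funext j i
  simp only [Matrix.of_apply, Matrix.vandermonde_apply, signCoeff, node]
  cases τ j <;> simp

/-! ### Positivity of the coefficients -/

variable {β α}

theorem node_sub_node (τ : Fin n → Bool) (i j : Fin n) :
    node β τ j - node β τ i = (if τ j then 1 else -1) *
      (β j - (if τ j then 1 else -1) * (if τ i then 1 else -1) * β i) := by
  simp only [node]
  cases τ j <;> cases τ i <;> simp <;> ring

/-- The absolute value of the Vandermonde determinant of the nodes. -/
def absVand (β : Fin n → ℝ) (τ : Fin n → Bool) : ℝ :=
  ∏ i, ∏ j ∈ Finset.Ioi i, (β j - (if τ j then 1 else -1) * (if τ i then 1 else -1) * β i)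

/-- Pulling the sign of the larger-index node out of each Vandermonde factor produces it `j` times
for index `j`. These signs cancel the `(-1)^j` in `a_j`; the alternating signs are chosen for
exactly this. -/
theorem tauCoeff_eq (τ : Fin n → Bool) :
    tauCoeff β α τ = (∏ j, if τ j then α j else 1) * absVand β τ := by
  have h1 : (Matrix.vandermonde (node β τ)).det =
      (∏ j : Fin n, (if τ j then (1 : ℝ) else -1) ^ (j : ℕ)) * absVand β τ := by
    rw [Matrix.det_vandermonde, absVand]
    simp only [node_sub_node, Finset.prod_mul_distrib]
    congr 1
    rw [Finset.prod_comm' (s' := fun j => Finset.Iio j) (t' := Finset.univ) (by simp)]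
    simp
  rw [tauCoeff, h1, ← mul_assoc, ← Finset.prod_mul_distrib]
  congr 1
  refine Finset.prod_congr rfl fun j _ => ?_
  rw [signCoeff]
  cases τ j
  · simp [← mul_pow]
  · simp

theorem sign_mul_le (hβpos : ∀ j, 0 < β j) (τ : Fin n → Bool) (i j : Fin n) :
    β j - β i ≤ β j - (if τ j then 1 else -1) * (if τ i then 1 else -1) * β i := by
  have := hβpos i
  cases τ j <;> cases τ i <;> simp <;> linarith

/-- Every factor is `β_j - β_i` or `β_j + β_i`, and equal signs give the smaller one, which is
nonnegative as `β` increases. -/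
theorem absVand_true_le (hβpos : ∀ j, 0 < β j) (hβ : StrictMono β) (τ : Fin n → Bool) :
    absVand β (fun _ => true) ≤ absVand β τ := by
  have h : ∀ i, ∀ j ∈ Finset.Ioi i, 0 ≤ β j - β i := fun i j hj => by
    have := hβ (Finset.mem_Ioi.mp hj); linarith
  simp only [absVand, if_true, one_mul]
  refine Finset.prod_le_prod (fun i _ => Finset.prod_nonneg (h i)) fun i _ => ?_
  exact Finset.prod_le_prod (h i) fun j _ => sign_mul_le hβpos τ i j

theorem absVand_true_pos (hβ : StrictMono β) : 0 < absVand β (fun _ => true) := by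
  simp only [absVand, if_true, one_mul]
  refine Finset.prod_pos fun i _ => Finset.prod_pos fun j hj => ?_
  have := hβ (Finset.mem_Ioi.mp hj)
  linarith

theorem absVand_pos (hβpos : ∀ j, 0 < β j) (hβ : StrictMono β) (τ : Fin n → Bool) :
    0 < absVand β τ := (absVand_true_pos hβ).trans_le (absVand_true_le hβpos hβ τ)

theorem absVand_not (τ : Fin n → Bool) : absVand β (fun j => !τ j) = absVand β τ := by
  unfold absVand
  refine Finset.prod_congr rfl fun i _ => Finset.prod_congr rfl fun j _ => ?_
  beta_reduce
  generalize τ j = a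
  generalize τ i = b
  cases a <;> cases b <;> simp

theorem tauCoeff_pos (hβpos : ∀ j, 0 < β j) (hβ : StrictMono β) (hα : ∀ j, 0 < α j)
    (τ : Fin n → Bool) : 0 < tauCoeff β α τ := by
  rw [tauCoeff_eq]
  refine mul_pos (Finset.prod_pos fun j _ => ?_) (absVand_pos hβpos hβ τ)
  split_ifs
  · exact hα j
  · exact one_pos

theorem tauCoeff_mul_not (τ : Fin n → Bool) :
    tauCoeff β α τ * tauCoeff β α (fun j => !τ j) = (∏ j, α j) * absVand β τ ^ 2 := by
  rw [tauCoeff_eq, tauCoeff_eq, absVand_not]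
  have : (∏ j, if τ j then α j else 1) * (∏ j, if !τ j then α j else 1) = ∏ j, α j := by
    rw [← Finset.prod_mul_distrib]
    refine Finset.prod_congr rfl fun j _ => ?_
    cases τ j <;> simp
  rw [← this]; ring

/-- The value at the origin dominates the geometric mean of the extreme coefficients. -/
theorem four_pow_mul_le_tauSum_sq (hβpos : ∀ j, 0 < β j) (hβ : StrictMono β)
    (hα : ∀ j, 0 < α j) :
    4 ^ n * (tauCoeff β α (fun _ => true) * tauCoeff β α (fun _ => false)) ≤
      tauSum β α 0 0 ^ 2 := by
  have hp := tauCoeff_pos hβpos hβ hα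
  set B := Real.sqrt (tauCoeff β α (fun _ => true) * tauCoeff β α (fun _ => false)) with hB
  have hB2 : B ^ 2 = tauCoeff β α (fun _ => true) * tauCoeff β α (fun _ => false) :=
    Real.sq_sqrt (mul_pos (hp _) (hp _)).le
  have hB0 : 0 ≤ B := Real.sqrt_nonneg _
  -- Arithmetic-geometric inequality for opposite sign choices. Their product is `∏ α_j` times a
  -- squared `absVand`, which is smallest for the extreme pair; summing over all `2^n` choices gives
  -- the claim.
  have h1 : ∀ τ, 2 * B ≤ tauCoeff β α τ + tauCoeff β α (fun j => !τ j) := by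
    intro τ
    refine abs_le_of_sq_le_sq' ?_ (add_pos (hp _) (hp _)).le |>.2
    have e1 : B ^ 2 ≤ tauCoeff β α τ * tauCoeff β α (fun j => !τ j) := by
      have := tauCoeff_mul_not (β := β) (α := α) (fun _ => true)
      simp only [Bool.not_true] at this
      rw [hB2, this, tauCoeff_mul_not]
      have h2 := absVand_true_le hβpos hβ τ
      have h3 := absVand_true_pos hβ
      have h4 : 0 ≤ ∏ j, α j := Finset.prod_nonneg fun j _ => (hα j).le
      gcongr
    nlinarith [sq_nonneg (tauCoeff β α τ - tauCoeff β α (fun j => !τ j))]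
  have h2 : tauSum β α 0 0 = ∑ τ, tauCoeff β α τ := by simp [tauSum]
  have h3 : ∑ τ : Fin n → Bool, tauCoeff β α (fun j => !τ j) = ∑ τ, tauCoeff β α τ := by
    refine Fintype.sum_equiv (Function.Involutive.toPerm (fun (τ : Fin n → Bool) j => !τ j)
      (fun τ => by funext j; simp)) _ _ fun τ => rfl
  have h4 : (2 : ℝ) ^ n * (2 * B) ≤ 2 * tauSum β α 0 0 := by
    have := Finset.sum_le_sum (s := Finset.univ) fun (τ : Fin n → Bool) _ => h1 τ
    rw [Finset.sum_add_distrib, h3, ← h2] at this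
    simp at this
    linarith
  have h5 : 2 ^ n * B ≤ tauSum β α 0 0 := by linarith
  rw [← hB2]
  calc (4 : ℝ) ^ n * B ^ 2 = (2 ^ n * B) ^ 2 := by
        rw [mul_pow, ← pow_mul, mul_comm n 2, pow_mul]; norm_num
    _ ≤ _ := by gcongr

/-! ### The bilinear identity -/

open Polynomial in
/-- The polynomial with roots the nodes. -/
def nodePoly (β : Fin n → ℝ) (τ : Fin n → Bool) : ℝ[X] := ∏ j, (X - C (node β τ j))

/-- The numerator of the Baker-Akhiezer function, with its derivatives. -/
def numSum (β α : Fin n → ℝ) (c : ℝ) (k : ℕ) (x : ℝ) : ℝ :=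
  ∑ τ, tauCoeff β α τ * (nodePoly β τ).eval c * freq β τ ^ k * Real.exp (freq β τ * x)

theorem det_vandermonde_snoc (v : Fin n → ℝ) (c : ℝ) :
    (Matrix.vandermonde (Fin.snoc v c : Fin (n + 1) → ℝ)).det =
      (Matrix.vandermonde v).det * ∏ i, (c - v i) := by
  rw [Matrix.det_vandermonde, Matrix.det_vandermonde, Fin.prod_univ_castSucc]
  have hlast : Finset.Ioi (Fin.last n) = ∅ := by
    ext i; simp [Fin.le_last]
  rw [hlast, Finset.prod_empty, mul_one, ← Finset.prod_mul_distrib]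
  refine Finset.prod_congr rfl fun i _ => ?_
  have : Finset.Ioi (Fin.castSucc i) =
      insert (Fin.last n) ((Finset.Ioi i).map Fin.castSuccEmb) := by
    ext j
    refine Fin.lastCases ?_ (fun j => ?_) j
    · simp [Fin.castSucc_lt_last]
    · simp [Fin.le_last]
  rw [this, Finset.prod_insert (by simp), mul_comm, Finset.prod_map]
  simp

/-- Change one sign. -/
def flip (j : Fin n) (τ : Fin n → Bool) : Fin n → Bool := Function.update τ j (!τ j)

theorem flip_involutive (j : Fin n) : Function.Involutive (flip j) := by
  intro τ
  funext i
  by_cases h : i = j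
  · subst h; simp [flip]
  · simp [flip, h]

theorem eval_nodePoly (τ : Fin n → Bool) (c : ℝ) :
    (nodePoly β τ).eval c = ∏ j, (c - node β τ j) := by
  simp [nodePoly, Polynomial.eval_prod]

/-- Both sides are Vandermonde determinants on the same `n + 1` nodes, which contain both `β_j` and
`-β_j`; the transposition exchanging these two accounts for the sign. -/
theorem vandermonde_flip {j : Fin n} {τ : Fin n → Bool} (hτ : τ j = false) :
    (Matrix.vandermonde (node β τ)).det * ∏ i, (β j - node β τ i) =
      -((Matrix.vandermonde (node β (flip j τ))).det * ∏ i, (-β j - node β (flip j τ) i)) := by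
  rw [← det_vandermonde_snoc, ← det_vandermonde_snoc]
  have h : (Fin.snoc (node β (flip j τ)) (-β j) : Fin (n + 1) → ℝ) =
      (Fin.snoc (node β τ) (β j) : Fin (n + 1) → ℝ) ∘ Equiv.swap (Fin.castSucc j) (Fin.last n) := by
    funext i
    refine Fin.lastCases ?_ (fun i => ?_) i
    · simp [node, hτ]
    · by_cases hi : i = j
      · subst hi
        simp [node, flip, hτ]
      · have h1 : Fin.castSucc i ≠ Fin.castSucc j := fun h => hi (Fin.castSucc_injective n h)
        simp [Equiv.swap_apply_of_ne_of_ne h1 (Fin.castSucc_ne_last i), node, flip, hi]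
  rw [h]
  have h2 : Matrix.vandermonde ((Fin.snoc (node β τ) (β j) : Fin (n + 1) → ℝ) ∘
      Equiv.swap (Fin.castSucc j) (Fin.last n)) =
      (Matrix.vandermonde (Fin.snoc (node β τ) (β j) : Fin (n + 1) → ℝ)).submatrix
        (Equiv.swap (Fin.castSucc j) (Fin.last n)) id := by
    ext a b
    simp [Matrix.vandermonde_apply]
  rw [h2, Matrix.det_permute, Equiv.Perm.sign_swap (Fin.castSucc_ne_last j)]
  simp

theorem signCoeff_flip {j : Fin n} {τ : Fin n → Bool} (hτ : τ j = false) :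
    α j * ∏ i, signCoeff α τ i = (-1) ^ (j : ℕ) * ∏ i, signCoeff α (flip j τ) i := by
  rw [← Finset.mul_prod_erase _ _ (Finset.mem_univ j), ← Finset.mul_prod_erase _ (fun i =>
    signCoeff α (flip j τ) i) (Finset.mem_univ j)]
  have h : ∏ i ∈ Finset.univ.erase j, signCoeff α (flip j τ) i =
      ∏ i ∈ Finset.univ.erase j, signCoeff α τ i := by
    refine Finset.prod_congr rfl fun i hi => ?_
    simp [signCoeff, flip, Finset.ne_of_mem_erase hi]
  have h1 : signCoeff α τ j = (-1) ^ (j : ℕ) := by simp [signCoeff, hτ]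
  have h2 : signCoeff α (flip j τ) j = α j := by simp [signCoeff, flip, hτ]
  rw [h, h1, h2]; ring

theorem freq_flip {j : Fin n} {τ : Fin n → Bool} (hτ : τ j = false) :
    freq β (flip j τ) - β j = freq β τ + β j := by
  rw [freq, freq, ← Finset.add_sum_erase _ _ (Finset.mem_univ j), ← Finset.add_sum_erase _
    (fun i => node β τ i) (Finset.mem_univ j)]
  have h : ∑ i ∈ Finset.univ.erase j, node β (flip j τ) i =
      ∑ i ∈ Finset.univ.erase j, node β τ i := by
    refine Finset.sum_congr rfl fun i hi => ?_
    simp [node, flip, Finset.ne_of_mem_erase hi]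
  have h1 : node β τ j = -β j := by simp [node, hτ]
  have h2 : node β (flip j τ) j = β j := by simp [node, flip, hτ]
  rw [h, h1, h2]; ring

/-- Terms of the two sums cancel in pairs related by a change of the `j`-th sign, which leaves the
argument of `g` unchanged. The terms without a partner vanish because their node polynomial has a
root at `±β_j`. The freedom in `g` is used to insert coefficients depending on the frequency. -/
theorem sum_flip (j : Fin n) (g : ℝ → ℝ) :
    (-1) ^ (j : ℕ) * ∑ τ, tauCoeff β α τ * (nodePoly β τ).eval (-β j) * g (freq β τ - β j) +
      α j * ∑ τ, tauCoeff β α τ * (nodePoly β τ).eval (β j) * g (freq β τ + β j) = 0 := by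
  rw [← Equiv.sum_comp (flip_involutive j).toPerm, Finset.mul_sum, Finset.mul_sum,
    ← Finset.sum_add_distrib]
  refine Finset.sum_eq_zero fun τ _ => ?_
  simp only [Function.Involutive.coe_toPerm]
  by_cases hτ : τ j = false
  · rw [freq_flip hτ, tauCoeff, tauCoeff, eval_nodePoly, eval_nodePoly]
    have h1 := vandermonde_flip (β := β) hτ
    have h2 := signCoeff_flip (α := α) hτ
    set V := (Matrix.vandermonde (node β τ)).det
    set V' := (Matrix.vandermonde (node β (flip j τ))).det
    set Q := ∏ i, (β j - node β τ i)
    set Q' := ∏ i, (-β j - node β (flip j τ) i)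
    linear_combination (-(V' * Q' * g (freq β τ + β j))) * h2 +
      α j * (∏ i, signCoeff α τ i) * g (freq β τ + β j) * h1
  · have hτ' : τ j = true := by simpa using hτ
    have h1 : (nodePoly β τ).eval (β j) = 0 := by
      rw [eval_nodePoly]
      exact Finset.prod_eq_zero (Finset.mem_univ j) (by simp [node, hτ'])
    have h2 : (nodePoly β (flip j τ)).eval (-β j) = 0 := by
      rw [eval_nodePoly]
      exact Finset.prod_eq_zero (Finset.mem_univ j) (by simp [node, flip, hτ'])
    rw [h1, h2]; ring

theorem tauSum_pos (hβpos : ∀ j, 0 < β j) (hβ : StrictMono β) (hα : ∀ j, 0 < α j) (x : ℝ) :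
    0 < tauSum β α 0 x := by
  refine Finset.sum_pos (fun τ _ => ?_) ⟨fun _ => true, Finset.mem_univ _⟩
  have := tauCoeff_pos hβpos hβ hα τ
  rw [pow_zero, mul_one]
  positivity

/-- A polynomial of degree less than `n` whose associated operator kills all the `a_j` is zero. -/
theorem poly_eq_zero_of_degree_lt (hβpos : ∀ j, 0 < β j) (hβ : StrictMono β) (hα : ∀ j, 0 < α j)
    (x : ℝ) {p : Polynomial ℝ} (hp : p.degree < n)
    (h : ∀ j : Fin n, (-1) ^ (j : ℕ) * Real.exp (-β j * x) * p.eval (-β j) +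
      α j * Real.exp (β j * x) * p.eval (β j) = 0) : p = 0 := by
  have hdet : (solitonMatrix β α x).transpose.det ≠ 0 := by
    rw [Matrix.det_transpose, ← solitonWronskian_eq_det, solitonWronskian_eq]
    exact (tauSum_pos hβpos hβ hα x).ne'
  have hev : ∀ c : ℝ, p.eval c = ∑ i : Fin n, p.coeff i * c ^ (i : ℕ) := by
    intro c
    by_cases hp0 : p = 0
    · simp [hp0]
    · rw [Polynomial.eval_eq_sum_range' ((Polynomial.natDegree_lt_iff_degree_lt hp0).mpr hp)]
      exact Finset.sum_range (fun i => p.coeff i * c ^ i)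
  have hmul : (solitonMatrix β α x).transpose.mulVec (fun i : Fin n => p.coeff i) = 0 := by
    -- The `j`-th condition on the values at `±β_j` is the `j`-th row of a linear system for the
    -- coefficients of `p`, with matrix the transposed Wronskian matrix.
    funext j
    rw [Pi.zero_apply, ← h j, hev, hev, Finset.mul_sum, Finset.mul_sum, ← Finset.sum_add_distrib]
    simp only [Matrix.mulVec, dotProduct, Matrix.transpose_apply, solitonMatrix, Matrix.of_apply]
    refine Finset.sum_congr rfl fun i _ => ?_
    ring
  have h0 := Matrix.eq_zero_of_mulVec_eq_zero hdet hmul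
  ext i
  by_cases hi : i < n
  · have := congrFun h0 ⟨i, hi⟩
    simpa using this
  · rw [Polynomial.coeff_zero]
    exact Polynomial.coeff_eq_zero_of_degree_lt (hp.trans_le (by exact_mod_cast not_lt.mp hi))

open Polynomial in
-- This says that `e^(cx) N/W` solves the Schrödinger equation with potential `-2 (log W)''`. For
-- fixed `x` the left side is a polynomial `S` in `c`. Its two top coefficients cancel, and
-- `sum_flip` supplies the conditions of `poly_eq_zero_of_degree_lt`, so it vanishes.
theorem bilinear_identity (hn : 0 < n) (hβpos : ∀ j, 0 < β j) (hβ : StrictMono β)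
    (hα : ∀ j, 0 < α j) (c x : ℝ) :
    numSum β α c 2 x * tauSum β α 0 x - 2 * tauSum β α 1 x * numSum β α c 1 x +
      tauSum β α 2 x * numSum β α c 0 x +
      2 * c * (numSum β α c 1 x * tauSum β α 0 x - tauSum β α 1 x * numSum β α c 0 x) = 0 := by
  set W₀ := tauSum β α 0 x with hW₀
  set W₁ := tauSum β α 1 x with hW₁
  set W₂ := tauSum β α 2 x with hW₂
  set w : (Fin n → Bool) → ℝ := fun τ => tauCoeff β α τ * Real.exp (freq β τ * x) with hw
  set a : (Fin n → Bool) → ℝ := fun τ => W₀ * freq β τ ^ 2 - 2 * W₁ * freq β τ + W₂ with ha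
  set b : (Fin n → Bool) → ℝ := fun τ => 2 * (W₀ * freq β τ - W₁) with hb
  set S : ℝ[X] := ∑ τ, C (w τ) * (C (a τ) * nodePoly β τ + C (b τ) * (X * nodePoly β τ)) with hS
  have hev : ∀ c, S.eval c = ∑ τ, w τ * (a τ + b τ * c) * (nodePoly β τ).eval c := by
    intro c
    rw [hS, eval_finsetSum]
    refine Finset.sum_congr rfl fun τ _ => ?_
    simp only [eval_mul, eval_add, eval_C, eval_X]
    ring
  have hW0 : ∑ τ, w τ = W₀ := by
    rw [hW₀, tauSum]; exact Finset.sum_congr rfl fun τ _ => by rw [hw]; ring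
  have hW1 : ∑ τ, w τ * freq β τ = W₁ := by
    rw [hW₁, tauSum]; exact Finset.sum_congr rfl fun τ _ => by rw [hw]; ring
  have hW2 : ∑ τ, w τ * freq β τ ^ 2 = W₂ := by
    rw [hW₂, tauSum]; exact Finset.sum_congr rfl fun τ _ => by rw [hw]; ring
  have hmonic : ∀ τ, (nodePoly β τ).Monic := fun τ => monic_prod_of_monic _ _ fun j _ => monic_X_sub_C _
  have hdeg : ∀ τ, (nodePoly β τ).natDegree = n := fun τ => by
    rw [nodePoly, natDegree_finsetProd_X_sub_C_eq_card]
    simp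
  have hc0 : ∀ τ, (nodePoly β τ).coeff n = 1 := fun τ => by
    have := (hmonic τ).coeff_natDegree
    rwa [hdeg] at this
  have hc1 : ∀ τ, (nodePoly β τ).coeff (n - 1) = -freq β τ := fun τ => by
    have := prod_X_sub_C_coeff_card_pred (Finset.univ : Finset (Fin n)) (node β τ) (by simpa using hn)
    simpa [nodePoly, freq] using this
  have hc2 : ∀ τ, ∀ i, n < i → (nodePoly β τ).coeff i = 0 := fun τ i hi =>
    coeff_eq_zero_of_natDegree_lt (by rw [hdeg]; exact hi)
  have hcoeff : ∀ i, S.coeff (i + 1) = ∑ τ, w τ * (a τ * (nodePoly β τ).coeff (i + 1) +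
      b τ * (nodePoly β τ).coeff i) := by
    intro i
    rw [hS, finsetSum_coeff]
    refine Finset.sum_congr rfl fun τ _ => ?_
    rw [coeff_C_mul, coeff_add, coeff_C_mul, coeff_C_mul, coeff_X_mul]
  -- The coefficients at `n` and `n + 1` reduce to `-W₀W₂ + W₂W₀` and `2(W₀W₁ - W₁W₀)`; the second
  -- leading coefficient of a node polynomial, `-freq`, enters the former.
  have hSdeg : S.degree < n := by
    rw [degree_lt_iff_coeff_zero]
    intro i hi
    obtain ⟨m, rfl⟩ : ∃ m, i = m + 1 := ⟨i - 1, by omega⟩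
    rw [hcoeff]
    rcases Nat.lt_trichotomy (m + 1) n with h | h | h
    · omega
    · have hm : m = n - 1 := by omega
      rw [h, hm]
      simp only [hc0, hc1]
      have e : ∀ τ, w τ * (a τ * 1 + b τ * -freq β τ) =
          -W₀ * (w τ * freq β τ ^ 2) + W₂ * w τ := fun τ => by simp only [ha, hb]; ring
      simp only [e, Finset.sum_add_distrib, ← Finset.mul_sum, hW0, hW2]
      ring
    · rcases Nat.lt_or_ge n m with h' | h'
      · exact Finset.sum_eq_zero fun τ _ => by rw [hc2 τ _ h, hc2 τ _ h']; ring
      · have hm : m = n := by omega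
        simp only [hm, hc0, hc2 _ (n + 1) (Nat.lt_succ_self n)]
        have e : ∀ τ, w τ * (a τ * 0 + b τ * 1) = 2 * W₀ * (w τ * freq β τ) - 2 * W₁ * w τ :=
          fun τ => by simp only [hb]; ring
        simp only [e, Finset.sum_sub_distrib, ← Finset.mul_sum, hW0, hW1]
        ring
  have hS0 : S = 0 := by
    refine poly_eq_zero_of_degree_lt hβpos hβ hα x hSdeg fun j => ?_
    -- At `c = ±β_j`, completing the square turns `a τ + b τ c` into a function of the shifted
    -- frequency `θ = freq ± β_j` alone, as `sum_flip` needs.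
    have := sum_flip (β := β) (α := α) j
      (fun θ => Real.exp (θ * x) * (W₀ * (θ ^ 2 - β j ^ 2) - 2 * W₁ * θ + W₂))
    have e1 : Real.exp (-β j * x) * S.eval (-β j) = ∑ τ, tauCoeff β α τ *
        (nodePoly β τ).eval (-β j) * (Real.exp ((freq β τ - β j) * x) *
        (W₀ * ((freq β τ - β j) ^ 2 - β j ^ 2) - 2 * W₁ * (freq β τ - β j) + W₂)) := by
      rw [hev, Finset.mul_sum]
      refine Finset.sum_congr rfl fun τ _ => ?_
      rw [sub_eq_add_neg, add_mul, Real.exp_add]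
      simp only [hw, ha, hb]
      ring
    have e2 : Real.exp (β j * x) * S.eval (β j) = ∑ τ, tauCoeff β α τ *
        (nodePoly β τ).eval (β j) * (Real.exp ((freq β τ + β j) * x) *
        (W₀ * ((freq β τ + β j) ^ 2 - β j ^ 2) - 2 * W₁ * (freq β τ + β j) + W₂)) := by
      rw [hev, Finset.mul_sum]
      refine Finset.sum_congr rfl fun τ _ => ?_
      rw [add_mul, Real.exp_add]
      simp only [hw, ha, hb]
      ring
    rw [mul_assoc, mul_assoc, e1, e2]
    exact this
  have := hev c
  rw [hS0, eval_zero] at this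
  rw [this]
  simp only [numSum, Finset.sum_mul, Finset.mul_sum, ← Finset.sum_add_distrib,
    ← Finset.sum_sub_distrib]
  refine Finset.sum_congr rfl fun τ _ => ?_
  simp only [hw, ha, hb]
  ring

end Soliton

end KdV

end

noncomputable section

namespace KdV

/-! ### Positive exponential sums -/

section ExpPoly

variable {ι : Type*} [Fintype ι]

/-- The `k`-th derivative of the exponential sum `∑ A_i e^(l_i x)`. -/
def expPoly (A l : ι → ℝ) (k : ℕ) (x : ℝ) : ℝ := ∑ i, A i * l i ^ k * Real.exp (l i * x)

theorem hasDerivAt_expPoly (A l : ι → ℝ) (k : ℕ) (x : ℝ) :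
    HasDerivAt (expPoly A l k) (expPoly A l (k + 1) x) x := by
  unfold expPoly
  refine HasDerivAt.fun_sum fun i _ => ?_
  have h : HasDerivAt (fun x : ℝ => Real.exp (l i * x)) (Real.exp (l i * x) * l i) x := by
    simpa using ((hasDerivAt_id x).const_mul (l i)).exp
  exact (h.const_mul (A i * l i ^ k)).congr_deriv (by ring)

theorem continuous_expPoly (A l : ι → ℝ) (k : ℕ) : Continuous (expPoly A l k) :=
  continuous_iff_continuousAt.mpr fun x => (hasDerivAt_expPoly A l k x).continuousAt

theorem expPoly_pos [Nonempty ι] {A : ι → ℝ} (hA : ∀ i, 0 < A i) (l : ι → ℝ) (x : ℝ) :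
    0 < expPoly A l 0 x := by
  refine Finset.sum_pos (fun i _ => ?_) Finset.univ_nonempty
  have := hA i
  rw [pow_zero, mul_one]; positivity

theorem expPoly_neg (A l : ι → ℝ) (k : ℕ) (x : ℝ) :
    expPoly A (fun i => -l i) k x = (-1) ^ k * expPoly A l k (-x) := by
  rw [expPoly, expPoly, Finset.mul_sum]
  refine Finset.sum_congr rfl fun i _ => ?_
  rw [neg_pow, neg_mul_comm]; ring

/-- The second derivative of the logarithm of an exponential sum. -/
def logSecond (A l : ι → ℝ) (x : ℝ) : ℝ :=
  (expPoly A l 2 x * expPoly A l 0 x - expPoly A l 1 x ^ 2) / expPoly A l 0 x ^ 2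

theorem logSecond_neg (A l : ι → ℝ) (x : ℝ) :
    logSecond A (fun i => -l i) x = logSecond A l (-x) := by
  simp [logSecond, expPoly_neg]

theorem continuous_logSecond [Nonempty ι] {A : ι → ℝ} (hA : ∀ i, 0 < A i) (l : ι → ℝ) :
    Continuous (logSecond A l) := by
  have := continuous_expPoly A l
  exact Continuous.div (by fun_prop) (by fun_prop) fun x => pow_ne_zero _ (expPoly_pos hA l x).ne'

theorem expPoly_add_zero (A l : ι → ℝ) (c x : ℝ) :
    expPoly A (fun i => l i + c) 0 x = Real.exp (c * x) * expPoly A l 0 x := by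
  rw [expPoly, expPoly, Finset.mul_sum]
  refine Finset.sum_congr rfl fun i _ => ?_
  rw [add_mul, Real.exp_add]; ring

theorem expPoly_add_one (A l : ι → ℝ) (c x : ℝ) :
    expPoly A (fun i => l i + c) 1 x =
      Real.exp (c * x) * (expPoly A l 1 x + c * expPoly A l 0 x) := by
  simp only [expPoly, Finset.mul_sum, ← Finset.sum_add_distrib]
  refine Finset.sum_congr rfl fun i _ => ?_
  rw [add_mul, Real.exp_add]; ring

theorem expPoly_add_two (A l : ι → ℝ) (c x : ℝ) :
    expPoly A (fun i => l i + c) 2 x =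
      Real.exp (c * x) * (expPoly A l 2 x + 2 * c * expPoly A l 1 x + c ^ 2 * expPoly A l 0 x) := by
  simp only [expPoly, Finset.mul_sum, ← Finset.sum_add_distrib]
  refine Finset.sum_congr rfl fun i _ => ?_
  rw [add_mul, Real.exp_add]; ring

/-- A common frequency shift changes the logarithm by a linear function. This permits normalising
the top frequency to `0`. -/
theorem logSecond_add (A l : ι → ℝ) (c x : ℝ) :
    logSecond A (fun i => l i + c) x = logSecond A l x := by
  rw [logSecond, logSecond, expPoly_add_zero, expPoly_add_one, expPoly_add_two, mul_pow,
    ← mul_div_mul_left _ (expPoly A l 0 x ^ 2) (pow_ne_zero 2 (Real.exp_ne_zero (c * x)))]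
  congr 1 <;> ring

theorem hasDerivAt_logDeriv [Nonempty ι] {A : ι → ℝ} (hA : ∀ i, 0 < A i) (l : ι → ℝ) (x : ℝ) :
    HasDerivAt (fun x => expPoly A l 1 x / expPoly A l 0 x) (logSecond A l x) x := by
  refine ((hasDerivAt_expPoly A l 1 x).fun_div (hasDerivAt_expPoly A l 0 x)
    (expPoly_pos hA l x).ne').congr_deriv ?_
  rw [logSecond]; ring

theorem hasDerivAt_log_expPoly [Nonempty ι] {A : ι → ℝ} (hA : ∀ i, 0 < A i) (l : ι → ℝ) (x : ℝ) :
    HasDerivAt (fun x => Real.log (expPoly A l 0 x)) (expPoly A l 1 x / expPoly A l 0 x) x :=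
  (hasDerivAt_expPoly A l 0 x).log (expPoly_pos hA l x).ne'

/-! ### Exponential sums with top frequency zero and a spectral gap -/

section Top

variable {A l : ι → ℝ} {p : ι} {d : ℝ}

theorem abs_expPoly_le (B : ι → ℝ) (hp : l p = 0) (hl : ∀ i ≠ p, l i ≤ -d) {k : ℕ} (hk : k ≠ 0)
    {x : ℝ} (hx : 0 ≤ x) :
    |expPoly B l k x| ≤ (∑ i, |B i * l i ^ k|) * Real.exp (-d * x) := by
  rw [Finset.sum_mul]
  refine (Finset.abs_sum_le_sum_abs _ _).trans (Finset.sum_le_sum fun i _ => ?_)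
  rw [abs_mul, abs_of_pos (Real.exp_pos _)]
  by_cases hi : i = p
  · subst hi; simp [hp, hk]
  · have := hl i hi
    gcongr

theorem tendsto_expPoly (B : ι → ℝ) (hp : l p = 0) (hd : 0 < d) (hl : ∀ i ≠ p, l i ≤ -d) :
    Tendsto (expPoly B l 0) atTop (𝓝 (B p)) := by
  classical
  have h : Tendsto (fun x => ∑ i, B i * l i ^ 0 * Real.exp (l i * x)) atTop
      (𝓝 (∑ i, if i = p then B p else 0)) := by
    refine tendsto_finsetSum _ fun i _ => ?_
    by_cases hi : i = p
    · subst hi; simp [hp]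
    · have h1 : l i < 0 := by have := hl i hi; linarith
      have := (Real.tendsto_exp_atBot.comp (tendsto_id.const_mul_atTop_of_neg h1)).const_mul
        (B i * l i ^ 0)
      simpa [hi] using this
  simp only [Finset.sum_ite_eq', Finset.mem_univ, if_true] at h
  exact h

theorem le_expPoly (hA : ∀ i, 0 < A i) (hp : l p = 0) (x : ℝ) : A p ≤ expPoly A l 0 x := by
  have := Finset.single_le_sum (f := fun i => A i * l i ^ 0 * Real.exp (l i * x))
    (fun i _ => by have := hA i; rw [pow_zero, mul_one]; positivity) (Finset.mem_univ p)
  simpa [hp, expPoly] using this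

/-- The top term is constant, so it bounds the sum from below and drops out of all derivatives,
which therefore decay at the rate of the gap. -/
theorem exists_abs_logSecond_le_of_zero (hA : ∀ i, 0 < A i) (hp : l p = 0) (hd : 0 < d)
    (hl : ∀ i ≠ p, l i ≤ -d) : ∃ C, ∀ x, 0 ≤ x →
      |expPoly A l 1 x / expPoly A l 0 x| ≤ C * Real.exp (-d * x) ∧
      |logSecond A l x| ≤ C * Real.exp (-d * x) := by
  set a := A p with ha
  have ha0 : 0 < a := hA p
  set c₁ := ∑ i, |A i * l i ^ 1|
  set c₂ := ∑ i, |A i * l i ^ 2|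
  have hc1 : 0 ≤ c₁ := Finset.sum_nonneg fun i _ => abs_nonneg _
  have hc2 : 0 ≤ c₂ := Finset.sum_nonneg fun i _ => abs_nonneg _
  refine ⟨c₁ / a + (c₂ / a + (c₁ / a) ^ 2), fun x hx => ?_⟩
  have hE := le_expPoly hA hp x
  have hE0 : 0 < expPoly A l 0 x := ha0.trans_le hE
  have hq : ∀ {k : ℕ}, k ≠ 0 → |expPoly A l k x / expPoly A l 0 x| ≤
      (∑ i, |A i * l i ^ k|) / a * Real.exp (-d * x) := by
    intro k hk
    rw [abs_div, abs_of_pos hE0, div_mul_eq_mul_div]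
    exact div_le_div₀ (mul_nonneg (Finset.sum_nonneg fun i _ => abs_nonneg _) (Real.exp_pos _).le)
      (abs_expPoly_le A hp hl hk hx) ha0 hE
  have h1 := hq one_ne_zero
  have h2 := hq two_ne_zero
  have he1 : Real.exp (-d * x) ≤ 1 := Real.exp_le_one_iff.mpr (by nlinarith)
  have he0 := Real.exp_pos (-d * x)
  have p1 : 0 ≤ c₁ / a := by positivity
  have p2 : 0 ≤ c₂ / a := by positivity
  constructor
  · refine h1.trans (mul_le_mul_of_nonneg_right ?_ he0.le)
    have : 0 ≤ (c₁ / a) ^ 2 := sq_nonneg _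
    linarith
  · have e : logSecond A l x = expPoly A l 2 x / expPoly A l 0 x -
        (expPoly A l 1 x / expPoly A l 0 x) ^ 2 := by
      rw [logSecond]; field_simp
    have h3 : |expPoly A l 1 x / expPoly A l 0 x| ^ 2 ≤ (c₁ / a * Real.exp (-d * x)) ^ 2 := by
      gcongr
    have h4 : (c₁ / a * Real.exp (-d * x)) ^ 2 ≤ (c₁ / a) ^ 2 * Real.exp (-d * x) := by
      rw [mul_pow]
      gcongr
      nlinarith
    rw [e]
    refine (abs_sub _ _).trans ?_
    rw [abs_pow]
    have : 0 ≤ c₁ / a * Real.exp (-d * x) := by positivity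
    nlinarith

end Top

/-- Weighted integrability of exponentially decaying functions. -/
theorem integrableOn_Ioi_of_abs_le_exp {g : ℝ → ℝ} (hg : Continuous g) {C d : ℝ} (hd : 0 < d)
    (h : ∀ x, 0 ≤ x → |g x| ≤ C * Real.exp (-d * x)) :
    IntegrableOn (fun t => (1 + |t|) ^ 2 * g t) (Set.Ioi 0) := by
  refine integrable_of_isBigO_exp_neg (b := d / 2) (half_pos hd) (by fun_prop) ?_
  have h1 : (fun x : ℝ => x ^ 2) =O[atTop] fun x => Real.exp (d / 2 * x) :=
    (isLittleO_pow_exp_pos_mul_atTop 2 (half_pos hd)).isBigO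
  have h2 : (fun t : ℝ => (1 + |t|) ^ 2) =O[atTop] fun x : ℝ => x ^ 2 := by
    refine Asymptotics.IsBigO.of_bound 4 ?_
    filter_upwards [eventually_ge_atTop 1] with x hx
    rw [Real.norm_of_nonneg (by positivity), Real.norm_of_nonneg (by positivity),
      abs_of_nonneg (by linarith)]
    nlinarith
  have h3 : g =O[atTop] fun x => Real.exp (-d * x) := by
    refine Asymptotics.IsBigO.of_bound C ?_
    filter_upwards [eventually_ge_atTop 0] with x hx
    rw [Real.norm_of_nonneg (Real.exp_pos _).le]
    exact h x hx
  refine ((h2.trans h1).mul h3).congr_right fun x => ?_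
  rw [← Real.exp_add]
  ring_nf

/-- An antiderivative is `s (log E)' - log E`. At infinity its first term vanishes by exponential
decay and the second tends to minus the logarithm of the top coefficient. -/
theorem integral_mul_logSecond_of_zero [Nonempty ι] {A l : ι → ℝ} {p : ι} {d : ℝ}
    (hA : ∀ i, 0 < A i) (hp : l p = 0)
    (hd : 0 < d) (hl : ∀ i ≠ p, l i ≤ -d) :
    ∫ s in Set.Ioi (0 : ℝ), s * logSecond A l s =
      Real.log (expPoly A l 0 0) - Real.log (A p) := by
  obtain ⟨C, hC⟩ := exists_abs_logSecond_le_of_zero hA hp hd hl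
  have hderiv : ∀ s ∈ Set.Ioi (0 : ℝ), HasDerivAt (fun s => s * (expPoly A l 1 s / expPoly A l 0 s) -
      Real.log (expPoly A l 0 s)) (s * logSecond A l s) s := by
    intro s _
    refine (((hasDerivAt_id' s).fun_mul (hasDerivAt_logDeriv hA l s)).fun_sub
      (hasDerivAt_log_expPoly hA l s)).congr_deriv ?_
    ring
  have hcont : Continuous (fun s => s * (expPoly A l 1 s / expPoly A l 0 s) -
      Real.log (expPoly A l 0 s)) := by
    have h1 := continuous_expPoly A l
    have h2 := fun x => (expPoly_pos hA l x).ne'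
    exact (continuous_id.mul ((h1 1).div (h1 0) h2)).sub ((h1 0).log h2)
  have hint : IntegrableOn (fun s => s * logSecond A l s) (Set.Ioi 0) := by
    have h := integrableOn_Ioi_of_abs_le_exp (continuous_logSecond hA l) hd fun x hx => (hC x hx).2
    refine Integrable.mono h
      (continuous_id.mul (continuous_logSecond hA l)).aestronglyMeasurable.restrict
      (Eventually.of_forall fun s => ?_)
    rw [norm_mul, norm_mul, Real.norm_eq_abs s, Real.norm_of_nonneg (by positivity : 0 ≤ (1 + |s|) ^ 2)]
    have := abs_nonneg s
    refine mul_le_mul_of_nonneg_right ?_ (norm_nonneg _)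
    nlinarith
  have hlim : Tendsto (fun s => s * (expPoly A l 1 s / expPoly A l 0 s) -
      Real.log (expPoly A l 0 s)) atTop (𝓝 (0 - Real.log (A p))) := by
    refine Tendsto.sub ?_ ((tendsto_expPoly A hp hd hl).log (hA p).ne')
    have h1 : Tendsto (fun s : ℝ => C * (s * Real.exp (-d * s))) atTop (𝓝 0) := by
      have := (Real.tendsto_pow_mul_exp_neg_atTop_nhds_zero 1)
      have h2 := ((this.comp (tendsto_id.const_mul_atTop hd)).const_mul (C / d))
      simp only [mul_zero] at h2
      refine h2.congr fun s => ?_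
      simp only [Function.comp, id, pow_one]
      rw [neg_mul]
      field_simp
    refine squeeze_zero_norm' ?_ h1
    filter_upwards [eventually_ge_atTop 0] with s hs
    rw [norm_mul, Real.norm_of_nonneg hs, Real.norm_eq_abs, mul_left_comm]
    exact mul_le_mul_of_nonneg_left (hC s hs).1 hs
  rw [integral_Ioi_of_hasDerivAt_of_tendsto hcont.continuousWithinAt hderiv hint hlim]
  simp
  ring

end ExpPoly

end KdV

end

noncomputable section

namespace KdV

/-! ### Exponential sums with an arbitrary dominant frequency -/

section ExpPolyTop

variable {ι : Type*} [Fintype ι] {A l : ι → ℝ} {p : ι} {d : ℝ}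

theorem exists_abs_logSecond_le (hA : ∀ i, 0 < A i) (hd : 0 < d) (hl : ∀ i ≠ p, l i ≤ l p - d) :
    ∃ C, ∀ x, 0 ≤ x → |logSecond A l x| ≤ C * Real.exp (-d * x) := by
  obtain ⟨C, hC⟩ := exists_abs_logSecond_le_of_zero (l := fun i => l i + -l p) (p := p) hA
    (by simp) hd (fun i hi => by have := hl i hi; linarith)
  exact ⟨C, fun x hx => by have := (hC x hx).2; rwa [logSecond_add] at this⟩

theorem integral_mul_logSecond [Nonempty ι] (hA : ∀ i, 0 < A i) (hd : 0 < d)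
    (hl : ∀ i ≠ p, l i ≤ l p - d) :
    ∫ s in Set.Ioi (0 : ℝ), s * logSecond A l s =
      Real.log (expPoly A l 0 0) - Real.log (A p) := by
  have := integral_mul_logSecond_of_zero (l := fun i => l i + -l p) (p := p) hA
    (by simp) hd (fun i hi => by have := hl i hi; linarith)
  simp only [logSecond_add, expPoly_add_zero, mul_zero, Real.exp_zero, one_mul] at this
  exact this

theorem tendsto_expPoly_div (hA : ∀ i, 0 < A i) (B : ι → ℝ) (hd : 0 < d)
    (hl : ∀ i ≠ p, l i ≤ l p - d) :
    Tendsto (fun x => expPoly B l 0 x / expPoly A l 0 x) atTop (𝓝 (B p / A p)) := by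
  have hl' : ∀ i ≠ p, l i + -l p ≤ -d := fun i hi => by have := hl i hi; linarith
  have h := (tendsto_expPoly (l := fun i => l i + -l p) (p := p) B (by simp) hd hl').div
    (tendsto_expPoly (l := fun i => l i + -l p) (p := p) A (by simp) hd hl') (hA p).ne'
  refine h.congr fun x => ?_
  simp only [Pi.div_apply, expPoly_add_zero]
  rw [mul_div_mul_left _ _ (Real.exp_ne_zero _)]

end ExpPolyTop

/-! ### The soliton potential -/

section Soliton

variable {n : ℕ} {β α : Fin n → ℝ}

theorem nSoliton_eq (hβpos : ∀ j, 0 < β j) (hβ : StrictMono β) (hα : ∀ j, 0 < α j) (x : ℝ) :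
    nSoliton β α x 0 = -2 * logSecond (tauCoeff β α) (freq β) x := by
  have hA := tauCoeff_pos hβpos hβ hα
  have h0 : (fun y => Real.log (solitonWronskian β α y 0)) =
      fun y => Real.log (expPoly (tauCoeff β α) (freq β) 0 y) :=
    funext fun y => by rw [solitonWronskian_eq]; rfl
  have h1 : deriv (fun y => Real.log (expPoly (tauCoeff β α) (freq β) 0 y)) = fun y =>
      expPoly (tauCoeff β α) (freq β) 1 y / expPoly (tauCoeff β α) (freq β) 0 y :=
    funext fun y => (hasDerivAt_log_expPoly hA (freq β) y).deriv
  rw [nSoliton, h0, iteratedDeriv_succ, iteratedDeriv_one, h1, (hasDerivAt_logDeriv hA _ x).deriv]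

theorem freq_le (hβ : ∀ j, 0 < β j) {b : ℝ} (hb : ∀ j, b ≤ β j) (τ : Fin n → Bool)
    (hτ : τ ≠ fun _ => true) : freq β τ ≤ freq β (fun _ => true) - 2 * b := by
  obtain ⟨j, hj⟩ : ∃ j, τ j ≠ true := by
    by_contra! h
    exact hτ (funext h)
  have h1 : ∀ i, node β τ i ≤ node β (fun _ => true) i := fun i => by
    have := hβ i
    simp only [node, if_true]
    split_ifs <;> linarith
  have h2 : node β τ j = -β j := by simp [node, hj]
  have h3 : node β (fun _ => true) j = β j := by simp [node]
  rw [freq, freq, ← Finset.add_sum_erase _ _ (Finset.mem_univ j),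
    ← Finset.add_sum_erase _ (fun i => node β (fun _ => true) i) (Finset.mem_univ j), h2, h3]
  have := Finset.sum_le_sum (s := Finset.univ.erase j) fun i _ => h1 i
  linarith [hb j]

theorem freq_not (τ : Fin n → Bool) : freq β (fun j => !τ j) = -freq β τ := by
  rw [freq, freq, ← Finset.sum_neg_distrib]
  refine Finset.sum_congr rfl fun j _ => ?_
  rw [node, node]
  cases τ j <;> simp

theorem neg_freq_le (hβ : ∀ j, 0 < β j) {b : ℝ} (hb : ∀ j, b ≤ β j) (τ : Fin n → Bool)
    (hτ : τ ≠ fun _ => false) : -freq β τ ≤ -freq β (fun _ => false) - 2 * b := by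
  rw [← freq_not, ← freq_not]
  refine freq_le hβ hb _ fun h => hτ (funext fun j => ?_)
  have := congrFun h j
  simpa using this

theorem exists_pos_le (hβ : ∀ j, 0 < β j) : ∃ b, 0 < b ∧ ∀ j, b ≤ β j := by
  obtain h | h := isEmpty_or_nonempty (Fin n)
  · exact ⟨1, one_pos, fun j => h.elim j⟩
  · obtain ⟨i, hi⟩ := Finite.exists_min β
    exact ⟨β i, hβ i, hi⟩

/-- The all-plus frequency dominates at `+∞` and the all-minus one at `-∞`, each with gap at least
`2b`, so the potential decays exponentially in both directions. -/
theorem isWeighted_nSoliton (hβpos : ∀ j, 0 < β j) (hβ : StrictMono β) (hα : ∀ j, 0 < α j) :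
    IsWeighted (fun x => nSoliton β α x 0) := by
  have hA := tauCoeff_pos hβpos hβ hα
  obtain ⟨b, hb, hbj⟩ := exists_pos_le hβpos
  have hd : 0 < 2 * b := by positivity
  obtain ⟨C, hC⟩ := exists_abs_logSecond_le hA hd (freq_le hβpos hbj)
  obtain ⟨C', hC'⟩ := exists_abs_logSecond_le (l := fun τ => -freq β τ) hA hd
    (neg_freq_le hβpos hbj)
  have hc := continuous_logSecond hA (freq β)
  have hc' := continuous_logSecond hA (fun τ => -freq β τ)
  have h1 := integrableOn_Ioi_of_abs_le_exp hc hd hC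
  have h2 := integrableOn_Ioi_of_abs_le_exp hc' hd hC'
  have h3 : IntegrableOn (fun t => (1 + |t|) ^ 2 * logSecond (tauCoeff β α) (freq β) t)
      (Set.Iic 0) := by
    have := h2.congr_set_ae Ioi_ae_eq_Ici.symm
    rw [← neg_zero] at this
    simpa only [logSecond_neg, neg_neg, abs_neg] using this.comp_neg_Iic
  have h4 : Integrable fun t => (1 + |t|) ^ 2 * logSecond (tauCoeff β α) (freq β) t := by
    rw [← integrableOn_univ, ← Set.Iic_union_Ioi (a := (0 : ℝ))]
    exact h3.union h1
  have h5 : (fun x => nSoliton β α x 0) = fun x => -2 * logSecond (tauCoeff β α) (freq β) x :=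
    funext (nSoliton_eq hβpos hβ hα)
  rw [h5]
  constructor
  · refine (h4.mono hc.aestronglyMeasurable (Eventually.of_forall fun t => ?_)).const_mul _
    rw [norm_mul]
    have : (1 : ℝ) ≤ ‖(1 + |t|) ^ 2‖ := by
      rw [Real.norm_of_nonneg (by positivity)]
      nlinarith [abs_nonneg t]
    nlinarith [norm_nonneg (logSecond (tauCoeff β α) (freq β) t)]
  · refine (h4.norm.const_mul 2).congr (Eventually.of_forall fun t => ?_)
    beta_reduce
    rw [norm_mul, Real.norm_of_nonneg (by positivity : 0 ≤ (1 + |t|) ^ 2), abs_mul, abs_neg,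
      abs_two, Real.norm_eq_abs]
    ring

theorem IsWeighted.integrable_mul {u : ℝ → ℝ} (hu : IsWeighted u) :
    Integrable fun s => s * u s := by
  refine hu.2.mono (continuous_id.aestronglyMeasurable.mul hu.1.aestronglyMeasurable)
    (Eventually.of_forall fun s => ?_)
  rw [norm_mul, norm_mul, Real.norm_eq_abs s, Real.norm_of_nonneg (by positivity : 0 ≤ (1 + |s|) ^ 2),
    Real.norm_eq_abs, Real.norm_eq_abs, abs_abs]
  have := abs_nonneg s
  refine mul_le_mul_of_nonneg_right ?_ (abs_nonneg _)
  nlinarith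

/-- The two half-line integrals add up to at least `4 log W(0)` minus twice the logarithms of the
extreme coefficients. By `four_pow_mul_le_tauSum_sq` this is at least `2 n log 4`, which exceeds `n`
since `log 4 > 1`. -/
theorem lt_integral_abs_mul_nSoliton (hn : 0 < n) (hβpos : ∀ j, 0 < β j) (hβ : StrictMono β)
    (hα : ∀ j, 0 < α j) : n < ∫ s : ℝ, |s * nSoliton β α s 0| := by
  have hA := tauCoeff_pos hβpos hβ hα
  obtain ⟨b, hb, hbj⟩ := exists_pos_le hβpos
  have hd : 0 < 2 * b := by positivity
  have hI : Integrable fun s => |s * nSoliton β α s 0| :=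
    ((isWeighted_nSoliton hβpos hβ hα).integrable_mul).abs
  have e1 := integral_mul_logSecond hA hd (freq_le hβpos hbj)
  have e2 := integral_mul_logSecond (l := fun τ => -freq β τ) hA hd (neg_freq_le hβpos hbj)
  have e3 : expPoly (tauCoeff β α) (fun τ => -freq β τ) 0 0 = tauSum β α 0 0 := by
    simp [expPoly, tauSum]
  have e4 : expPoly (tauCoeff β α) (freq β) 0 0 = tauSum β α 0 0 := rfl
  rw [e3] at e2
  rw [e4] at e1
  simp only [logSecond_neg] at e2
  have h1 : 2 * ∫ s in Set.Ioi (0 : ℝ), s * logSecond (tauCoeff β α) (freq β) s ≤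
      ∫ s in Set.Ioi (0 : ℝ), |s * nSoliton β α s 0| := by
    rw [← integral_const_mul]
    refine (le_abs_self _).trans (abs_integral_le_integral_abs.trans_eq ?_)
    refine integral_congr_ae (Eventually.of_forall fun s => ?_)
    beta_reduce
    rw [nSoliton_eq hβpos hβ hα, ← abs_neg]
    congr 1; ring
  have h2 : 2 * ∫ s in Set.Ioi (0 : ℝ), s * logSecond (tauCoeff β α) (freq β) (-s) ≤
      ∫ s in Set.Iic (0 : ℝ), |s * nSoliton β α s 0| := by
    have := integral_comp_neg_Ioi (0 : ℝ) (fun s => |s * nSoliton β α s 0|)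
    rw [neg_zero] at this
    rw [← integral_const_mul, ← this]
    refine (le_abs_self _).trans (abs_integral_le_integral_abs.trans_eq ?_)
    refine integral_congr_ae (Eventually.of_forall fun s => ?_)
    beta_reduce
    rw [nSoliton_eq hβpos hβ hα]
    congr 1; ring
  have h3 := intervalIntegral.integral_Iic_add_Ioi (b := (0 : ℝ)) hI.integrableOn hI.integrableOn
  have hW := tauSum_pos hβpos hβ hα 0
  have hp := hA fun _ => true
  have hm := hA fun _ => false
  have h4 := Real.log_le_log (by positivity) (four_pow_mul_le_tauSum_sq hβpos hβ hα)
  rw [Real.log_mul (by positivity) (by positivity), Real.log_mul hp.ne' hm.ne', Real.log_pow,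
    Real.log_pow] at h4
  have h5 : 1 < Real.log 4 := by
    rw [Real.lt_log_iff_exp_lt (by norm_num)]
    exact Real.exp_one_lt_three.trans (by norm_num)
  have hn' : (0 : ℝ) < n := by exact_mod_cast hn
  rw [e1] at h1
  rw [e2] at h2
  push_cast at h4
  nlinarith

theorem succ_le_boundStateBound_nSoliton (hn : 0 < n) (hβpos : ∀ j, 0 < β j) (hβ : StrictMono β)
    (hα : ∀ j, 0 < α j) : ((n + 1 : ℕ) : ℤ) ≤ boundStateBound (fun x => nSoliton β α x 0) := by
  refine (boundStateBound_isGreatest _).2 ?_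
  have := lt_integral_abs_mul_nSoliton hn hβpos hβ hα
  simp only [Set.mem_ofPred_eq]
  push_cast
  linarith

/-! ### The Jost solution of the soliton -/

/-- If `m` tends to `L` at `-∞`, then `m' = 2ik - 2ik m - ∫_x^∞ u m` converges as well, necessarily
to `0`. This evaluates `∫ u m`, which is inserted into `jostW_eq`. -/
theorem jostW_eq_of_tendsto {u : ℝ → ℝ} {k L : ℂ} (hk : 0 < k.im) (hu : Integrable u)
    (h : Tendsto (jostM u k) atBot (𝓝 L)) : jostW u k = -(2 * Complex.I * k * L) := by
  have hV := isVolterraSolution_jostM hk hu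
  have hI := hV.integrable_mul hu
  have hd : ∀ x, HasDerivAt (jostM u k) (2 * Complex.I * k - 2 * (Complex.I * k) * jostM u k x -
      ∫ t in Set.Ioi x, (u t : ℂ) * jostM u k t) x := by
    intro x
    have h1 : HasDerivAt (jostPlus u k) (deriv (jostPlus u k) x) x :=
      ((isJostPlus_jostPlus hk hu).1.1 x).hasDerivAt
    have h2 : HasDerivAt (fun x : ℝ => Complex.exp (-(Complex.I * k) * x))
        (Complex.exp (-(Complex.I * k) * x) * -(Complex.I * k)) x := by
      simpa using ((hasDerivAt_id x).ofReal_comp.const_mul (-(Complex.I * k))).cexp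
    have h3 : Complex.exp (Complex.I * k * x) * Complex.exp (-(Complex.I * k) * x) = 1 := by
      rw [← Complex.exp_add]; simp
    refine (h1.fun_mul h2).congr_deriv ?_
    rw [deriv_jostPlus hk hu, jostPlus_eq]
    linear_combination (2 * Complex.I * k - 2 * (Complex.I * k) * jostM u k x -
      ∫ t in Set.Ioi x, (u t : ℂ) * jostM u k t) * h3
  have h4 := tendsto_setIntegral_Ioi_neg hI
  have h5 : Tendsto (fun y => jostM u k (-y)) atTop (𝓝 L) := h.comp tendsto_neg_atTop_atBot
  have h6 := eq_zero_of_tendsto_of_tendsto_deriv (fun y => (hd (-y)).scomp y (hasDerivAt_neg y)) h5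
    (((h5.const_mul (2 * (Complex.I * k))).const_sub (2 * Complex.I * k)).sub h4 |>.const_smul (-1 : ℝ))
  rw [jostW_eq hk hu]
  simp only [neg_smul, one_smul] at h6
  linear_combination h6

/-- The Jost solution of the soliton on the imaginary axis. -/
theorem jostPlus_nSoliton (hn : 0 < n) (hβpos : ∀ j, 0 < β j) (hβ : StrictMono β)
    (hα : ∀ j, 0 < α j) {κ : ℝ} (hκ : 0 < κ) :
    jostPlus (fun x => nSoliton β α x 0) (Complex.I * κ) = fun x =>
      ((Real.exp (-κ * x) * (numSum β α (-κ) 0 x / tauSum β α 0 x) /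
        (nodePoly β fun _ => true).eval (-κ) : ℝ) : ℂ) := by
  have hA := tauCoeff_pos hβpos hβ hα
  have hu := isWeighted_nSoliton hβpos hβ hα
  obtain ⟨b, hb, hbj⟩ := exists_pos_le hβpos
  have him : 0 < (Complex.I * (κ : ℂ)).im := by simpa using hκ
  set N : ℕ → ℝ → ℝ := fun k x => numSum β α (-κ) k x with hN
  set W : ℕ → ℝ → ℝ := fun k x => tauSum β α k x with hW
  set P := (nodePoly β fun _ => true).eval (-κ) with hP
  have hP0 : P ≠ 0 := by
    rw [hP, eval_nodePoly, Finset.prod_ne_zero_iff]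
    intro j _
    have := hβpos j
    simp only [node, if_true]
    linarith
  have hdN : ∀ k x, HasDerivAt (N k) (N (k + 1) x) x := fun k x =>
    hasDerivAt_expPoly (fun τ => tauCoeff β α τ * (nodePoly β τ).eval (-κ)) (freq β) k x
  have hdW : ∀ k x, HasDerivAt (W k) (W (k + 1) x) x := fun k x =>
    hasDerivAt_expPoly (tauCoeff β α) (freq β) k x
  have hW0 : ∀ x, W 0 x ≠ 0 := fun x => (tauSum_pos hβpos hβ hα x).ne'
  have hcN : ∀ k, Continuous (N k) := fun k => continuous_iff_continuousAt.mpr fun x =>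
    (hdN k x).continuousAt
  have hcW : ∀ k, Continuous (W k) := fun k => continuous_iff_continuousAt.mpr fun x =>
    (hdW k x).continuousAt
  have hde : ∀ x, HasDerivAt (fun x : ℝ => Real.exp (-κ * x)) (Real.exp (-κ * x) * -κ) x := fun x => by
    simpa using ((hasDerivAt_id x).const_mul (-κ)).exp
  set f : ℝ → ℝ := fun x => Real.exp (-κ * x) * (N 0 x / W 0 x) / P with hf
  set f₁ : ℝ → ℝ := fun x => Real.exp (-κ * x) *
    (-κ * (N 0 x / W 0 x) + (N 1 x * W 0 x - N 0 x * W 1 x) / W 0 x ^ 2) / P with hf1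
  have hd1 : ∀ x, HasDerivAt f (f₁ x) x := fun x => by
    refine (((hde x).fun_mul ((hdN 0 x).fun_div (hdW 0 x) (hW0 x))).div_const P).congr_deriv ?_
    simp only [hf1]; ring
  have hd2 : ∀ x, HasDerivAt f₁ ((nSoliton β α x 0 + κ ^ 2) * f x) x := fun x => by
    refine (((hde x).fun_mul ((((hdN 0 x).fun_div (hdW 0 x) (hW0 x)).const_mul (-κ)).fun_add
      ((((hdN 1 x).fun_mul (hdW 0 x)).fun_sub ((hdN 0 x).fun_mul (hdW 1 x))).fun_div
        ((hdW 0 x).fun_pow 2) (pow_ne_zero 2 (hW0 x))))).div_const P).congr_deriv ?_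
    -- With `c = -κ`, this identity is the Schrödinger equation for `e^(-κx) N/W` after clearing
    -- denominators.
    have hbil : N 2 x * W 0 x - 2 * W 1 x * N 1 x + W 2 x * N 0 x +
      2 * (-κ) * (N 1 x * W 0 x - W 1 x * N 0 x) = 0 := bilinear_identity hn hβpos hβ hα (-κ) x
    have h0 := hW0 x
    have hu0 : nSoliton β α x 0 = -2 * ((W 2 x * W 0 x - W 1 x ^ 2) / W 0 x ^ 2) :=
      nSoliton_eq hβpos hβ hα x
    rw [hu0]
    simp only [hf, zero_add, one_add_one_eq_two]
    field_simp
    linear_combination W 0 x ^ 2 * hbil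
  have hcf : Continuous f := continuous_iff_continuousAt.mpr fun x => (hd1 x).continuousAt
  have hcf1 : Continuous f₁ := continuous_iff_continuousAt.mpr fun x => (hd2 x).continuousAt
  have hcu : Continuous fun x => nSoliton β α x 0 := by
    have : (fun x => nSoliton β α x 0) = fun x => -2 * logSecond (tauCoeff β α) (freq β) x :=
      funext (nSoliton_eq hβpos hβ hα)
    rw [this]
    exact continuous_const.mul (continuous_logSecond hA (freq β))
  have hk2 : (Complex.I * (κ : ℂ)) ^ 2 = -(κ : ℂ) ^ 2 := by
    rw [mul_pow, Complex.I_sq]; ring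
  have hsol := isSchrodingerSolution_of_isPrim (u := fun x => nSoliton β α x 0)
    (k := Complex.I * κ) (f := fun x => (f x : ℂ)) (g := fun x => (f₁ x : ℂ))
    (isPrim_of_hasDerivAt (fun x => (hd1 x).ofReal_comp) (Complex.continuous_ofReal.comp hcf1))
    ((isPrim_of_hasDerivAt (fun x => (hd2 x).ofReal_comp) (by fun_prop)).congr fun x => by
      rw [hk2]; push_cast; ring)
  refine (IsJostPlus.eq_jostPlus him hu.1 ⟨hsol.1, ?_⟩).symm
  -- At `+∞` the all-plus term dominates both sums, so `N/W` tends to `P`; this explains the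
  -- division by `P` in the formula.
  have hlim := (tendsto_expPoly_div hA (fun τ => tauCoeff β α τ * (nodePoly β τ).eval (-κ))
    (by positivity : 0 < 2 * b) (freq_le hβpos hbj)).div_const P
  rw [mul_div_cancel_left₀ _ (hA _).ne', div_self hP0] at hlim
  refine ((Complex.continuous_ofReal.tendsto _).comp hlim).congr fun x => ?_
  rw [I_mul_I_mul, ← Complex.ofReal_neg, ← Complex.ofReal_exp, ← Complex.ofReal_mul]
  simp only [Function.comp]
  congr 1
  have he : Real.exp (-κ * x) * Real.exp (- -(κ * x)) = 1 := by
    rw [← Real.exp_add]; simp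
  change N 0 x / W 0 x / P = Real.exp (-κ * x) * (N 0 x / W 0 x) / P * Real.exp (- -(κ * x))
  linear_combination -(N 0 x / W 0 x / P) * he

/-- At `-∞` the all-minus term dominates, so the normalised Jost solution tends to the quotient of
the two extreme node polynomials at `-κ`, which is the product; `jostW_eq_of_tendsto` then applies.
-/
theorem jostW_nSoliton (hn : 0 < n) (hβpos : ∀ j, 0 < β j) (hβ : StrictMono β)
    (hα : ∀ j, 0 < α j) {κ : ℝ} (hκ : 0 < κ) :
    jostW (fun x => nSoliton β α x 0) (Complex.I * κ) =
      ((2 * κ * ∏ j, (κ - β j) / (κ + β j) : ℝ) : ℂ) := by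
  have hA := tauCoeff_pos hβpos hβ hα
  have hu := isWeighted_nSoliton hβpos hβ hα
  obtain ⟨b, hb, hbj⟩ := exists_pos_le hβpos
  have him : 0 < (Complex.I * (κ : ℂ)).im := by simpa using hκ
  set P := (nodePoly β fun _ => true).eval (-κ) with hP
  set B : (Fin n → Bool) → ℝ := fun τ => tauCoeff β α τ * (nodePoly β τ).eval (-κ) with hB
  have hM : ∀ x, jostM (fun x => nSoliton β α x 0) (Complex.I * κ) x =
      ((expPoly B (freq β) 0 x / expPoly (tauCoeff β α) (freq β) 0 x / P : ℝ) : ℂ) := by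
    intro x
    rw [jostM, jostPlus_nSoliton hn hβpos hβ hα hκ, neg_mul, I_mul_I_mul, ← Complex.ofReal_neg,
      ← Complex.ofReal_exp, ← Complex.ofReal_mul]
    congr 1
    have he : Real.exp (-κ * x) * Real.exp (- -(κ * x)) = 1 := by
      rw [← Real.exp_add]; simp
    change Real.exp (-κ * x) * (expPoly B (freq β) 0 x / expPoly (tauCoeff β α) (freq β) 0 x) / P *
      Real.exp (- -(κ * x)) = _
    linear_combination (expPoly B (freq β) 0 x / expPoly (tauCoeff β α) (freq β) 0 x / P) * he
  have hlim := ((tendsto_expPoly_div (l := fun τ => -freq β τ) hA B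
    (by positivity : 0 < 2 * b) (neg_freq_le hβpos hbj)).comp tendsto_neg_atBot_atTop).div_const P
  rw [mul_div_cancel_left₀ _ (hA _).ne'] at hlim
  have hlim' : Tendsto (jostM (fun x => nSoliton β α x 0) (Complex.I * κ)) atBot
      (𝓝 (((nodePoly β fun _ => false).eval (-κ) / P : ℝ) : ℂ)) := by
    refine ((Complex.continuous_ofReal.tendsto _).comp hlim).congr fun x => ?_
    rw [hM]
    simp [expPoly_neg]
  have hval : (nodePoly β fun _ => false).eval (-κ) / P = ∏ j, (κ - β j) / (κ + β j) := by
    rw [hP, eval_nodePoly, eval_nodePoly, ← Finset.prod_div_distrib]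
    refine Finset.prod_congr rfl fun j _ => ?_
    simp only [node, if_true, Bool.false_eq_true, if_false]
    rw [← neg_div_neg_eq]
    congr 1 <;> ring
  rw [jostW_eq_of_tendsto him hu.1 hlim', hval]
  push_cast
  linear_combination (-2 * (κ : ℂ) * ∏ j, ((κ : ℂ) - β j) / (κ + β j)) * Complex.I_sq

end Soliton

end KdV

end

noncomputable section

namespace KdV

/-! ### Zeros of perturbations of the soliton Wronskian -/

section Zeros

variable {n : ℕ} {β : Fin n → ℝ}

/-- The Wronskian of the Jost solutions of the soliton on the imaginary axis. -/
def solitonJostW (β : Fin n → ℝ) (κ : ℝ) : ℝ := 2 * κ * ∏ j, (κ - β j) / (κ + β j)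

/-- The zeros of `solitonJostW`. -/
def solitonZero (β : Fin n → ℝ) (o : Option (Fin n)) : ℝ := o.elim 0 β

theorem contDiffAt_prod_div (hβ : ∀ j, 0 < β j) (s : Finset (Fin n)) {κ : ℝ} (hκ : 0 ≤ κ) :
    ContDiffAt ℝ 1 (fun κ => ∏ j ∈ s, (κ - β j) / (κ + β j)) κ := by
  refine contDiffAt_prod fun j _ => ?_
  have : κ + β j ≠ 0 := by have := hβ j; positivity
  exact (contDiffAt_id.sub contDiffAt_const).div (contDiffAt_id.add contDiffAt_const) this

theorem contDiffAt_solitonJostW (hβ : ∀ j, 0 < β j) {κ : ℝ} (hκ : 0 ≤ κ) :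
    ContDiffAt ℝ 1 (solitonJostW β) κ :=
  (contDiffAt_const.mul contDiffAt_id).mul (contDiffAt_prod_div hβ _ hκ)

/-- Records that all zeros are simple, the origin included: `g` at the zero is the derivative there.
-/
theorem exists_factor_solitonJostW (hβ : ∀ j, 0 < β j) (hinj : Function.Injective β)
    (o : Option (Fin n)) : ∃ g : ℝ → ℝ, DifferentiableAt ℝ g (solitonZero β o) ∧
      g (solitonZero β o) ≠ 0 ∧ solitonJostW β = fun κ => (κ - solitonZero β o) * g κ := by
  cases o with
  | none =>
    refine ⟨fun κ => 2 * ∏ j, (κ - β j) / (κ + β j), ?_, ?_, ?_⟩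
    · exact ((contDiffAt_prod_div hβ _ le_rfl).differentiableAt one_ne_zero).const_mul _
    · simp only [solitonZero, Option.elim]
      refine mul_ne_zero two_ne_zero (Finset.prod_ne_zero_iff.mpr fun j _ => ?_)
      have := hβ j
      exact div_ne_zero (by linarith) (by linarith)
    · funext κ; simp only [solitonJostW, solitonZero, Option.elim]; ring
  | some i =>
    have hi := hβ i
    refine ⟨fun κ => 2 * κ / (κ + β i) * ∏ j ∈ Finset.univ.erase i, (κ - β j) / (κ + β j),
      ?_, ?_, ?_⟩
    · refine DifferentiableAt.mul ?_
        ((contDiffAt_prod_div hβ _ hi.le).differentiableAt one_ne_zero)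
      exact DifferentiableAt.div (by fun_prop) (by fun_prop)
        (by simp only [solitonZero, Option.elim]; positivity)
    · simp only [solitonZero, Option.elim]
      refine mul_ne_zero (by positivity) (Finset.prod_ne_zero_iff.mpr fun j hj => ?_)
      have := hβ j
      exact div_ne_zero (sub_ne_zero.mpr fun h => Finset.ne_of_mem_erase hj (hinj h.symm))
        (by positivity)
    · funext κ
      simp only [solitonJostW, solitonZero, Option.elim]
      rw [← Finset.mul_prod_erase _ _ (Finset.mem_univ i)]
      ring

theorem solitonJostW_solitonZero (hβ : ∀ j, 0 < β j) (hinj : Function.Injective β)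
    (o : Option (Fin n)) : solitonJostW β (solitonZero β o) = 0 := by
  obtain ⟨g, -, -, h⟩ := exists_factor_solitonJostW hβ hinj o
  rw [h]; simp

theorem solitonZero_nonneg (hβ : ∀ j, 0 < β j) (o : Option (Fin n)) : 0 ≤ solitonZero β o := by
  cases o with
  | none => exact le_rfl
  | some j => exact (hβ j).le

/-- Near each of its zeros the function is expansive. -/
theorem exists_expansive_solitonJostW (hβ : ∀ j, 0 < β j) (hinj : Function.Injective β)
    (o : Option (Fin n)) : ∃ c : ℝ, ∃ r > 0, ∀ x y, |x - solitonZero β o| ≤ r →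
      |y - solitonZero β o| ≤ r → y ≤ x →
      x - y ≤ c * (solitonJostW β x - solitonJostW β y) := by
  obtain ⟨g, hg, hg0, h⟩ := exists_factor_solitonJostW hβ hinj o
  set p := solitonZero β o
  have h1 : HasDerivAt (solitonJostW β) (g p) p := by
    rw [h]
    refine (((hasDerivAt_id' p).sub_const p).fun_mul hg.hasDerivAt).congr_deriv ?_
    simp
  have h2 : HasStrictDerivAt (solitonJostW β) (g p) p :=
    (contDiffAt_solitonJostW hβ (solitonZero_nonneg hβ o)).hasStrictDerivAt' h1 one_ne_zero
  have h3 := h2.hasStrictFDerivAt.isLittleO.bound (half_pos (abs_pos.mpr hg0))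
  obtain ⟨r, hr, hball⟩ := Metric.eventually_nhds_iff_ball.mp h3
  -- Strict differentiability with error half the derivative leaves half the slope. The constant
  -- keeps the sign of `g p`, so one inequality covers the increasing and the decreasing case.
  refine ⟨2 / g p, r / 2, half_pos hr, fun x y hx hy hxy => ?_⟩
  have h4 := hball (x, y) (by
    rw [Metric.mem_ball, Prod.dist_eq, max_lt_iff, Real.dist_eq, Real.dist_eq]
    constructor <;> simp only <;> linarith)
  simp only [ContinuousLinearMap.toSpanSingleton_apply, smul_eq_mul, Real.norm_eq_abs] at h4
  set E := solitonJostW β x - solitonJostW β y - (x - y) * g p with hE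
  have h5 : |2 / g p * E| ≤ x - y := by
    rw [abs_mul, abs_div, abs_two]
    have hgp : 0 < |g p| := abs_pos.mpr hg0
    calc 2 / |g p| * |E| ≤ 2 / |g p| * (|g p| / 2 * |x - y|) := by gcongr
      _ = x - y := by rw [abs_of_nonneg (sub_nonneg.mpr hxy)]; field_simp
  have h6 : 2 / g p * (solitonJostW β x - solitonJostW β y) = 2 / g p * E + 2 * (x - y) := by
    rw [hE]; field_simp; ring
  rw [h6]
  linarith [neg_abs_le (2 / g p * E)]

/-- The bound holds for arbitrarily large `κ` too: at distance at least `r` from `β_j`, the ratio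
`|κ - β_j|/(κ + β_j)` is smallest at `κ = β_j + r`. -/
theorem le_abs_solitonJostW (hβ : ∀ j, 0 < β j) {r κ : ℝ} (hr : 0 < r)
    (h : ∀ o, r ≤ |κ - solitonZero β o|) (hκ : 0 < κ) :
    2 * r * ∏ j, r / (2 * β j + r) ≤ |solitonJostW β κ| := by
  have h0 : r ≤ κ := by have := h none; simpa [solitonZero, abs_of_pos hκ] using this
  rw [solitonJostW, abs_mul, Finset.abs_prod, abs_mul, abs_two, abs_of_pos hκ]
  refine mul_le_mul (by linarith) (Finset.prod_le_prod (fun j _ => ?_) fun j _ => ?_)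
    (Finset.prod_nonneg fun j _ => ?_) (by positivity)
  · have := hβ j; positivity
  · have hj := hβ j
    have h1 : r ≤ |κ - β j| := h (some j)
    rw [abs_div, abs_of_pos (by positivity : 0 < κ + β j),
      div_le_div_iff₀ (by positivity) (by positivity)]
    rcases abs_cases (κ - β j) with ⟨e, _⟩ | ⟨e, _⟩ <;> rw [e] at h1 ⊢ <;> nlinarith
  · have := hβ j; positivity

/-- Zeros of small perturbations. -/
theorem exists_zeros_of_close (hβ : ∀ j, 0 < β j) (hinj : Function.Injective β) :
    ∃ r > 0, ∃ c > 0, ∀ ε η : ℝ, 0 < ε → ε ≤ r → η ≤ c * ε → ∀ G : ℝ → ℝ,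
      (∀ κ, 0 < κ → |G κ - solitonJostW β κ| ≤ η) →
      (∀ κ l, 0 < κ → 0 < l →
        |(G κ - solitonJostW β κ) - (G l - solitonJostW β l)| ≤ η * |κ - l|) →
      (∀ j, ∃ z, 0 < z ∧ |z - β j| < ε ∧ G z = 0) ∧
      (∀ κ, 0 < κ → G κ = 0 → ∃ o, |κ - solitonZero β o| < ε) ∧
      (∀ o κ l, 0 < κ → 0 < l → |κ - solitonZero β o| < r → |l - solitonZero β o| < r →
        c * |κ - l| ≤ |G κ - G l|) := by
  choose c r hr hexp using exists_expansive_solitonJostW hβ hinj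
  obtain ⟨r₀, hr₀, hrle⟩ : ∃ r₀ : ℝ, 0 < r₀ ∧ ∀ o, r₀ ≤ r o := by
    obtain ⟨i, hi⟩ := Finite.exists_min r
    exact ⟨r i, hr i, hi⟩
  obtain ⟨b, hb, hbj⟩ := exists_pos_le hβ
  obtain ⟨M, hM, hMle⟩ : ∃ M : ℝ, 0 < M ∧ ∀ o, |c o| ≤ M := by
    obtain ⟨i, hi⟩ := Finite.exists_max fun o => |c o|
    exact ⟨|c i| + 1, by positivity, fun o => (hi o).trans (by linarith)⟩
  set ρ := min (min r₀ b) 1 with hρ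
  have hρ0 : 0 < ρ := lt_min (lt_min hr₀ hb) one_pos
  have hρr : ρ ≤ r₀ := (min_le_left _ _).trans (min_le_left _ _)
  have hρb : ρ ≤ b := (min_le_left _ _).trans (min_le_right _ _)
  have hρ1 : ρ ≤ 1 := min_le_right _ _
  set m := 2 * ρ * ∏ j, ρ / (2 * β j + ρ) with hm
  have hm0 : 0 < m := by
    refine mul_pos (by positivity) (Finset.prod_pos fun j _ => ?_)
    have := hβ j; positivity
  -- The first entry makes `M η ≤ ε / 4`, so that the perturbation moves a zero by less than `ε`;
  -- the second, with `ε ≤ 1`, makes `η` smaller than the lower bound `m` away from the zeros.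
  refine ⟨ρ, hρ0, min (1 / (4 * M)) (m / 2), by positivity, fun ε η hε hερ hη G hG hG' => ?_⟩
  have hηM : M * η ≤ ε / 4 := by
    have : η ≤ 1 / (4 * M) * ε := hη.trans (by gcongr; exact min_le_left _ _)
    calc M * η ≤ M * (1 / (4 * M) * ε) := by gcongr
      _ = ε / 4 := by field_simp
  have hηm : η < m := by
    have : η ≤ m / 2 * ε := hη.trans (by gcongr; exact min_le_right _ _)
    nlinarith
  have hexpF : ∀ o x y, |x - solitonZero β o| ≤ ρ → |y - solitonZero β o| ≤ ρ → y ≤ x →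
      x - y ≤ c o * (solitonJostW β x - solitonJostW β y) := fun o x y hx hy =>
    hexp o x y (hx.trans (hρr.trans (hrle o))) (hy.trans (hρr.trans (hrle o)))
  have hcη : ∀ o t, |t| ≤ η → |c o * t| ≤ ε / 4 := fun o t ht => by
    rw [abs_mul]
    exact (mul_le_mul (hMle o) ht (abs_nonneg _) hM.le).trans hηM
  have hF0 := solitonJostW_solitonZero hβ hinj
  refine ⟨fun j => ?_, fun κ hκ hκ0 => ?_, ?_⟩
  -- Intermediate value theorem on `[β_j - ε/2, β_j + ε/2]`: expansiveness makes `c o` times the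
  -- soliton function at least `ε/2` in size, with opposite signs at the endpoints, and the
  -- perturbation contributes at most `ε/4`.
  · set o : Option (Fin n) := some j
    have hj := hbj j
    have hp : solitonZero β o = β j := rfl
    have hcont : ContinuousOn (fun κ => c o * G κ) (Set.Icc (β j - ε / 2) (β j + ε / 2)) := by
      have hsub : ∀ κ ∈ Set.Icc (β j - ε / 2) (β j + ε / 2), 0 < κ := fun κ hκ => by
        have := hκ.1; linarith
      have h1 : ContinuousOn (fun κ => G κ - solitonJostW β κ)
          (Set.Icc (β j - ε / 2) (β j + ε / 2)) := by
        refine (LipschitzOnWith.of_dist_le_mul (K := η.toNNReal) fun x hx y hy => ?_).continuousOn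
        rw [Real.dist_eq, Real.dist_eq]
        refine (hG' x y (hsub x hx) (hsub y hy)).trans ?_
        gcongr
        exact Real.le_coe_toNNReal η
      have h2 : ContinuousOn (solitonJostW β) (Set.Icc (β j - ε / 2) (β j + ε / 2)) :=
        fun κ hκ => (contDiffAt_solitonJostW hβ (hsub κ hκ).le).continuousAt.continuousWithinAt
      refine ((continuousOn_const (c := c o)).mul (h1.add h2)).congr fun κ _ => ?_
      simp
    have habs1 : |β j + ε / 2 - solitonZero β o| ≤ ρ := by
      rw [hp, add_sub_cancel_left, abs_of_pos (by positivity)]; linarith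
    have habs2 : |β j - ε / 2 - solitonZero β o| ≤ ρ := by
      rw [hp, abs_sub_comm, sub_sub_cancel, abs_of_pos (by positivity)]; linarith
    have habs3 : |solitonZero β o - solitonZero β o| ≤ ρ := by simp [hρ0.le]
    have hup := hexpF o _ _ habs1 habs3 (by rw [hp]; linarith)
    have hlo := hexpF o _ _ habs3 habs2 (by rw [hp]; linarith)
    rw [hF0, hp] at hup hlo
    have e1 := hcη o _ (hG (β j + ε / 2) (by linarith [hβ j]))
    have e2 := hcη o _ (hG (β j - ε / 2) (by linarith))
    rw [abs_le] at e1 e2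
    have := intermediate_value_Ioo (by linarith) hcont
      (show (0 : ℝ) ∈ Set.Ioo _ _ from ⟨by linarith [e2.2], by linarith [e1.1]⟩)
    obtain ⟨z, hz, hz0⟩ := this
    have hz1 := hz.1
    have hz2 := hz.2
    have hz3 : 0 < z := by linarith
    refine ⟨z, hz3, by rw [abs_lt]; constructor <;> linarith, ?_⟩
    have hc0 : c o ≠ 0 := fun h => by rw [h] at hup; linarith
    exact (mul_eq_zero.mp hz0).resolve_left hc0
  -- A zero within `ρ` of an old one lies within `ε/4` of it by expansiveness. A zero farther from
  -- all of them would contradict the lower bound `m`.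
  · by_contra! hfar
    have h1 := hG κ hκ
    rw [hκ0, zero_sub, abs_neg] at h1
    by_cases hclose : ∃ o, |κ - solitonZero β o| ≤ ρ
    · obtain ⟨o, ho⟩ := hclose
      have h2 := hcη o _ h1
      rw [abs_le] at h2
      have h3 : |solitonZero β o - solitonZero β o| ≤ ρ := by simp [hρ0.le]
      have h4 := hfar o
      rcases le_total (solitonZero β o) κ with h5 | h5
      · have h6 := hexpF o _ _ ho h3 h5
        rw [hF0, sub_zero] at h6
        rw [abs_of_nonneg (sub_nonneg.mpr h5)] at h4
        linarith [h2.2]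
      · have h6 := hexpF o _ _ h3 ho h5
        rw [hF0, zero_sub, mul_neg] at h6
        rw [abs_sub_comm, abs_of_nonneg (sub_nonneg.mpr h5)] at h4
        linarith [h2.1]
    · push Not at hclose
      have := le_abs_solitonJostW hβ hρ0 (fun o => (hclose o).le) hκ
      linarith
  -- Expansiveness survives the perturbation: its increment, multiplied by `c o`, costs at most a
  -- quarter of `κ - l`.
  · have key : ∀ o κ l, 0 < κ → 0 < l → |κ - solitonZero β o| < ρ →
        |l - solitonZero β o| < ρ → l ≤ κ →
        min (1 / (4 * M)) (m / 2) * |κ - l| ≤ |G κ - G l| := by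
      intro o κ l hκ hl hκo hlo hlκ
      have h1 := hexpF o κ l hκo.le hlo.le hlκ
      have h2 := hG' κ l hκ hl
      set t := κ - l with ht
      have ht0 : 0 ≤ t := sub_nonneg.mpr hlκ
      rw [abs_of_nonneg ht0] at h2 ⊢
      set D := (G κ - solitonJostW β κ) - (G l - solitonJostW β l) with hD
      have h3 : |c o * D| ≤ t / 4 := by
        rw [abs_mul]
        refine (mul_le_mul (hMle o) h2 (abs_nonneg _) hM.le).trans ?_
        have : M * η ≤ 1 / 4 := hηM.trans (by linarith)
        nlinarith
      have h4 : c o * (G κ - G l) = c o * D + c o * (solitonJostW β κ - solitonJostW β l) := by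
        rw [hD]; ring
      have h5 : t / 4 ≤ |c o * (G κ - G l)| := by
        refine le_trans ?_ (le_abs_self _)
        rw [h4]; linarith [neg_abs_le (c o * D)]
      have h6 : |c o * (G κ - G l)| ≤ M * |G κ - G l| := by
        rw [abs_mul]; gcongr; exact hMle o
      calc min (1 / (4 * M)) (m / 2) * t ≤ 1 / (4 * M) * t := by gcongr; exact min_le_left _ _
        _ = (t / 4) / M := by field_simp
        _ ≤ |G κ - G l| := by rw [div_le_iff₀ hM]; linarith
    intro o κ l hκ hl hκo hlo
    rcases le_total l κ with h | h
    · exact key o κ l hκ hl hκo hlo h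
    · rw [abs_sub_comm κ l, abs_sub_comm (G κ)]
      exact key o l κ hl hκ hlo hκo h

end Zeros

end KdV

end

noncomputable section

namespace KdV

/-! ### Bound states of perturbed solitons -/

theorem jostW_eq_zero_of_mem_boundStates {u : ℝ → ℝ} (hu : Integrable u) {κ : ℝ}
    (h : κ ∈ boundStates u) : jostW u (Complex.I * κ) = 0 := by
  have hκ : 0 < κ := h.1
  have h1 := (mem_boundStates_iff hu hκ).mp h
  by_contra h0
  rw [(analyticAt_jostW hu (by simpa using hκ)).analyticOrderAt_eq_zero.mpr h0] at h1
  exact zero_ne_one h1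

/-- Expansiveness along the imaginary axis excludes a vanishing complex derivative, so the zero is
simple. -/
theorem mem_boundStates_of_expansive {u : ℝ → ℝ} (hu : Integrable u) {κ c : ℝ} (hκ : 0 < κ)
    (hc : 0 < c) (h0 : jostW u (Complex.I * κ) = 0)
    (h : ∀ᶠ l : ℝ in 𝓝 κ, c * |l - κ| ≤ ‖jostW u (Complex.I * l) - jostW u (Complex.I * κ)‖) :
    κ ∈ boundStates u := by
  have han := analyticAt_jostW hu (k := Complex.I * κ) (by simpa using hκ)
  rw [mem_boundStates_iff hu hκ]
  refine han.analyticOrderAt_eq_one_of_zero_deriv_ne_zero h0 fun hd => ?_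
  have h1 : HasDerivAt (jostW u) 0 (Complex.I * κ) := hd ▸ han.differentiableAt.hasDerivAt
  have h2 : HasDerivAt (fun l : ℝ => Complex.I * (l : ℂ)) Complex.I κ := by
    simpa using (hasDerivAt_id κ).ofReal_comp.const_mul Complex.I
  have h3 : HasDerivAt (fun l : ℝ => jostW u (Complex.I * l)) 0 κ :=
    (HasDerivAt.scomp_of_eq κ h1 h2 rfl).congr_deriv (smul_zero _)
  have h4 := h3.isLittleO.bound (half_pos hc)
  have h5 : ∃ᶠ l in 𝓝[≠] κ, l ∈ ({κ}ᶜ : Set ℝ) :=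
    eventually_mem_nhdsWithin.frequently
  obtain ⟨l, hl, hl1, hl2⟩ := (h5.and_eventually
    ((h.and h4).filter_mono nhdsWithin_le_nhds)).exists
  rw [smul_zero, sub_zero, Real.norm_eq_abs] at hl2
  have : 0 < |l - κ| := abs_pos.mpr (sub_ne_zero.mpr hl)
  nlinarith

/-- The factor `2` comes from `(1 + |x|)² ≤ 2 (1 + |x|²)`. -/
theorem MemL12.isWeighted {v : ℝ → ℝ} (hv : MemL12 v) :
    IsWeighted v ∧ weightedNorm v ≤ 2 * normL12 v := by
  have hv' : Integrable fun x : ℝ => (1 + |x| ^ 2) * v x := hv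
  have hpos : ∀ x : ℝ, 0 < 1 + |x| ^ 2 := fun x => by positivity
  have hmeas : AEStronglyMeasurable v := by
    have h1 : Continuous fun x : ℝ => (1 + |x| ^ 2)⁻¹ :=
      Continuous.inv₀ (by fun_prop) fun x => (hpos x).ne'
    refine (h1.aestronglyMeasurable.mul hv'.aestronglyMeasurable).congr
      (Eventually.of_forall fun x => ?_)
    exact inv_mul_cancel_left₀ (hpos x).ne' _
  have hle : ∀ x, (1 + |x|) ^ 2 * |v x| ≤ 2 * |(1 + |x| ^ 2) * v x| := fun x => by
    rw [abs_mul, abs_of_pos (hpos x), ← mul_assoc]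
    refine mul_le_mul_of_nonneg_right ?_ (abs_nonneg _)
    nlinarith [sq_nonneg (1 - |x|)]
  have hsq : Integrable fun t => (1 + |t|) ^ 2 * |v t| := by
    refine (hv'.abs.const_mul 2).mono' ?_ (Eventually.of_forall fun x => ?_)
    · exact (by fun_prop : Continuous fun t : ℝ => (1 + |t|) ^ 2).aestronglyMeasurable.mul
        hmeas.norm
    · rw [Real.norm_of_nonneg (by positivity)]
      exact hle x
  refine ⟨⟨hv'.mono hmeas (Eventually.of_forall fun x => ?_), hsq⟩, ?_⟩
  · rw [norm_mul, Real.norm_of_nonneg (hpos x).le]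
    nlinarith [norm_nonneg (v x), sq_nonneg |x|, mul_nonneg (sq_nonneg |x|) (norm_nonneg (v x))]
  · rw [weightedNorm, normL12, ← integral_const_mul]
    exact integral_mono hsq (hv'.abs.const_mul 2) hle

section Perturbation

variable {n : ℕ} {β α : Fin n → ℝ}

/-- The zeros of the perturbed Wronskian are the bound states; they lie near `0` or near the
`β_j`, one near each `β_j` and at most one near `0`. -/
theorem exists_boundStates_of_close (hn : 0 < n) (hβpos : ∀ j, 0 < β j) (hβ : StrictMono β)
    (hα : ∀ j, 0 < α j) : ∃ r > 0, ∃ c > 0, ∀ ε : ℝ, 0 < ε → ε ≤ r → ∀ v : ℝ → ℝ, IsWeighted v →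
      weightedNorm v ≤ c * ε →
      (∀ j, ∃ z ∈ boundStates (fun x => nSoliton β α x 0 + v x), |z - β j| < ε) ∧
      (∀ z ∈ boundStates (fun x => nSoliton β α x 0 + v x),
        ∃ o, |z - solitonZero β o| < ε) ∧
      (∀ o, ∀ z ∈ boundStates (fun x => nSoliton β α x 0 + v x),
        ∀ z' ∈ boundStates (fun x => nSoliton β α x 0 + v x),
        |z - solitonZero β o| < ε → |z' - solitonZero β o| < ε → z = z') := by
  obtain ⟨r, hr, c, hc, hmain⟩ := exists_zeros_of_close hβpos hβ.injective
  have hu := isWeighted_nSoliton hβpos hβ hα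
  set u : ℝ → ℝ := fun x => nSoliton β α x 0
  set M := weightedNorm u + 1 with hM
  set K := |wronskianConst M| + 1 with hK
  have hK1 : 1 ≤ K := by rw [hK]; linarith [abs_nonneg (wronskianConst M)]
  have hK0 : 0 < K := one_pos.trans_le hK1
  -- The two `1`s force `weightedNorm v ≤ 1`, hence both norms are at most `M`; `c / K` gives `K δ ≤
  -- c ε` for `exists_zeros_of_close`.
  refine ⟨min r 1, by positivity, min (c / K) 1, by positivity, fun ε hε hεr v hv hδ => ?_⟩
  have hεr' : ε ≤ r := hεr.trans (min_le_left _ _)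
  have hε1 : ε ≤ 1 := hεr.trans (min_le_right _ _)
  set δ := weightedNorm v
  have hδ0 : 0 ≤ δ := weightedNorm_nonneg v
  have hδ1 : δ ≤ 1 := by
    refine hδ.trans ((mul_le_mul_of_nonneg_right (min_le_right _ _) hε.le).trans ?_)
    linarith
  have hη : K * δ ≤ c * ε := by
    calc K * δ ≤ K * (c / K * ε) := by
          gcongr
          exact hδ.trans (mul_le_mul_of_nonneg_right (min_le_left _ _) hε.le)
      _ = c * ε := by field_simp
  have hM1 : weightedNorm u ≤ M := by rw [hM]; linarith
  have hM2 : weightedNorm (fun x => u x + v x) ≤ M := (weightedNorm_add_le hu hv).trans (by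
    rw [hM]; gcongr)
  have hKle : wronskianConst M ≤ K := by rw [hK]; linarith [le_abs_self (wronskianConst M)]
  set w : ℝ → ℝ := fun x => u x + v x with hw
  have hwI : Integrable w := (hu.add hv).1
  set G : ℝ → ℝ := fun κ => 2 * κ + ∫ t, w t * jostR w κ t with hG
  have hGw : ∀ κ : ℝ, 0 < κ → jostW w (Complex.I * κ) = (G κ : ℂ) := fun κ hκ =>
    jostW_eq_ofReal hwI hκ
  have hFu : ∀ κ : ℝ, 0 < κ → jostW u (Complex.I * κ) = (solitonJostW β κ : ℂ) := fun κ hκ =>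
    jostW_nSoliton hn hβpos hβ hα hκ
  have him : ∀ κ : ℝ, 0 < κ → 0 < (Complex.I * (κ : ℂ)).im := fun κ hκ => by simpa using hκ
  have h1 : ∀ κ, 0 < κ → |G κ - solitonJostW β κ| ≤ K * δ := fun κ hκ => by
    have := norm_jostW_add_sub_le (him κ hκ) hu hv hM1 hM2
    rw [← hw, hGw κ hκ, hFu κ hκ, ← Complex.ofReal_sub, Complex.norm_real, Real.norm_eq_abs] at this
    exact this.trans (by gcongr)
  have h2 : ∀ κ l, 0 < κ → 0 < l →
      |(G κ - solitonJostW β κ) - (G l - solitonJostW β l)| ≤ K * δ * |κ - l| := fun κ l hκ hl => by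
    have := norm_jostW_second_diff_le (him κ hκ) (him l hl) hu hv hM1 hM2
    rw [← hw, hGw κ hκ, hFu κ hκ, hGw l hl, hFu l hl, ← Complex.ofReal_sub, ← Complex.ofReal_sub,
      ← Complex.ofReal_sub, Complex.norm_real, Real.norm_eq_abs, ← mul_sub, norm_mul,
      Complex.norm_I, one_mul, ← Complex.ofReal_sub, Complex.norm_real, Real.norm_eq_abs] at this
    exact this.trans (by gcongr)
  obtain ⟨hz1, hz2, hz3⟩ := hmain ε (K * δ) hε hεr' hη G h1 h2
  have hmem : ∀ κ, κ ∈ boundStates w ↔ 0 < κ ∧ G κ = 0 := by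
    intro κ
    constructor
    · intro h
      have h0 := jostW_eq_zero_of_mem_boundStates hwI h
      rw [hGw κ h.1] at h0
      exact ⟨h.1, by exact_mod_cast h0⟩
    · rintro ⟨hκ, h0⟩
      obtain ⟨o, ho⟩ := hz2 κ hκ h0
      have ho' := ho.trans_le hεr'
      refine mem_boundStates_of_expansive hwI hκ hc (by rw [hGw κ hκ, h0]; rfl) ?_
      have hnhds : ∀ᶠ l : ℝ in 𝓝 κ, |l - solitonZero β o| < r :=
        ContinuousAt.eventually_lt (by fun_prop) continuousAt_const ho'
      filter_upwards [hnhds, eventually_gt_nhds hκ] with l hl1 hl2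
      rw [hGw κ hκ, hGw l hl2, ← Complex.ofReal_sub, Complex.norm_real, Real.norm_eq_abs]
      exact hz3 o l κ hl2 hκ hl1 ho'
  refine ⟨fun j => ?_, fun z hz => ?_, fun o z hz z' hz' ho ho' => ?_⟩
  · obtain ⟨z, hz, hzj, hz0⟩ := hz1 j
    exact ⟨z, (hmem z).mpr ⟨hz, hz0⟩, hzj⟩
  · exact hz2 z hz.1 ((hmem z).mp hz).2
  · have := hz3 o z z' hz.1 hz'.1 (ho.trans_le hεr') (ho'.trans_le hεr')
    rw [((hmem z).mp hz).2, ((hmem z').mp hz').2, sub_zero, abs_zero] at this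
    have h3 : |z - z'| = 0 := le_antisymm (by
      by_contra! h
      nlinarith) (abs_nonneg _)
    exact sub_eq_zero.mp (abs_eq_zero.mp h3)

/-- The bound states can be listed, the last `n` of them being near the `β_j`. -/
theorem exists_isBoundStateList (hn : 0 < n) {u : ℝ → ℝ} {ε : ℝ} (hβ : StrictMono β)
    (hε : ε < β ⟨0, hn⟩ / 2) (hsep : ∀ j j' : Fin n, j ≠ j' → ε < |β j - β j'| / 2)
    (h1 : ∀ j, ∃ z ∈ boundStates u, |z - β j| < ε)
    (h2 : ∀ z ∈ boundStates u, ∃ o, |z - solitonZero β o| < ε)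
    (h3 : ∀ o, ∀ z ∈ boundStates u, ∀ z' ∈ boundStates u,
        |z - solitonZero β o| < ε → |z' - solitonZero β o| < ε → z = z') :
    ∃ (μ : ℕ) (b : Fin μ → ℝ) (hμ : n ≤ μ), IsBoundStateList u μ b ∧ μ ≤ n + 1 ∧
      (∀ j : Fin n, |b (topIndex hμ j) - β j| < ε) ∧
      (∀ i : Fin μ, (i : ℕ) < μ - n → |b i| < ε) := by
  choose z hz hzβ using h1
  -- The `β_j` are more than `2ε` apart, so the nearby bound states are in the same order.
  have hzmono : StrictMono z := by
    intro i j hij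
    have e1 := abs_lt.mp (hzβ i)
    have e2 := abs_lt.mp (hzβ j)
    have e3 := hsep j i hij.ne'
    rw [abs_of_pos (sub_pos.mpr (hβ hij))] at e3
    linarith [e1.2, e2.1]
  have hrange : ∀ y ∈ boundStates u, ∀ j : Fin n, |y - β j| < ε → z j = y := fun y hy j hj =>
    h3 (some j) _ (hz j) _ hy (hzβ j) hj
  -- The only possible further bound state is a single one near `0`; it lies below the others
  -- because `ε < β₀ / 2`, and is put in front of the list.
  by_cases hextra : ∃ y ∈ boundStates u, |y - solitonZero β none| < ε
  · obtain ⟨y, hy, hy0⟩ := hextra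
    have hy0' : |y| < ε := by simpa [solitonZero] using hy0
    have hlt : ∀ j, y < z j := fun j => by
      have e1 := abs_lt.mp (hzβ j)
      have e2 := abs_lt.mp hy0'
      have e3 : β ⟨0, hn⟩ ≤ β j := hβ.monotone (Nat.zero_le _)
      linarith [e1.1, e2.2]
    refine ⟨n + 1, Fin.cons y z, Nat.le_succ n,
      ⟨Fin.strictMono_cons.mpr ⟨hlt, hzmono⟩, ?_⟩, le_rfl, fun j => ?_, fun i hi => ?_⟩
    · ext x
      rw [Fin.range_cons]
      constructor
      · rintro (rfl | ⟨j, rfl⟩)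
        · exact hy
        · exact hz j
      · intro hx
        obtain ⟨o, ho⟩ := h2 x hx
        cases o with
        | none => exact Or.inl (h3 none _ hx _ hy ho hy0)
        | some j => exact Or.inr ⟨j, hrange x hx j ho⟩
    · have : topIndex (Nat.le_succ n) j = j.succ := by
        ext; simp [topIndex, add_comm]
      rw [this, Fin.cons_succ]
      exact hzβ j
    · have : i = 0 := by ext; simp at hi ⊢; omega
      rw [this, Fin.cons_zero]
      exact hy0'
  · refine ⟨n, z, le_rfl, ⟨hzmono, ?_⟩, Nat.le_succ n, fun j => ?_, fun i hi => by omega⟩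
    · ext x
      constructor
      · rintro ⟨j, rfl⟩
        exact hz j
      · intro hx
        obtain ⟨o, ho⟩ := h2 x hx
        cases o with
        | none => exact absurd ⟨x, hx, ho⟩ hextra
        | some j => exact ⟨j, hrange x hx j ho⟩
    · have : topIndex (le_refl n) j = j := by ext; simp [topIndex]
      rw [this]
      exact hzβ j

theorem jostW_nSoliton_eq_zero (hn : 0 < n) (hβpos : ∀ j, 0 < β j) (hβ : StrictMono β)
    (hα : ∀ j, 0 < α j) (j : Fin n) :
    jostW (fun x => nSoliton β α x 0) (Complex.I * β j) = 0 := by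
  rw [jostW_nSoliton hn hβpos hβ hα (hβpos j), Finset.prod_eq_zero (Finset.mem_univ j) (by simp)]
  simp

theorem exists_normingConstant_nSoliton_lipschitz (hn : 0 < n) (hβpos : ∀ j, 0 < β j)
    (hβ : StrictMono β) (hα : ∀ j, 0 < α j) :
    ∃ C > 0, ∃ ε₁ > 0, ∀ v : ℝ → ℝ, IsWeighted v → weightedNorm v ≤ ε₁ → ∀ j, ∀ κ : ℝ,
      κ ∈ boundStates (fun x => nSoliton β α x 0 + v x) → |κ - β j| ≤ ε₁ →
      ‖normingConstant (fun x => nSoliton β α x 0 + v x) κ -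
        normingConstant (fun x => nSoliton β α x 0) (β j)‖ ≤ C * (weightedNorm v + |κ - β j|) := by
  have hu := isWeighted_nSoliton hβpos hβ hα
  choose C hC e he h using fun j => exists_normingConstant_lipschitz hu (hβpos j)
    (jostW_nSoliton_eq_zero hn hβpos hβ hα j)
  have : Nonempty (Fin n) := ⟨⟨0, hn⟩⟩
  obtain ⟨i, hi⟩ := Finite.exists_max C
  obtain ⟨i', hi'⟩ := Finite.exists_min e
  refine ⟨C i, hC i, e i', he i', fun v hv hve j κ hκ hκβ => ?_⟩
  refine (h j v hv κ hκ.1 (hve.trans (hi' j)) (hκβ.trans (hi' j))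
    (jostW_eq_zero_of_mem_boundStates (hu.add hv).1 hκ)).trans ?_
  have := weightedNorm_nonneg v
  gcongr
  exact hi j

end Perturbation

end KdV

end

/-! ### The main theorem: choice of the constant -/

theorem mainTheorem3 (n : ℕ) (hn : 0 < n) (β α : Fin n → ℝ)
    (hβpos : ∀ j, 0 < β j) (hβ : StrictMono β) (hα : ∀ j, 0 < α j)
    (σ : ℝ) (hσ : 2 < σ) :
    ∃ C : ℝ, 0 < C ∧
      ∀ ε : ℝ, 0 < ε → ε < β ⟨0, hn⟩ / 2 →
        (∀ j j' : Fin n, j ≠ j' → ε < |β j - β j'| / 2) →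
      ∀ v : ℝ → ℝ, KdV.MemL12 v → KdV.normL12 v ≤ ε ^ σ / C →
        ∃ (μ : ℕ) (b : Fin μ → ℝ) (hμ : n ≤ μ),
          KdV.IsBoundStateList (fun x => KdV.nSoliton β α x 0 + v x) μ b ∧
          (μ : ℤ) ≤ KdV.boundStateBound (fun x => KdV.nSoliton β α x 0) ∧
          (∀ j : Fin n, |b (KdV.topIndex hμ j) - β j| < ε) ∧
          (∀ j : Fin n,
            ‖KdV.normingConstant (fun x => KdV.nSoliton β α x 0 + v x) (b (KdV.topIndex hμ j))
              - KdV.normingConstant (fun x => KdV.nSoliton β α x 0) (β j)‖ < C * ε) ∧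
          (∀ i : Fin μ, (i : ℕ) < μ - n → |b i| < ε) := by
  obtain ⟨r, hr, c, hc, hclose⟩ := KdV.exists_boundStates_of_close hn hβpos hβ hα
  obtain ⟨N, hN, e, he, hnorm⟩ :=
    KdV.exists_normingConstant_nSoliton_lipschitz hn hβpos hβ hα
  set B := β ⟨0, hn⟩ / 2 with hB
  have hB0 : 0 < B := half_pos (hβpos _)
  set ρ := min r e with hρ
  have hρ0 : 0 < ρ := lt_min hr he
  set a := min c 1 with ha
  have ha0 : 0 < a := lt_min hc one_pos
  -- Chosen so that the hypothesis on `v` becomes `δ ≤ a ε'`: the factor `2` compares the norms, `B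
  -- ^ (σ - 1)` absorbs the extra powers of `ε`, and `(B + ρ) / ρ` compares `ε` with `ε'`.
  set D := 2 * B ^ (σ - 1) * (B + ρ) / (ρ * a) with hD
  have hD0 : 0 < D := by positivity
  refine ⟨2 * N + 1 + D, by positivity, fun ε hε hεB hsep v hv hvn => ?_⟩
  obtain ⟨hv', hδ⟩ := hv.isWeighted
  set δ := KdV.weightedNorm v
  -- The perturbation results hold only up to `ρ`, while `ε` may be as large as `B`; they are
  -- applied at the smaller `ε'`, to which `ε` is comparable.
  set ε' := min ε ρ with hε'
  have hε'0 : 0 < ε' := lt_min hε hρ0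
  have hε'ε : ε' ≤ ε := min_le_left _ _
  have hε'ρ : ε' ≤ ρ := min_le_right _ _
  have hεε' : ε ≤ (B + ρ) / ρ * ε' := by
    rw [div_mul_eq_mul_div, le_div_iff₀ hρ0]
    rcases min_choice ε ρ with h | h
    · rw [hε', h]; nlinarith
    · rw [hε', h]; nlinarith
  have hpow : ε ^ σ ≤ B ^ (σ - 1) * ε := by
    have : ε ^ σ = ε ^ (σ - 1) * ε := by
      conv_rhs => rw [← Real.rpow_add_one hε.ne']
      ring_nf
    rw [this]
    gcongr
    linarith
  have hδε : δ ≤ a * ε' := by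
    calc δ ≤ 2 * (ε ^ σ / (2 * N + 1 + D)) := hδ.trans (by gcongr)
      _ ≤ 2 * (B ^ (σ - 1) * ((B + ρ) / ρ * ε') / D) := by
          gcongr
          · exact hpow.trans (by gcongr)
          · linarith
      _ = a * ε' := by rw [hD]; field_simp
  have hδε' : δ ≤ ε' := hδε.trans (by
    have : a ≤ 1 := min_le_right _ _
    nlinarith)
  obtain ⟨h1, h2, h3⟩ := hclose ε' hε'0 (hε'ρ.trans (min_le_left _ _)) v hv'
    (hδε.trans (by gcongr; exact min_le_left _ _))
  obtain ⟨μ, b, hμ, hlist, hμn, hb1, hb2⟩ := KdV.exists_isBoundStateList hn hβ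
    (hε'ε.trans_lt hεB) (fun j j' hj => hε'ε.trans_lt (hsep j j' hj)) h1 h2 h3
  refine ⟨μ, b, hμ, hlist, ?_, fun j => (hb1 j).trans_le hε'ε, fun j => ?_,
    fun i hi => (hb2 i hi).trans_le hε'ε⟩
  · exact (Int.ofNat_le.mpr hμn).trans (KdV.succ_le_boundStateBound_nSoliton hn hβpos hβ hα)
  · have hρe : ρ ≤ e := min_le_right _ _
    have hmem : b (KdV.topIndex hμ j) ∈ KdV.boundStates _ := hlist.2 ▸ Set.mem_range_self _
    have hκ := (hb1 j).le
    refine (hnorm v hv' (hδε'.trans (hε'ρ.trans hρe)) j _ hmem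
      (hκ.trans (hε'ρ.trans hρe))).trans_lt ?_
    -- Both displacements are at most `ε`, which is why `C` contains `2 * N`; its remaining part
    -- makes the inequality strict.
    calc N * (δ + |b (KdV.topIndex hμ j) - β j|) ≤ N * (ε + ε) := by
          gcongr
          · exact hδε'.trans hε'ε
          · exact hκ.trans hε'ε
      _ < (2 * N + 1 + D) * ε := by nlinarith [mul_pos hD0 hε]
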